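/- **Conventions.** Write $\odot$ for the composition of 1-cells of a bicategory in diagrammatic order, with associators $\alpha$ and unitors $\ell, r$. A *shadow* on a bicategory $\mathcal B$ with values in a category $\mathcal B_{Sh}$ consists of functors $\langle\langle-\rangle\rangle\colon \mathcal B(a,a)\to \mathcal B_{Sh}$ for all 0-cells $a$, and isomorphisms (rotators) $\theta\colon \langle\langle M\odot N\rangle\rangle\cong\langle\langle N\odot M\rangle\rangle$, natural in $M\colon a\to b$ and $N\colon b\to a$, satisfying the hexagon axiom with the associators and $\langle\langle \ell\rangle\rangle\circ\theta_{M,I}=\langle\langle r\rangle\rangle$, $\langle\langle r\rangle\rangle\circ\theta_{I,M}=\langle\langle \ell\rangle\rangle$. A *normal lax shadow functor* $(\mathcal C,\mathcal C_{Sh})\to(\mathcal D,\mathcal D_{Sh})$ consists of a lax functor $F\colon\mathcal C\to\mathcal D$ with structure maps $m\colon F(M)\odot F(N)\to F(M\odot N)$ and $i\colon I\to F(I)$, all $i$ being invertible, a functor $H\colon\mathcal C_{Sh}\to\mathcal D_{Sh}$, and maps $s\colon\langle\langle F(M)\rangle\rangle\to H\langle\langle M\rangle\rangle$, natural in the endomorphism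 1-cell $M$, such that $$H(\theta)\circ s\circ\langle\langle m\rangle\rangle=s\circ\langle\langle m\rangle\rangle\circ\theta\colon\ \langle\langle F(M)\odot F(N)\rangle\rangle\longrightarrow H\langle\langle N\odot M\rangle\rangle .$$ A *normal oplax shadow functor* is defined in the same way with $F$ oplax, and with $m$, $i$, $s$ pointing in the opposite direction. **Formal diagrams.** Consider a normal lax shadow functor $(F,H,s)$ and the underlying graph $G$ of $\mathcal C$ (its 0-cells and 1-cells). The free normal lax shadow functor on $G$ has as source the free bicategory on $G$, with its free shadow; its target shadow category $\mathcal E_G$ has as objects the formal expressions $\langle\langle w\rangle\rangle$, for $w$ a closed parenthesized word in units and in terms $F(u)$ with $u$ a 1-cell of the free bicategory on $G$, and $H\langle\langle u\rangle\rangle$, for $u$ an endomorphism 1-cell of the free bicategory on $G$. Its morphisms are generated by associators, unitors and rotators (inside and outside of $F$ and $H$), $m$, $i$, $i^{-1}$ and $s$, subject to the axioms of a bicategory, of a shadow, of a lax functor with invertible unit maps, of functoriality of $H$, and to naturality of $s$ and its compatibility with $\theta$. There is an evaluation functor $\mathcal E_G\to\mathcal D_{Sh}$. A *formal diagram* for $(F,H,s)$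 is a diagram $K\colon J\to\mathcal D_{Sh}$ ($J$ any category) together with a lift of $K$ along it to $\mathcal E_G$. In the oplax case $\mathcal E_G$ is replaced by its opposite. Every formal morphism has an underlying permutation: the bijection that it induces from the occurrences of edges of $G$ in its source to those in its target. The rotators act by the evident rotations and all other generators preserve the list of edges, so this is a cyclic permutation. **Bi-augmented cyclic category.** $\mathbf\Lambda'$ has objects $\underline n$ for $n\ge 0$ and an object $\underline *$; it is generated by cofaces $d^j\colon\underline{n-1}\to\underline{n}$ ($n\ge1$, $1\le j\le n$), codegeneracies $s^j\colon\underline{n+1}\to\underline{n}$ and cycle maps $\tau_{(n)}\colon\underline n\to\underline n$ ($n\geq 1$, $1\le j\le n$), and $t\colon\underline1\to\underline*$, subject to the cosimplicial identities between the $d^j$ and $s^j$, $\tau_{(n)}d^j=d^{j-1}\tau_{(n-1)}$ and $\tau_{(n)}s^j=s^{j-1}\tau_{(n+1)}$ for $2\le j\le n$, $\tau_{(n)}d^1=d^n$, $\tau_{(n)}s^1=s^n(\tau_{(n+1)})^2$, $\tau_{(n)}^n=\mathrm{id}$ and $ts^1=ts^1\tau_{(2)}$. In the comma category $(\underline n\downarrow\mathbf\Lambda')$,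 let $\mathcal I$ be the class of the maps that lie over composites of cofaces (the injective totally ordered maps). **Theorem (coherence for normal (op)lax shadow functors).** 1. Every formal diagram for a normal lax shadow functor in which any two parallel composites have the same underlying permutation commutes. 2. Every formal diagram for a normal oplax shadow functor in which any two parallel composites have the same underlying permutation commutes. 3. For every $n\ge 0$ the localization $(\underline n\downarrow\mathbf\Lambda')[\mathcal I^{-1}]$ is thin, that is, it has at most one morphism between any two objects. -/

import Mathlib

open CategoryTheory

universe w w₁ w₂ v v₁ v₂ t t₁ t₂ t₃ u u₁ u₂

namespace ShadowCoherence

open Category Bicategory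

/-! ## Bicategories with shadow -/

/-- A shadow on a bicategory `B` with values in a category `T` (the shadow category): functors
`sh a : B(a, a) ⥤ T` and natural rotator isomorphisms `⟨⟨f ⊙ g⟩⟩ ≅ ⟨⟨g ⊙ f⟩⟩`, compatible with the
associators and the unitors. -/
structure Shadow (B : Type u) [Bicategory.{w, v} B] (T : Type t) [Category.{t₁} T] where
  sh (a : B) : (a ⟶ a) ⥤ T
  rot {a b : B} (f : a ⟶ b) (g : b ⟶ a) : (sh a).obj (f ≫ g) ≅ (sh b).obj (g ≫ f)
  rot_naturality_left {a b : B} {f f' : a ⟶ b} (η : f ⟶ f') (g : b ⟶ a) :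
    (sh a).map (η ▷ g) ≫ (rot f' g).hom = (rot f g).hom ≫ (sh b).map (g ◁ η)
  rot_naturality_right {a b : B} (f : a ⟶ b) {g g' : b ⟶ a} (η : g ⟶ g') :
    (sh a).map (f ◁ η) ≫ (rot f g').hom = (rot f g).hom ≫ (sh b).map (η ▷ f)
  rot_associator {a b c : B} (f : a ⟶ b) (g : b ⟶ c) (h : c ⟶ a) :
    (rot (f ≫ g) h).hom ≫ (sh c).map (α_ h f g).inv ≫ (rot (h ≫ f) g).hom =
      (sh a).map (α_ f g h).hom ≫ (rot f (g ≫ h)).hom ≫ (sh b).map (α_ g h f).hom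
  rot_leftUnitor {a : B} (f : a ⟶ a) :
    (rot f (𝟙 a)).hom ≫ (sh a).map (λ_ f).hom = (sh a).map (ρ_ f).hom
  rot_rightUnitor {a : B} (f : a ⟶ a) :
    (rot (𝟙 a) f).hom ≫ (sh a).map (ρ_ f).hom = (sh a).map (λ_ f).hom

section ShadowFunctors

variable {C : Type u₁} [Bicategory.{w₁, v₁} C] {TC : Type t} [Category.{t₁} TC]
  {D : Type u₂} [Bicategory.{w₂, v₂} D] {TD : Type t₂} [Category.{t₃} TD]

/-- A normal lax shadow functor `(C, TC) → (D, TD)`: a lax functor `F` with invertible unit maps,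
a functor `H` of shadow categories, and natural shadow commutators `⟨⟨F M⟩⟩ ⟶ H ⟨⟨M⟩⟩`
compatible with the rotators. -/
structure NormalLaxShadowFunctor (SC : Shadow C TC) (SD : Shadow D TD) where
  F : LaxFunctor C D
  isIso_mapId (a : C) : IsIso (F.mapId a)
  H : TC ⥤ TD
  s {a : C} (f : a ⟶ a) : (SD.sh (F.obj a)).obj (F.map f) ⟶ H.obj ((SC.sh a).obj f)
  s_naturality {a : C} {f g : a ⟶ a} (η : f ⟶ g) :
    (SD.sh (F.obj a)).map (F.map₂ η) ≫ s g = s f ≫ H.map ((SC.sh a).map η)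
  s_rot {a b : C} (f : a ⟶ b) (g : b ⟶ a) :
    (SD.sh (F.obj a)).map (F.mapComp f g) ≫ s (f ≫ g) ≫ H.map (SC.rot f g).hom =
      (SD.rot (F.map f) (F.map g)).hom ≫ (SD.sh (F.obj b)).map (F.mapComp g f) ≫ s (g ≫ f)

/-- A normal oplax shadow functor: as above, with the unit maps, the composition maps and the
shadow commutators pointing in the other direction. -/
structure NormalOplaxShadowFunctor (SC : Shadow C TC) (SD : Shadow D TD) where
  F : OplaxFunctor C D
  isIso_mapId (a : C) : IsIso (F.mapId a)
  H : TC ⥤ TD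
  s {a : C} (f : a ⟶ a) : H.obj ((SC.sh a).obj f) ⟶ (SD.sh (F.obj a)).obj (F.map f)
  s_naturality {a : C} {f g : a ⟶ a} (η : f ⟶ g) :
    H.map ((SC.sh a).map η) ≫ s g = s f ≫ (SD.sh (F.obj a)).map (F.map₂ η)
  s_rot {a b : C} (f : a ⟶ b) (g : b ⟶ a) :
    H.map (SC.rot f g).hom ≫ s (g ≫ f) ≫ (SD.sh (F.obj b)).map (F.mapComp g f) =
      s (f ≫ g) ≫ (SD.sh (F.obj a)).map (F.mapComp f g) ≫ (SD.rot (F.map f) (F.map g)).hom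

end ShadowFunctors

/-! ## The free shadow category of a bicategory -/

/-- Objects of the free shadow category of a bicategory `B`: the endomorphism 1-cells of `B`,
written `⟨⟨f⟩⟩`. -/
structure FreeShadow (B : Type u) [Bicategory.{w, v} B] where
  {base : B}
  cell : base ⟶ base

namespace FreeShadow

variable {B : Type u} [Bicategory.{w, v} B]

/-- Words of morphisms of the free shadow category, generated by the 2-cells of `B` and
the rotators. -/
inductive Pre : FreeShadow B → FreeShadow B → Type (max u v w)
  | id (X : FreeShadow B) : Pre X X
  | comp {X Y Z : FreeShadow B} (p : Pre X Y) (q : Pre Y Z) : Pre X Z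
  | sh {a : B} {f g : a ⟶ a} (η : f ⟶ g) : Pre ⟨f⟩ ⟨g⟩
  | rot {a b : B} (f : a ⟶ b) (g : b ⟶ a) : Pre ⟨f ≫ g⟩ ⟨g ≫ f⟩
  | rotInv {a b : B} (f : a ⟶ b) (g : b ⟶ a) : Pre ⟨g ≫ f⟩ ⟨f ≫ g⟩

section

local infixr:65 "⋆" => Pre.comp

/-- Relations between words: the axioms of a category and of a shadow. -/
inductive Rel : ∀ {X Y : FreeShadow B}, Pre X Y → Pre X Y → Prop
  | comp_right {X Y Z} (p : Pre X Y) (q q' : Pre Y Z) : Rel q q' → Rel (p ⋆ q) (p ⋆ q')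
  | comp_left {X Y Z} (p p' : Pre X Y) (q : Pre Y Z) : Rel p p' → Rel (p ⋆ q) (p' ⋆ q)
  | id_comp {X Y} (p : Pre X Y) : Rel (Pre.id X ⋆ p) p
  | comp_id {X Y} (p : Pre X Y) : Rel (p ⋆ Pre.id Y) p
  | assoc {X Y Z W} (p : Pre X Y) (q : Pre Y Z) (r : Pre Z W) : Rel ((p ⋆ q) ⋆ r) (p ⋆ q ⋆ r)
  | sh_id {a : B} (f : a ⟶ a) : Rel (Pre.sh (𝟙 f)) (Pre.id ⟨f⟩)
  | sh_comp {a : B} {f g h : a ⟶ a} (η : f ⟶ g) (θ : g ⟶ h) :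
      Rel (Pre.sh (η ≫ θ)) (Pre.sh η ⋆ Pre.sh θ)
  | rot_rotInv {a b : B} (f : a ⟶ b) (g : b ⟶ a) :
      Rel (Pre.rot f g ⋆ Pre.rotInv f g) (Pre.id ⟨f ≫ g⟩)
  | rotInv_rot {a b : B} (f : a ⟶ b) (g : b ⟶ a) :
      Rel (Pre.rotInv f g ⋆ Pre.rot f g) (Pre.id ⟨g ≫ f⟩)
  | rot_naturality_left {a b : B} {f f' : a ⟶ b} (η : f ⟶ f') (g : b ⟶ a) :
      Rel (Pre.sh (η ▷ g) ⋆ Pre.rot f' g) (Pre.rot f g ⋆ Pre.sh (g ◁ η))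
  | rot_naturality_right {a b : B} (f : a ⟶ b) {g g' : b ⟶ a} (η : g ⟶ g') :
      Rel (Pre.sh (f ◁ η) ⋆ Pre.rot f g') (Pre.rot f g ⋆ Pre.sh (η ▷ f))
  | rot_associator {a b c : B} (f : a ⟶ b) (g : b ⟶ c) (h : c ⟶ a) :
      Rel (Pre.rot (f ≫ g) h ⋆ Pre.sh (α_ h f g).inv ⋆ Pre.rot (h ≫ f) g)
        (Pre.sh (α_ f g h).hom ⋆ Pre.rot f (g ≫ h) ⋆ Pre.sh (α_ g h f).hom)
  | rot_leftUnitor {a : B} (f : a ⟶ a) :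
      Rel (Pre.rot f (𝟙 a) ⋆ Pre.sh (λ_ f).hom) (Pre.sh (ρ_ f).hom)
  | rot_rightUnitor {a : B} (f : a ⟶ a) :
      Rel (Pre.rot (𝟙 a) f ⋆ Pre.sh (ρ_ f).hom) (Pre.sh (λ_ f).hom)

end

instance category : Category (FreeShadow B) where
  Hom X Y := Quot (@Rel B _ X Y)
  id X := Quot.mk _ (Pre.id X)
  comp := Quot.map₂ Pre.comp Rel.comp_right Rel.comp_left
  id_comp := by
    rintro X Y ⟨p⟩
    exact Quot.sound (Rel.id_comp p)
  comp_id := by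
    rintro X Y ⟨p⟩
    exact Quot.sound (Rel.comp_id p)
  assoc := by
    rintro X Y Z W ⟨p⟩ ⟨q⟩ ⟨r⟩
    exact Quot.sound (Rel.assoc p q r)

/-- The universal shadow of `B`. -/
def shadow (B : Type u) [Bicategory.{w, v} B] : Shadow B (FreeShadow B) where
  sh _ :=
    { obj f := ⟨f⟩
      map η := Quot.mk _ (Pre.sh η)
      map_id f := Quot.sound (Rel.sh_id f)
      map_comp η θ := Quot.sound (Rel.sh_comp η θ) }
  rot f g :=
    { hom := Quot.mk _ (Pre.rot f g)
      inv := Quot.mk _ (Pre.rotInv f g)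
      hom_inv_id := Quot.sound (Rel.rot_rotInv f g)
      inv_hom_id := Quot.sound (Rel.rotInv_rot f g) }
  rot_naturality_left η g := Quot.sound (Rel.rot_naturality_left η g)
  rot_naturality_right f _ _ η := Quot.sound (Rel.rot_naturality_right f η)
  rot_associator f g h := Quot.sound (Rel.rot_associator f g h)
  rot_leftUnitor f := Quot.sound (Rel.rot_leftUnitor f)
  rot_rightUnitor f := Quot.sound (Rel.rot_rightUnitor f)

variable {T : Type t} [Category.{t₁} T] (S : Shadow B T)

/-- Evaluation of a word of the free shadow category in a given shadow. -/
def Pre.eval : ∀ {X Y : FreeShadow B}, Pre X Y → ((S.sh X.base).obj X.cell ⟶ (S.sh Y.base).obj Y.cell)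
  | _, _, .id _ => 𝟙 _
  | _, _, .comp p q => p.eval ≫ q.eval
  | _, _, .sh η => (S.sh _).map η
  | _, _, .rot f g => (S.rot f g).hom
  | _, _, .rotInv f g => (S.rot f g).inv

theorem Pre.eval_congr {X Y : FreeShadow B} {p q : Pre X Y} (h : Rel p q) :
    p.eval S = q.eval S := by
  induction h with
  | comp_right p q q' _ ih => simp [Pre.eval, ih]
  | comp_left p p' q _ ih => simp [Pre.eval, ih]
  | rot_naturality_left η g => exact S.rot_naturality_left η g
  | rot_naturality_right f η => exact S.rot_naturality_right f η
  | rot_associator f g h => exact S.rot_associator f g h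
  | rot_leftUnitor f => exact S.rot_leftUnitor f
  | rot_rightUnitor f => exact S.rot_rightUnitor f
  | _ => simp [Pre.eval]

/-- A shadow on `B` extends uniquely to a functor on the free shadow category. -/
def lift : FreeShadow B ⥤ T where
  obj X := (S.sh X.base).obj X.cell
  map := Quot.lift (Pre.eval S) fun _ _ h => Pre.eval_congr S h
  map_id _ := rfl
  map_comp := by
    rintro X Y Z ⟨p⟩ ⟨q⟩
    rfl

end FreeShadow

/-! ## The target bicategory of the free normal lax functor on a graph -/

/-- The 0-cells are the vertices of the graph. -/
def FreeNormalLax (V : Type u) := V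

namespace FreeNormalLax

section

variable {V : Type u} [Quiver.{v} V]

/-- 1-cells: parenthesized words in formal units and in the symbols `F(w)`, for `w` a 1-cell of
the free bicategory on the graph. -/
inductive Hom : V → V → Type (max u v)
  | app {a b : V} (w : FreeBicategory.Hom a b) : Hom a b
  | id (a : V) : Hom a a
  | comp {a b c : V} (f : Hom a b) (g : Hom b c) : Hom a c

instance categoryStruct : CategoryStruct.{max u v} (FreeNormalLax V) where
  Hom := fun a b : V => Hom a b
  id := fun a : V => Hom.id a
  comp := @fun _ _ _ => Hom.comp

/-- Words of 2-cells. The 2-cells of the free bicategory (composites of associators and unitors)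
are applied inside the symbols `F(w)`. -/
inductive Hom₂ : ∀ {a b : FreeNormalLax V}, (a ⟶ b) → (a ⟶ b) → Type (max u v)
  | id {a b} (f : a ⟶ b) : Hom₂ f f
  | vcomp {a b} {f g h : a ⟶ b} (η : Hom₂ f g) (θ : Hom₂ g h) : Hom₂ f h
  | whiskerLeft {a b c} (f : a ⟶ b) {g h : b ⟶ c} (η : Hom₂ g h) : Hom₂ (f ≫ g) (f ≫ h)
  | whiskerRight {a b c} {f g : a ⟶ b} (h : b ⟶ c) (η : Hom₂ f g) : Hom₂ (f ≫ h) (g ≫ h)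
  | associator {a b c d} (f : a ⟶ b) (g : b ⟶ c) (h : c ⟶ d) : Hom₂ ((f ≫ g) ≫ h) (f ≫ g ≫ h)
  | associatorInv {a b c d} (f : a ⟶ b) (g : b ⟶ c) (h : c ⟶ d) :
      Hom₂ (f ≫ g ≫ h) ((f ≫ g) ≫ h)
  | rightUnitor {a b} (f : a ⟶ b) : Hom₂ (f ≫ 𝟙 b) f
  | rightUnitorInv {a b} (f : a ⟶ b) : Hom₂ f (f ≫ 𝟙 b)
  | leftUnitor {a b} (f : a ⟶ b) : Hom₂ (𝟙 a ≫ f) f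
  | leftUnitorInv {a b} (f : a ⟶ b) : Hom₂ f (𝟙 a ≫ f)
  | map₂ {a b : FreeBicategory V} {f g : a ⟶ b} (η : f ⟶ g) :
      Hom₂ (Hom.app (V := V) f) (Hom.app (V := V) g)
  | mapId (a : FreeNormalLax V) : Hom₂ (𝟙 a) (Hom.app (V := V) (FreeBicategory.Hom.id (B := V) a))
  | mapIdInv (a : FreeNormalLax V) : Hom₂ (Hom.app (V := V) (FreeBicategory.Hom.id (B := V) a)) (𝟙 a)
  | mapComp {a b c : FreeBicategory V} (f : a ⟶ b) (g : b ⟶ c) :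
      Hom₂ ((Hom.app (V := V) f).comp (Hom.app g)) (Hom.app (V := V) (f ≫ g))

section

local infixr:65 "⋆" => Hom₂.vcomp
local infixr:81 "◁ₚ" => Hom₂.whiskerLeft
local notation:81 η "▷ₚ" h:82 => Hom₂.whiskerRight h η

/-- Relations between words of 2-cells: the axioms of a bicategory and of a lax functor with
invertible unit maps. -/
inductive Rel : ∀ {a b : FreeNormalLax V} {f g : a ⟶ b}, Hom₂ f g → Hom₂ f g → Prop
  | vcomp_right {a b} {f g h : Hom a b} (η : Hom₂ f g) (θ₁ θ₂ : Hom₂ g h) :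
      Rel θ₁ θ₂ → Rel (η ⋆ θ₁) (η ⋆ θ₂)
  | vcomp_left {a b} {f g h : Hom a b} (η₁ η₂ : Hom₂ f g) (θ : Hom₂ g h) :
      Rel η₁ η₂ → Rel (η₁ ⋆ θ) (η₂ ⋆ θ)
  | id_comp {a b} {f g : Hom a b} (η : Hom₂ f g) : Rel (Hom₂.id f ⋆ η) η
  | comp_id {a b} {f g : Hom a b} (η : Hom₂ f g) : Rel (η ⋆ Hom₂.id g) η
  | assoc {a b} {f g h i : Hom a b} (η : Hom₂ f g) (θ : Hom₂ g h) (ι : Hom₂ h i) :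
      Rel ((η ⋆ θ) ⋆ ι) (η ⋆ θ ⋆ ι)
  | whiskerLeft {a b c} (f : Hom a b) (g h : Hom b c) (η η' : Hom₂ g h) :
      Rel η η' → Rel (f ◁ₚ η) (f ◁ₚ η')
  | whiskerLeft_id {a b c} (f : Hom a b) (g : Hom b c) :
      Rel (f ◁ₚ Hom₂.id g) (Hom₂.id (f.comp g))
  | whiskerLeft_comp {a b c} (f : Hom a b) {g h i : Hom b c} (η : Hom₂ g h) (θ : Hom₂ h i) :
      Rel (f ◁ₚ (η ⋆ θ)) (f ◁ₚ η ⋆ f ◁ₚ θ)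
  | id_whiskerLeft {a b} {f g : Hom a b} (η : Hom₂ f g) :
      Rel (Hom.id a ◁ₚ η) (Hom₂.leftUnitor f ⋆ η ⋆ Hom₂.leftUnitorInv g)
  | comp_whiskerLeft {a b c d} (f : Hom a b) (g : Hom b c) {h h' : Hom c d} (η : Hom₂ h h') :
      Rel (f.comp g ◁ₚ η)
        (Hom₂.associator f g h ⋆ f ◁ₚ g ◁ₚ η ⋆ Hom₂.associatorInv f g h')
  | whiskerRight {a b c} (f g : Hom a b) (h : Hom b c) (η η' : Hom₂ f g) :
      Rel η η' → Rel (η ▷ₚ h) (η' ▷ₚ h)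
  | id_whiskerRight {a b c} (f : Hom a b) (g : Hom b c) :
      Rel (Hom₂.id f ▷ₚ g) (Hom₂.id (f.comp g))
  | comp_whiskerRight {a b c} {f g h : Hom a b} (i : Hom b c) (η : Hom₂ f g) (θ : Hom₂ g h) :
      Rel ((η ⋆ θ) ▷ₚ i) (η ▷ₚ i ⋆ θ ▷ₚ i)
  | whiskerRight_id {a b} {f g : Hom a b} (η : Hom₂ f g) :
      Rel (η ▷ₚ Hom.id b) (Hom₂.rightUnitor f ⋆ η ⋆ Hom₂.rightUnitorInv g)
  | whiskerRight_comp {a b c d} {f f' : Hom a b} (g : Hom b c) (h : Hom c d) (η : Hom₂ f f') :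
      Rel (η ▷ₚ g.comp h)
        (Hom₂.associatorInv f g h ⋆ (η ▷ₚ g) ▷ₚ h ⋆ Hom₂.associator f' g h)
  | whisker_assoc {a b c d} (f : Hom a b) {g g' : Hom b c} (η : Hom₂ g g') (h : Hom c d) :
      Rel ((f ◁ₚ η) ▷ₚ h)
        (Hom₂.associator f g h ⋆ f ◁ₚ (η ▷ₚ h) ⋆ Hom₂.associatorInv f g' h)
  | whisker_exchange {a b c} {f g : Hom a b} {h i : Hom b c} (η : Hom₂ f g) (θ : Hom₂ h i) :
      Rel (f ◁ₚ θ ⋆ η ▷ₚ i) (η ▷ₚ h ⋆ g ◁ₚ θ)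
  | associator_hom_inv {a b c d} (f : Hom a b) (g : Hom b c) (h : Hom c d) :
      Rel (Hom₂.associator f g h ⋆ Hom₂.associatorInv f g h) (Hom₂.id ((f.comp g).comp h))
  | associator_inv_hom {a b c d} (f : Hom a b) (g : Hom b c) (h : Hom c d) :
      Rel (Hom₂.associatorInv f g h ⋆ Hom₂.associator f g h) (Hom₂.id (f.comp (g.comp h)))
  | leftUnitor_hom_inv {a b} (f : Hom a b) :
      Rel (Hom₂.leftUnitor f ⋆ Hom₂.leftUnitorInv f) (Hom₂.id ((Hom.id a).comp f))
  | leftUnitor_inv_hom {a b} (f : Hom a b) :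
      Rel (Hom₂.leftUnitorInv f ⋆ Hom₂.leftUnitor f) (Hom₂.id f)
  | rightUnitor_hom_inv {a b} (f : Hom a b) :
      Rel (Hom₂.rightUnitor f ⋆ Hom₂.rightUnitorInv f) (Hom₂.id (f.comp (Hom.id b)))
  | rightUnitor_inv_hom {a b} (f : Hom a b) :
      Rel (Hom₂.rightUnitorInv f ⋆ Hom₂.rightUnitor f) (Hom₂.id f)
  | pentagon {a b c d e} (f : Hom a b) (g : Hom b c) (h : Hom c d) (i : Hom d e) :
      Rel (Hom₂.associator f g h ▷ₚ i ⋆ Hom₂.associator f (g.comp h) i ⋆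
          f ◁ₚ Hom₂.associator g h i)
        (Hom₂.associator (f.comp g) h i ⋆ Hom₂.associator f g (h.comp i))
  | triangle {a b c} (f : Hom a b) (g : Hom b c) :
      Rel (Hom₂.associator f (Hom.id b) g ⋆ f ◁ₚ Hom₂.leftUnitor g) (Hom₂.rightUnitor f ▷ₚ g)
  | map₂_id {a b : FreeBicategory V} (f : a ⟶ b) : Rel (Hom₂.map₂ (𝟙 f)) (Hom₂.id (Hom.app f))
  | map₂_comp {a b : FreeBicategory V} {f g h : a ⟶ b} (η : f ⟶ g) (θ : g ⟶ h) :
      Rel (Hom₂.map₂ (η ≫ θ)) (Hom₂.map₂ η ⋆ Hom₂.map₂ θ)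
  | mapId_hom_inv (a : V) : Rel (Hom₂.mapId a ⋆ Hom₂.mapIdInv a) (Hom₂.id (Hom.id a))
  | mapId_inv_hom (a : V) :
      Rel (Hom₂.mapIdInv a ⋆ Hom₂.mapId a) (Hom₂.id (Hom.app (FreeBicategory.Hom.id (B := V) a)))
  | mapComp_naturality_left {a b c : FreeBicategory V} {f f' : a ⟶ b} (η : f ⟶ f')
      (g : b ⟶ c) :
      Rel (Hom₂.mapComp f g ⋆ Hom₂.map₂ (η ▷ g))
        (Hom₂.map₂ η ▷ₚ Hom.app g ⋆ Hom₂.mapComp f' g)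
  | mapComp_naturality_right {a b c : FreeBicategory V} (f : a ⟶ b) {g g' : b ⟶ c}
      (η : g ⟶ g') :
      Rel (Hom₂.mapComp f g ⋆ Hom₂.map₂ (f ◁ η))
        (Hom.app f ◁ₚ Hom₂.map₂ η ⋆ Hom₂.mapComp f g')
  | map₂_associator {a b c d : FreeBicategory V} (f : a ⟶ b) (g : b ⟶ c) (h : c ⟶ d) :
      Rel (Hom₂.mapComp f g ▷ₚ Hom.app h ⋆ Hom₂.mapComp (f ≫ g) h ⋆ Hom₂.map₂ (α_ f g h).hom)
        (Hom₂.associator (Hom.app f) (Hom.app g) (Hom.app h) ⋆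
          Hom.app f ◁ₚ Hom₂.mapComp g h ⋆ Hom₂.mapComp f (g ≫ h))
  | map₂_leftUnitor {a b : FreeBicategory V} (f : a ⟶ b) :
      Rel (Hom₂.map₂ (λ_ f).inv)
        (Hom₂.leftUnitorInv (Hom.app f) ⋆ Hom₂.mapId a ▷ₚ Hom.app f ⋆ Hom₂.mapComp (𝟙 a) f)
  | map₂_rightUnitor {a b : FreeBicategory V} (f : a ⟶ b) :
      Rel (Hom₂.map₂ (ρ_ f).inv)
        (Hom₂.rightUnitorInv (Hom.app f) ⋆ Hom.app f ◁ₚ Hom₂.mapId b ⋆ Hom₂.mapComp f (𝟙 b))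

end

instance homCategory (a b : FreeNormalLax V) : Category (a ⟶ b) where
  Hom f g := Quot (@Rel V _ a b f g)
  id f := Quot.mk _ (Hom₂.id f)
  comp := Quot.map₂ Hom₂.vcomp Rel.vcomp_right Rel.vcomp_left
  id_comp := by
    rintro f g ⟨η⟩
    exact Quot.sound (Rel.id_comp η)
  comp_id := by
    rintro f g ⟨η⟩
    exact Quot.sound (Rel.comp_id η)
  assoc := by
    rintro f g h i ⟨η⟩ ⟨θ⟩ ⟨ι⟩
    exact Quot.sound (Rel.assoc η θ ι)

instance bicategory : Bicategory (FreeNormalLax V) where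
  homCategory := fun a b => homCategory a b
  whiskerLeft := @fun _ _ _ f g h η => Quot.map (Hom₂.whiskerLeft f) (Rel.whiskerLeft f g h) η
  whiskerRight := @fun _ _ _ f g η h => Quot.map (Hom₂.whiskerRight h) (Rel.whiskerRight f g h) η
  associator f g h :=
    { hom := Quot.mk _ (Hom₂.associator f g h)
      inv := Quot.mk _ (Hom₂.associatorInv f g h)
      hom_inv_id := Quot.sound (Rel.associator_hom_inv f g h)
      inv_hom_id := Quot.sound (Rel.associator_inv_hom f g h) }
  leftUnitor f :=
    { hom := Quot.mk _ (Hom₂.leftUnitor f)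
      inv := Quot.mk _ (Hom₂.leftUnitorInv f)
      hom_inv_id := Quot.sound (Rel.leftUnitor_hom_inv f)
      inv_hom_id := Quot.sound (Rel.leftUnitor_inv_hom f) }
  rightUnitor f :=
    { hom := Quot.mk _ (Hom₂.rightUnitor f)
      inv := Quot.mk _ (Hom₂.rightUnitorInv f)
      hom_inv_id := Quot.sound (Rel.rightUnitor_hom_inv f)
      inv_hom_id := Quot.sound (Rel.rightUnitor_inv_hom f) }
  whiskerLeft_id f g := Quot.sound (Rel.whiskerLeft_id f g)
  whiskerLeft_comp := by
    rintro a b c f g h i ⟨η⟩ ⟨θ⟩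
    exact Quot.sound (Rel.whiskerLeft_comp f η θ)
  id_whiskerLeft := by
    rintro a b f g ⟨η⟩
    exact Quot.sound (Rel.id_whiskerLeft η)
  comp_whiskerLeft := by
    rintro a b c d f g h h' ⟨η⟩
    exact Quot.sound (Rel.comp_whiskerLeft f g η)
  id_whiskerRight f g := Quot.sound (Rel.id_whiskerRight f g)
  comp_whiskerRight := by
    rintro a b c f g h ⟨η⟩ ⟨θ⟩ i
    exact Quot.sound (Rel.comp_whiskerRight i η θ)
  whiskerRight_id := by
    rintro a b f g ⟨η⟩
    exact Quot.sound (Rel.whiskerRight_id η)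
  whiskerRight_comp := by
    rintro a b c d f f' ⟨η⟩ g h
    exact Quot.sound (Rel.whiskerRight_comp g h η)
  whisker_assoc := by
    rintro a b c d f g g' ⟨η⟩ h
    exact Quot.sound (Rel.whisker_assoc f η h)
  whisker_exchange := by
    rintro a b c f g h i ⟨η⟩ ⟨θ⟩
    exact Quot.sound (Rel.whisker_exchange η θ)
  pentagon f g h i := Quot.sound (Rel.pentagon f g h i)
  triangle f g := Quot.sound (Rel.triangle f g)

/-- The universal normal lax functor on a graph. -/
def laxFunctor (V : Type u) [Quiver.{v} V] : LaxFunctor (FreeBicategory V) (FreeNormalLax V) where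
  obj a := a
  map f := Hom.app f
  map₂ η := Quot.mk _ (Hom₂.map₂ η)
  map₂_id f := Quot.sound (Rel.map₂_id f)
  map₂_comp η θ := Quot.sound (Rel.map₂_comp η θ)
  mapId a := Quot.mk _ (Hom₂.mapId a)
  mapComp f g := Quot.mk _ (Hom₂.mapComp f g)
  mapComp_naturality_left η g := Quot.sound (Rel.mapComp_naturality_left η g)
  mapComp_naturality_right f _ _ η := Quot.sound (Rel.mapComp_naturality_right f η)
  map₂_associator f g h := Quot.sound (Rel.map₂_associator f g h)
  map₂_leftUnitor f := Quot.sound (Rel.map₂_leftUnitor f)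
  map₂_rightUnitor f := Quot.sound (Rel.map₂_rightUnitor f)

end

/-! ### Evaluation in the target of a normal lax functor -/

section Eval

variable {C : Type u₁} [Bicategory.{w₁, v₁} C] {D : Type u₂} [Bicategory.{w₂, v₂} D]

/-- Evaluation of words of the free bicategory on the underlying graph of `C`. -/
abbrev counit (C : Type u₁) [Bicategory.{w₁, v₁} C] : Pseudofunctor (FreeBicategory C) C :=
  FreeBicategory.lift (Prefunctor.id C)

/-- Every 2-cell of the free bicategory is invertible. -/
theorem isIso_free {V : Type u} [Quiver.{v} V] {a b : FreeBicategory V} {f g : a ⟶ b}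
    (η : f ⟶ g) : IsIso η := by
  suffices h : ∀ p : FreeBicategory.Hom₂ f g, IsIso (FreeBicategory.Hom₂.mk p) by
    obtain ⟨p⟩ := η
    exact h p
  clear η
  intro p
  induction p with
  | id f => exact inferInstanceAs (IsIso (𝟙 f))
  | vcomp η θ h₁ h₂ =>
    exact @IsIso.comp_isIso _ _ _ _ _ (FreeBicategory.Hom₂.mk η) (FreeBicategory.Hom₂.mk θ) h₁ h₂
  | whisker_left f η h =>
    exact @whiskerLeft_isIso _ _ _ _ _ f _ _ (FreeBicategory.Hom₂.mk η) h
  | whisker_right f η h =>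
    exact @whiskerRight_isIso _ _ _ _ _ _ _ (FreeBicategory.Hom₂.mk η) f h
  | associator f g h => exact inferInstanceAs (IsIso (α_ f g h).hom)
  | associator_inv f g h => exact inferInstanceAs (IsIso (α_ f g h).inv)
  | right_unitor f => exact inferInstanceAs (IsIso (ρ_ f).hom)
  | right_unitor_inv f => exact inferInstanceAs (IsIso (ρ_ f).inv)
  | left_unitor f => exact inferInstanceAs (IsIso (λ_ f).hom)
  | left_unitor_inv f => exact inferInstanceAs (IsIso (λ_ f).inv)

theorem counit_whiskerLeft {a b c : FreeBicategory C} (f : a ⟶ b) {g g' : b ⟶ c} (η : g ⟶ g') :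
    (counit C).map₂ (f ◁ η) = (counit C).map f ◁ (counit C).map₂ η := by
  obtain ⟨p⟩ := η
  rfl

theorem counit_whiskerRight {a b c : FreeBicategory C} {f f' : a ⟶ b} (η : f ⟶ f') (g : b ⟶ c) :
    (counit C).map₂ (η ▷ g) = (counit C).map₂ η ▷ (counit C).map g := by
  obtain ⟨p⟩ := η
  rfl

/-- The inverse of a 2-cell of the free bicategory. -/
noncomputable def invFree {V : Type u} [Quiver.{v} V] {a b : FreeBicategory V} {f g : a ⟶ b}
    (η : f ⟶ g) : g ⟶ f :=
  @inv _ _ _ _ η (isIso_free η)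

theorem invFree_eq {V : Type u} [Quiver.{v} V] {a b : FreeBicategory V} {f g : a ⟶ b}
    {η : f ⟶ g} {θ : g ⟶ f} (h : η ≫ θ = 𝟙 f) : invFree η = θ :=
  @IsIso.inv_eq_of_hom_inv_id _ _ _ _ η (isIso_free η) θ h

theorem hom_invFree {V : Type u} [Quiver.{v} V] {a b : FreeBicategory V} {f g : a ⟶ b}
    (η : f ⟶ g) : η ≫ invFree η = 𝟙 f :=
  @IsIso.hom_inv_id _ _ _ _ η (isIso_free η)

theorem invFree_id {V : Type u} [Quiver.{v} V] {a b : FreeBicategory V} (f : a ⟶ b) :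
    invFree (𝟙 f) = 𝟙 f := invFree_eq (by simp)

theorem invFree_comp {V : Type u} [Quiver.{v} V] {a b : FreeBicategory V} {f g h : a ⟶ b}
    (η : f ⟶ g) (θ : g ⟶ h) : invFree (η ≫ θ) = invFree θ ≫ invFree η :=
  invFree_eq (by
    rw [Category.assoc, ← Category.assoc θ, hom_invFree, Category.id_comp, hom_invFree])

theorem invFree_whiskerRight {V : Type u} [Quiver.{v} V] {a b c : FreeBicategory V}
    {f f' : a ⟶ b} (η : f ⟶ f') (g : b ⟶ c) : invFree (η ▷ g) = invFree η ▷ g :=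
  invFree_eq (by rw [← comp_whiskerRight, hom_invFree, id_whiskerRight])

theorem invFree_whiskerLeft {V : Type u} [Quiver.{v} V] {a b c : FreeBicategory V}
    (f : a ⟶ b) {g g' : b ⟶ c} (η : g ⟶ g') : invFree (f ◁ η) = f ◁ invFree η :=
  invFree_eq (by rw [← whiskerLeft_comp, hom_invFree, whiskerLeft_id])

theorem invFree_hom {V : Type u} [Quiver.{v} V] {a b : FreeBicategory V} {f g : a ⟶ b}
    (i : f ≅ g) : invFree i.hom = i.inv := invFree_eq (by simp)

theorem invFree_inv {V : Type u} [Quiver.{v} V] {a b : FreeBicategory V} {f g : a ⟶ b}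
    (i : f ≅ g) : invFree i.inv = i.hom := invFree_eq (by simp)

/-- Evaluation of 1-cells: units and products go to units and products, and the symbol `F(w)`
goes to the value of `F` on the value of `w`. -/
def Hom.eval (F : PrelaxFunctor C D) : ∀ {a b : C}, Hom a b → (F.obj a ⟶ F.obj b)
  | _, _, .app w => F.map ((counit C).map w)
  | _, _, .id a => 𝟙 (F.obj a)
  | _, _, .comp f g => f.eval F ≫ g.eval F

section Lax

variable (F : LaxFunctor C D) (hF : ∀ a, IsIso (F.mapId a))

/-- Evaluation of words of 2-cells in the target of a normal lax functor. -/
noncomputable def Hom₂.eval : ∀ {a b : FreeNormalLax C} {f g : a ⟶ b}, Hom₂ f g →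
    (Hom.eval F.toPrelaxFunctor f ⟶ Hom.eval F.toPrelaxFunctor g)
  | _, _, _, _, .id _ => 𝟙 _
  | _, _, _, _, .vcomp η θ => η.eval ≫ θ.eval
  | _, _, _, _, .whiskerLeft f η => Hom.eval F.toPrelaxFunctor f ◁ η.eval
  | _, _, _, _, .whiskerRight h η => η.eval ▷ Hom.eval F.toPrelaxFunctor h
  | _, _, _, _, .associator _ _ _ => (α_ _ _ _).hom
  | _, _, _, _, .associatorInv _ _ _ => (α_ _ _ _).inv
  | _, _, _, _, .rightUnitor _ => (ρ_ _).hom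
  | _, _, _, _, .rightUnitorInv _ => (ρ_ _).inv
  | _, _, _, _, .leftUnitor _ => (λ_ _).hom
  | _, _, _, _, .leftUnitorInv _ => (λ_ _).inv
  | _, _, _, _, .map₂ η => F.map₂ ((counit C).map₂ η)
  | _, _, _, _, .mapId a => F.mapId a
  | _, _, _, _, .mapIdInv a => @inv _ _ _ _ (F.mapId a) (hF a)
  | _, _, _, _, .mapComp f g => F.mapComp ((counit C).map f) ((counit C).map g)

theorem Hom₂.eval_congr {a b : FreeNormalLax C} {f g : a ⟶ b} {η θ : Hom₂ f g} (h : Rel η θ) :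
    η.eval F hF = θ.eval F hF := by
  induction h with
  | vcomp_right η θ₁ θ₂ _ ih => simp only [eval, ih]
  | vcomp_left η θ₁ θ₂ _ ih => simp only [eval, ih]
  | whiskerLeft f g h η η' _ ih => exact congrArg (Hom.eval F.toPrelaxFunctor f ◁ ·) ih
  | whiskerRight f g h η η' _ ih => exact congrArg (· ▷ Hom.eval F.toPrelaxFunctor h) ih
  | id_comp η => exact Category.id_comp _
  | comp_id η => exact Category.comp_id _
  | assoc η θ ι => exact Category.assoc _ _ _
  | whiskerLeft_id f g => exact Bicategory.whiskerLeft_id _ _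
  | whiskerLeft_comp f η θ => exact Bicategory.whiskerLeft_comp _ _ _
  | id_whiskerLeft η => exact Bicategory.id_whiskerLeft _
  | comp_whiskerLeft f g η => exact Bicategory.comp_whiskerLeft _ _ _
  | id_whiskerRight f g => exact Bicategory.id_whiskerRight _ _
  | comp_whiskerRight i η θ => exact Bicategory.comp_whiskerRight _ _ _
  | whiskerRight_id η => exact Bicategory.whiskerRight_id _
  | whiskerRight_comp g h η => exact Bicategory.whiskerRight_comp _ _ _
  | whisker_assoc f η h => exact Bicategory.whisker_assoc _ _ _
  | whisker_exchange η θ => exact Bicategory.whisker_exchange _ _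
  | associator_hom_inv f g h => exact Iso.hom_inv_id _
  | associator_inv_hom f g h => exact Iso.inv_hom_id _
  | leftUnitor_hom_inv f => exact Iso.hom_inv_id _
  | leftUnitor_inv_hom f => exact Iso.inv_hom_id _
  | rightUnitor_hom_inv f => exact Iso.hom_inv_id _
  | rightUnitor_inv_hom f => exact Iso.inv_hom_id _
  | pentagon f g h i => exact Bicategory.pentagon _ _ _ _
  | triangle f g => exact Bicategory.triangle _ _
  | map₂_id f =>
    exact (congrArg F.map₂ ((counit C).map₂_id f)).trans (F.map₂_id _)
  | map₂_comp η θ =>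
    exact (congrArg F.map₂ ((counit C).map₂_comp η θ)).trans (F.map₂_comp _ _)
  | mapId_hom_inv a => exact @IsIso.hom_inv_id _ _ _ _ (F.mapId a) (hF a)
  | mapId_inv_hom a => exact @IsIso.inv_hom_id _ _ _ _ (F.mapId a) (hF a)
  | mapComp_naturality_left η g =>
    simp only [eval, counit_whiskerRight]
    exact F.mapComp_naturality_left ((counit C).map₂ η) ((counit C).map g)
  | mapComp_naturality_right f η =>
    simp only [eval, counit_whiskerLeft]
    exact F.mapComp_naturality_right ((counit C).map f) ((counit C).map₂ η)
  | map₂_associator f g h =>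
    exact F.map₂_associator ((counit C).map f) ((counit C).map g) ((counit C).map h)
  | map₂_leftUnitor f => exact F.map₂_leftUnitor ((counit C).map f)
  | map₂_rightUnitor f => exact F.map₂_rightUnitor ((counit C).map f)

end Lax

section Oplax

variable (F : OplaxFunctor C D) (hF : ∀ a, IsIso (F.mapId a))

/-- Evaluation of words of 2-cells in the target of a normal oplax functor. It reverses the
direction: the composition maps of the free normal lax functor, read backwards, are those of an
oplax functor. -/
noncomputable def Hom₂.evalOp : ∀ {a b : FreeNormalLax C} {f g : a ⟶ b}, Hom₂ f g →
    (Hom.eval F.toPrelaxFunctor g ⟶ Hom.eval F.toPrelaxFunctor f)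
  | _, _, _, _, .id _ => 𝟙 _
  | _, _, _, _, .vcomp η θ => θ.evalOp ≫ η.evalOp
  | _, _, _, _, .whiskerLeft f η => Hom.eval F.toPrelaxFunctor f ◁ η.evalOp
  | _, _, _, _, .whiskerRight h η => η.evalOp ▷ Hom.eval F.toPrelaxFunctor h
  | _, _, _, _, .associator _ _ _ => (α_ _ _ _).inv
  | _, _, _, _, .associatorInv _ _ _ => (α_ _ _ _).hom
  | _, _, _, _, .rightUnitor _ => (ρ_ _).inv
  | _, _, _, _, .rightUnitorInv _ => (ρ_ _).hom
  | _, _, _, _, .leftUnitor _ => (λ_ _).inv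
  | _, _, _, _, .leftUnitorInv _ => (λ_ _).hom
  | _, _, _, _, .map₂ η => F.map₂ ((counit C).map₂ (invFree η))
  | _, _, _, _, .mapId a => F.mapId a
  | _, _, _, _, .mapIdInv a => @inv _ _ _ _ (F.mapId a) (hF a)
  | _, _, _, _, .mapComp f g => F.mapComp ((counit C).map f) ((counit C).map g)

theorem Hom₂.evalOp_congr {a b : FreeNormalLax C} {f g : a ⟶ b} {η θ : Hom₂ f g}
    (h : Rel η θ) : η.evalOp F hF = θ.evalOp F hF := by
  induction h with
  | vcomp_right η θ₁ θ₂ _ ih => simp only [evalOp, ih]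
  | vcomp_left η θ₁ θ₂ _ ih => simp only [evalOp, ih]
  | whiskerLeft f g h η η' _ ih => exact congrArg (Hom.eval F.toPrelaxFunctor f ◁ ·) ih
  | whiskerRight f g h η η' _ ih => exact congrArg (· ▷ Hom.eval F.toPrelaxFunctor h) ih
  | id_comp η => exact Category.comp_id _
  | comp_id η => exact Category.id_comp _
  | assoc η θ ι => exact (Category.assoc _ _ _).symm
  | whiskerLeft_id f g => exact Bicategory.whiskerLeft_id _ _
  | whiskerLeft_comp f η θ => exact Bicategory.whiskerLeft_comp _ _ _
  | id_whiskerLeft η =>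
    exact (Bicategory.id_whiskerLeft _).trans (Category.assoc _ _ _).symm
  | comp_whiskerLeft f g η =>
    exact (Bicategory.comp_whiskerLeft _ _ _).trans (Category.assoc _ _ _).symm
  | id_whiskerRight f g => exact Bicategory.id_whiskerRight _ _
  | comp_whiskerRight i η θ => exact Bicategory.comp_whiskerRight _ _ _
  | whiskerRight_id η =>
    exact (Bicategory.whiskerRight_id _).trans (Category.assoc _ _ _).symm
  | whiskerRight_comp g h η =>
    exact (Bicategory.whiskerRight_comp _ _ _).trans (Category.assoc _ _ _).symm
  | whisker_assoc f η h =>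
    exact (Bicategory.whisker_assoc _ _ _).trans (Category.assoc _ _ _).symm
  | whisker_exchange η θ => exact (Bicategory.whisker_exchange _ _).symm
  | associator_hom_inv f g h => exact Iso.hom_inv_id _
  | associator_inv_hom f g h => exact Iso.inv_hom_id _
  | leftUnitor_hom_inv f => exact Iso.hom_inv_id _
  | leftUnitor_inv_hom f => exact Iso.inv_hom_id _
  | rightUnitor_hom_inv f => exact Iso.hom_inv_id _
  | rightUnitor_inv_hom f => exact Iso.inv_hom_id _
  | pentagon f g h i =>
    exact (Category.assoc _ _ _).trans (Bicategory.pentagon_inv _ _ _ _)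
  | triangle f g =>
    exact Bicategory.triangle_assoc_comp_left_inv _ _
  | map₂_id f =>
    simp only [evalOp, invFree_id]
    exact (congrArg F.map₂ ((counit C).map₂_id f)).trans (F.map₂_id _)
  | map₂_comp η θ =>
    simp only [evalOp, invFree_comp]
    exact (congrArg F.map₂ ((counit C).map₂_comp _ _)).trans (F.map₂_comp _ _)
  | mapId_hom_inv a => exact @IsIso.inv_hom_id _ _ _ _ (F.mapId a) (hF a)
  | mapId_inv_hom a => exact @IsIso.hom_inv_id _ _ _ _ (F.mapId a) (hF a)
  | mapComp_naturality_left η g =>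
    simp only [evalOp, invFree_whiskerRight, counit_whiskerRight]
    exact F.mapComp_naturality_left ((counit C).map₂ (invFree η)) ((counit C).map g)
  | mapComp_naturality_right f η =>
    simp only [evalOp, invFree_whiskerLeft, counit_whiskerLeft]
    exact F.mapComp_naturality_right ((counit C).map f) ((counit C).map₂ (invFree η))
  | map₂_associator f g h =>
    simp only [evalOp, invFree_hom]
    have key : ∀ {x y z t : C} (p : x ⟶ y) (q : y ⟶ z) (r : z ⟶ t),
        (F.map₂ (α_ p q r).inv ≫ F.mapComp (p ≫ q) r) ≫ F.mapComp p q ▷ F.map r =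
          (F.mapComp p (q ≫ r) ≫ F.map p ◁ F.mapComp q r) ≫
            (α_ (F.map p) (F.map q) (F.map r)).inv := by
      intro x y z t p q r
      rw [Category.assoc, F.mapComp_assoc_left, ← Category.assoc, ← F.map₂_comp,
        Iso.inv_hom_id, F.map₂_id, Category.id_comp, Category.assoc]
    exact key ((counit C).map f) ((counit C).map g) ((counit C).map h)
  | map₂_leftUnitor f =>
    simp only [evalOp, invFree_inv]
    exact (F.map₂_leftUnitor ((counit C).map f)).trans (Category.assoc _ _ _).symm
  | map₂_rightUnitor f =>
    simp only [evalOp, invFree_inv]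
    exact (F.map₂_rightUnitor ((counit C).map f)).trans (Category.assoc _ _ _).symm

end Oplax
end Eval

/-! ### Occurrences of edges -/

section Occ

variable {V : Type u} [Quiver.{v} V]

/-- The occurrences of edges of the graph in a 1-cell of the free bicategory. -/
def freeOcc : ∀ {a b : V}, FreeBicategory.Hom a b → Type
  | _, _, .of _ => Unit
  | _, _, .id _ => Empty
  | _, _, .comp f g => freeOcc f ⊕ freeOcc g

/-- The bijection of occurrences of edges induced by a word of 2-cells of the free bicategory. -/
def freeOccMap₂ : ∀ {a b : FreeBicategory V} {f g : a ⟶ b}, FreeBicategory.Hom₂ f g →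
    (freeOcc f ≃ freeOcc g)
  | _, _, _, _, .id _ => Equiv.refl _
  | _, _, _, _, .vcomp η θ => (freeOccMap₂ η).trans (freeOccMap₂ θ)
  | _, _, _, _, .whisker_left f η => Equiv.sumCongr (Equiv.refl (freeOcc f)) (freeOccMap₂ η)
  | _, _, _, _, .whisker_right h η => Equiv.sumCongr (freeOccMap₂ η) (Equiv.refl (freeOcc h))
  | _, _, _, _, .associator f g h => Equiv.sumAssoc (freeOcc f) (freeOcc g) (freeOcc h)
  | _, _, _, _, .associator_inv f g h =>
      (Equiv.sumAssoc (freeOcc f) (freeOcc g) (freeOcc h)).symm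
  | _, _, _, _, .right_unitor f => Equiv.sumEmpty (freeOcc f) Empty
  | _, _, _, _, .right_unitor_inv f => (Equiv.sumEmpty (freeOcc f) Empty).symm
  | _, _, _, _, .left_unitor f => Equiv.emptySum Empty (freeOcc f)
  | _, _, _, _, .left_unitor_inv f => (Equiv.emptySum Empty (freeOcc f)).symm

theorem freeOccMap₂_congr {a b : FreeBicategory V} {f g : a ⟶ b} {η θ : FreeBicategory.Hom₂ f g}
    (h : FreeBicategory.Rel η θ) : freeOccMap₂ η = freeOccMap₂ θ := by
  induction h with
  | vcomp_right η θ₁ θ₂ _ ih => simp only [freeOccMap₂, ih]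
  | vcomp_left η θ₁ θ₂ _ ih => simp only [freeOccMap₂, ih]
  | whisker_left f g h η η' _ ih =>
    exact congrArg (Equiv.sumCongr (Equiv.refl (freeOcc f))) ih
  | whisker_right f g h η η' _ ih =>
    exact congrArg (fun e => Equiv.sumCongr e (Equiv.refl (freeOcc h))) ih
  | _ =>
    refine Equiv.ext fun x => ?_
    first
    | rfl
    | (rcases x with x | x <;> first
        | rfl
        | exact x.elim
        | (rcases x with x | x <;> first
            | rfl
            | exact x.elim
            | (rcases x with x | x <;> rfl)))

/-- The bijection of occurrences of edges induced by a 2-cell of the free bicategory. -/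
def freeOccEquiv {a b : FreeBicategory V} {f g : a ⟶ b} (η : f ⟶ g) : freeOcc f ≃ freeOcc g :=
  Quot.lift freeOccMap₂ (fun _ _ h => freeOccMap₂_congr h) η

/-- The occurrences of edges of the graph in a 1-cell: those inside the symbols `F(w)`. -/
def occ : ∀ {a b : V}, Hom a b → Type
  | _, _, .app w => freeOcc w
  | _, _, .id _ => Empty
  | _, _, .comp f g => occ f ⊕ occ g

/-- The bijection of occurrences of edges induced by a word of 2-cells. -/
def occMap₂ : ∀ {a b : FreeNormalLax V} {f g : a ⟶ b}, Hom₂ f g → (occ f ≃ occ g)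
  | _, _, _, _, .id _ => Equiv.refl _
  | _, _, _, _, .vcomp η θ => (occMap₂ η).trans (occMap₂ θ)
  | _, _, _, _, .whiskerLeft f η => Equiv.sumCongr (Equiv.refl (occ f)) (occMap₂ η)
  | _, _, _, _, .whiskerRight h η => Equiv.sumCongr (occMap₂ η) (Equiv.refl (occ h))
  | _, _, _, _, .associator f g h => Equiv.sumAssoc (occ f) (occ g) (occ h)
  | _, _, _, _, .associatorInv f g h => (Equiv.sumAssoc (occ f) (occ g) (occ h)).symm
  | _, _, _, _, .rightUnitor f => Equiv.sumEmpty (occ f) Empty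
  | _, _, _, _, .rightUnitorInv f => (Equiv.sumEmpty (occ f) Empty).symm
  | _, _, _, _, .leftUnitor f => Equiv.emptySum Empty (occ f)
  | _, _, _, _, .leftUnitorInv f => (Equiv.emptySum Empty (occ f)).symm
  | _, _, _, _, .map₂ η => freeOccEquiv η
  | _, _, _, _, .mapId _ => Equiv.refl Empty
  | _, _, _, _, .mapIdInv _ => Equiv.refl Empty
  | _, _, _, _, .mapComp f g => Equiv.refl (freeOcc f ⊕ freeOcc g)

theorem occMap₂_congr {a b : FreeNormalLax V} {f g : a ⟶ b} {η θ : Hom₂ f g}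
    (h : Rel η θ) : occMap₂ η = occMap₂ θ := by
  induction h with
  | vcomp_right η θ₁ θ₂ _ ih => simp only [occMap₂, ih]
  | vcomp_left η θ₁ θ₂ _ ih => simp only [occMap₂, ih]
  | whiskerLeft f g h η η' _ ih => exact congrArg (Equiv.sumCongr (Equiv.refl (occ f))) ih
  | whiskerRight f g h η η' _ ih =>
    exact congrArg (fun e => Equiv.sumCongr e (Equiv.refl (occ h))) ih
  | map₂_comp η θ =>
    obtain ⟨η⟩ := η
    obtain ⟨θ⟩ := θ
    rfl
  | mapComp_naturality_left η g =>
    obtain ⟨η⟩ := η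
    rfl
  | mapComp_naturality_right f η =>
    obtain ⟨η⟩ := η
    rfl
  | _ =>
    refine Equiv.ext fun x => ?_
    first
    | rfl
    | (rcases x with x | x <;> first
        | rfl
        | exact x.elim
        | (rcases x with x | x <;> first
            | rfl
            | exact x.elim
            | (rcases x with x | x <;> rfl)))

/-- The bijection of occurrences of edges induced by a 2-cell. -/
def occEquiv {a b : FreeNormalLax V} {f g : a ⟶ b} (η : f ⟶ g) : occ f ≃ occ g :=
  Quot.lift occMap₂ (fun _ _ h => occMap₂_congr h) η

end Occ
end FreeNormalLax

namespace Shadow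

variable {B : Type u} [Bicategory.{w, v} B] {T : Type t} [Category.{t₁} T] (S : Shadow B T)

theorem inv_naturality_left {a b : B} {f f' : a ⟶ b} (η : f' ⟶ f) (g : b ⟶ a) :
    (S.rot f' g).inv ≫ (S.sh a).map (η ▷ g) = (S.sh b).map (g ◁ η) ≫ (S.rot f g).inv := by
  rw [Iso.inv_comp_eq, ← Category.assoc, Iso.eq_comp_inv]
  exact S.rot_naturality_left η g

theorem inv_naturality_right {a b : B} (f : a ⟶ b) {g g' : b ⟶ a} (η : g' ⟶ g) :
    (S.rot f g').inv ≫ (S.sh a).map (f ◁ η) = (S.sh b).map (η ▷ f) ≫ (S.rot f g).inv := by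
  rw [Iso.inv_comp_eq, ← Category.assoc, Iso.eq_comp_inv]
  exact S.rot_naturality_right f η

theorem inv_associator {a b c : B} (f : a ⟶ b) (g : b ⟶ c) (h : c ⟶ a) :
    ((S.rot (h ≫ f) g).inv ≫ (S.sh c).map (α_ h f g).hom) ≫ (S.rot (f ≫ g) h).inv =
      ((S.sh b).map (α_ g h f).inv ≫ (S.rot f (g ≫ h)).inv) ≫ (S.sh a).map (α_ f g h).inv := by
  have h₂ := IsIso.inv_eq_inv.mpr (S.rot_associator f g h)
  simpa [← Functor.map_inv] using h₂

theorem inv_leftUnitor {a : B} (f : a ⟶ a) :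
    (S.sh a).map (λ_ f).inv ≫ (S.rot f (𝟙 a)).inv = (S.sh a).map (ρ_ f).inv := by
  have h₂ := IsIso.inv_eq_inv.mpr (S.rot_leftUnitor f)
  simpa [← Functor.map_inv] using h₂

theorem inv_rightUnitor {a : B} (f : a ⟶ a) :
    (S.sh a).map (ρ_ f).inv ≫ (S.rot (𝟙 a) f).inv = (S.sh a).map (λ_ f).inv := by
  have h₂ := IsIso.inv_eq_inv.mpr (S.rot_rightUnitor f)
  simpa [← Functor.map_inv] using h₂

end Shadow

theorem NormalOplaxShadowFunctor.inv_s_rot {C : Type u₁} [Bicategory.{w₁, v₁} C] {TC : Type t}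
    [Category.{t₁} TC] {D : Type u₂} [Bicategory.{w₂, v₂} D] {TD : Type t₂} [Category.{t₃} TD]
    {SC : Shadow C TC} {SD : Shadow D TD} (Φ : NormalOplaxShadowFunctor SC SD)
    {a b : C} (f : a ⟶ b) (g : b ⟶ a) :
    (Φ.H.map (SC.rot f g).inv ≫ Φ.s (f ≫ g)) ≫ (SD.sh (Φ.F.obj a)).map (Φ.F.mapComp f g) =
      (Φ.s (g ≫ f) ≫ (SD.sh (Φ.F.obj b)).map (Φ.F.mapComp g f)) ≫
        (SD.rot (Φ.F.map f) (Φ.F.map g)).inv := by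
  have h := Φ.s_rot f g
  rw [Iso.eq_comp_inv, Category.assoc, Category.assoc, ← h, ← Category.assoc, ← Φ.H.map_comp,
    Iso.inv_hom_id, Φ.H.map_id, Category.id_comp]

/-! ## The target shadow category of the free normal lax shadow functor on a graph -/

/-- Objects: `⟨⟨w⟩⟩` for an endomorphism 1-cell `w` of the target bicategory (`inner`), and
`H⟨⟨w⟩⟩` for an endomorphism 1-cell `w` of the free bicategory (`outer`). -/
inductive FreeNormalLaxShadow (V : Type u) [Quiver.{v} V] : Type (max u v)
  | inner (X : FreeShadow (FreeNormalLax V))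
  | outer (X : FreeShadow (FreeBicategory V))

namespace FreeNormalLaxShadow

section

variable {V : Type u} [Quiver.{v} V]

/-- The universal lax functor, and the universal shadows on its source and target. -/
abbrev laxF (V : Type u) [Quiver.{v} V] : LaxFunctor (FreeBicategory V) (FreeNormalLax V) :=
  FreeNormalLax.laxFunctor V

abbrev innerShadow (V : Type u) [Quiver.{v} V] :
    Shadow (FreeNormalLax V) (FreeShadow (FreeNormalLax V)) :=
  FreeShadow.shadow _

abbrev outerShadow (V : Type u) [Quiver.{v} V] :
    Shadow (FreeBicategory V) (FreeShadow (FreeBicategory V)) :=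
  FreeShadow.shadow _

/-- Words of morphisms, generated by the morphisms of the two shadow categories (the one of the
free bicategory being placed inside `H`) and the shadow commutators `⟨⟨F(w)⟩⟩ ⟶ H⟨⟨w⟩⟩`. -/
inductive Pre : FreeNormalLaxShadow V → FreeNormalLaxShadow V → Type (max u v)
  | id (X : FreeNormalLaxShadow V) : Pre X X
  | comp {X Y Z : FreeNormalLaxShadow V} (p : Pre X Y) (q : Pre Y Z) : Pre X Z
  | inner {X Y : FreeShadow (FreeNormalLax V)} (p : X ⟶ Y) : Pre (.inner X) (.inner Y)
  | outer {X Y : FreeShadow (FreeBicategory V)} (p : X ⟶ Y) : Pre (.outer X) (.outer Y)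
  | s {a : FreeBicategory V} (w : a ⟶ a) :
      Pre (.inner ⟨(laxF V).map w⟩) (.outer ⟨w⟩)

section

local infixr:65 "⋆" => Pre.comp

/-- Relations between words: the axioms of a category, functoriality of the two inclusions,
naturality of the shadow commutators and their compatibility with the rotators. -/
inductive Rel : ∀ {X Y : FreeNormalLaxShadow V}, Pre X Y → Pre X Y → Prop
  | comp_right {X Y Z} (p : Pre X Y) (q q' : Pre Y Z) : Rel q q' → Rel (p ⋆ q) (p ⋆ q')
  | comp_left {X Y Z} (p p' : Pre X Y) (q : Pre Y Z) : Rel p p' → Rel (p ⋆ q) (p' ⋆ q)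
  | id_comp {X Y} (p : Pre X Y) : Rel (Pre.id X ⋆ p) p
  | comp_id {X Y} (p : Pre X Y) : Rel (p ⋆ Pre.id Y) p
  | assoc {X Y Z W} (p : Pre X Y) (q : Pre Y Z) (r : Pre Z W) : Rel ((p ⋆ q) ⋆ r) (p ⋆ q ⋆ r)
  | inner_id (X : FreeShadow (FreeNormalLax V)) : Rel (Pre.inner (𝟙 X)) (Pre.id (.inner X))
  | inner_comp {X Y Z : FreeShadow (FreeNormalLax V)} (p : X ⟶ Y) (q : Y ⟶ Z) :
      Rel (Pre.inner (p ≫ q)) (Pre.inner p ⋆ Pre.inner q)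
  | outer_id (X : FreeShadow (FreeBicategory V)) : Rel (Pre.outer (𝟙 X)) (Pre.id (.outer X))
  | outer_comp {X Y Z : FreeShadow (FreeBicategory V)} (p : X ⟶ Y) (q : Y ⟶ Z) :
      Rel (Pre.outer (p ≫ q)) (Pre.outer p ⋆ Pre.outer q)
  | s_naturality {a : FreeBicategory V} {f g : a ⟶ a} (η : f ⟶ g) :
      Rel (Pre.inner (((innerShadow V).sh ((laxF V).obj a)).map
            ((laxF V).map₂ η)) ⋆ Pre.s g)
        (Pre.s f ⋆ Pre.outer (((outerShadow V).sh a).map η))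
  | s_rot {a b : FreeBicategory V} (f : a ⟶ b) (g : b ⟶ a) :
      Rel (Pre.inner (((innerShadow V).sh ((laxF V).obj a)).map
            ((laxF V).mapComp f g)) ⋆ Pre.s (f ≫ g) ⋆
          Pre.outer ((outerShadow V).rot f g).hom)
        (Pre.inner ((innerShadow V).rot
            ((laxF V).map f) ((laxF V).map g)).hom ⋆
          Pre.inner (((innerShadow V).sh ((laxF V).obj b)).map
            ((laxF V).mapComp g f)) ⋆ Pre.s (g ≫ f))

end

instance category : Category (FreeNormalLaxShadow V) where
  Hom X Y := Quot (@Rel V _ X Y)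
  id X := Quot.mk _ (Pre.id X)
  comp := Quot.map₂ Pre.comp Rel.comp_right Rel.comp_left
  id_comp := by
    rintro X Y ⟨p⟩
    exact Quot.sound (Rel.id_comp p)
  comp_id := by
    rintro X Y ⟨p⟩
    exact Quot.sound (Rel.comp_id p)
  assoc := by
    rintro X Y Z W ⟨p⟩ ⟨q⟩ ⟨r⟩
    exact Quot.sound (Rel.assoc p q r)

/-- A functor on the free category is given by functors on the two shadow categories and values
of the shadow commutators that respect the two relations. -/
noncomputable def lift {T : Type t} [Category.{t₁} T] (A : FreeShadow (FreeNormalLax V) ⥤ T)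
    (B : FreeShadow (FreeBicategory V) ⥤ T)
    (σ : ∀ {a : FreeBicategory V} (w : a ⟶ a),
      A.obj ⟨(laxF V).map w⟩ ⟶ B.obj ⟨w⟩)
    (nat : ∀ {a : FreeBicategory V} {f g : a ⟶ a} (η : f ⟶ g),
      A.map (((innerShadow V).sh ((laxF V).obj a)).map
          ((laxF V).map₂ η)) ≫ σ g =
        σ f ≫ B.map (((outerShadow V).sh a).map η))
    (coh : ∀ {a b : FreeBicategory V} (f : a ⟶ b) (g : b ⟶ a),
      A.map (((innerShadow V).sh ((laxF V).obj a)).map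
            ((laxF V).mapComp f g)) ≫ σ (f ≫ g) ≫
          B.map ((outerShadow V).rot f g).hom =
        A.map ((innerShadow V).rot
            ((laxF V).map f) ((laxF V).map g)).hom ≫
          A.map (((innerShadow V).sh ((laxF V).obj b)).map
            ((laxF V).mapComp g f)) ≫ σ (g ≫ f)) :
    FreeNormalLaxShadow V ⥤ T :=
  let o : FreeNormalLaxShadow V → T := fun
    | .inner X => A.obj X
    | .outer X => B.obj X
  let e : ∀ {X Y : FreeNormalLaxShadow V}, Pre X Y → (o X ⟶ o Y) := fun p =>
    Pre.rec (motive := fun X Y _ => (o X ⟶ o Y)) (fun X => 𝟙 (o X))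
      (fun _ _ p q => p ≫ q) (fun p => A.map p) (fun p => B.map p) (fun w => σ w) p
  { obj := o
    map := Quot.lift e (by
      intro p q h
      induction h with
      | comp_right p q q' _ ih => exact congrArg (e p ≫ ·) ih
      | comp_left p p' q _ ih => exact congrArg (· ≫ e q) ih
      | id_comp p => exact Category.id_comp _
      | comp_id p => exact Category.comp_id _
      | assoc p q r => exact Category.assoc _ _ _
      | inner_id X => exact A.map_id X
      | inner_comp p q => exact A.map_comp p q
      | outer_id X => exact B.map_id X
      | outer_comp p q => exact B.map_comp p q
      | s_naturality η => exact nat η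
      | s_rot f g => exact coh f g)
    map_id := fun _ => rfl
    map_comp := by
      rintro X Y Z ⟨p⟩ ⟨q⟩
      rfl }

end

end FreeNormalLaxShadow

/-! ## The underlying permutation -/

/-- The groupoid of types and bijections. -/
structure Bij : Type 1 where
  carrier : Type

instance : Category Bij where
  Hom X Y := X.carrier ≃ Y.carrier
  id X := Equiv.refl X.carrier
  comp e f := e.trans f

section Permutation

variable (V : Type u) [Quiver.{v} V]

/-- The shadow on the free bicategory which records the occurrences of edges in a cyclic word;
the rotator moves the occurrences in the first factor past those in the second. -/
def freeOccShadow : Shadow (FreeBicategory V) Bij where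
  sh a :=
    { obj f := ⟨FreeNormalLax.freeOcc f⟩
      map η := FreeNormalLax.freeOccEquiv η
      map_id _ := rfl
      map_comp := by
        rintro f g h ⟨η⟩ ⟨θ⟩
        rfl }
  rot f g :=
    { hom := Equiv.sumComm (FreeNormalLax.freeOcc f) (FreeNormalLax.freeOcc g)
      inv := Equiv.sumComm (FreeNormalLax.freeOcc g) (FreeNormalLax.freeOcc f)
      hom_inv_id := Equiv.ext fun x => by rcases x with x | x <;> rfl
      inv_hom_id := Equiv.ext fun x => by rcases x with x | x <;> rfl }
  rot_naturality_left := by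
    rintro a b f f' ⟨η⟩ g
    exact Equiv.ext fun x => by rcases x with x | x <;> rfl
  rot_naturality_right := by
    rintro a b f g g' ⟨η⟩
    exact Equiv.ext fun x => by rcases x with x | x <;> rfl
  rot_associator f g h := Equiv.ext fun x => by rcases x with (x | x) | x <;> rfl
  rot_leftUnitor f := Equiv.ext fun x => by
    rcases x with x | x
    · rfl
    · exact x.elim
  rot_rightUnitor f := Equiv.ext fun x => by
    rcases x with x | x
    · exact x.elim
    · rfl

/-- The same for the target bicategory of the free normal lax functor. -/
def occShadow : Shadow (FreeNormalLax V) Bij where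
  sh a :=
    { obj f := ⟨FreeNormalLax.occ f⟩
      map η := FreeNormalLax.occEquiv η
      map_id _ := rfl
      map_comp := by
        rintro f g h ⟨η⟩ ⟨θ⟩
        rfl }
  rot f g :=
    { hom := Equiv.sumComm (FreeNormalLax.occ f) (FreeNormalLax.occ g)
      inv := Equiv.sumComm (FreeNormalLax.occ g) (FreeNormalLax.occ f)
      hom_inv_id := Equiv.ext fun x => by rcases x with x | x <;> rfl
      inv_hom_id := Equiv.ext fun x => by rcases x with x | x <;> rfl }
  rot_naturality_left := by
    rintro a b f f' ⟨η⟩ g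
    exact Equiv.ext fun x => by rcases x with x | x <;> rfl
  rot_naturality_right := by
    rintro a b f g g' ⟨η⟩
    exact Equiv.ext fun x => by rcases x with x | x <;> rfl
  rot_associator f g h := Equiv.ext fun x => by rcases x with (x | x) | x <;> rfl
  rot_leftUnitor f := Equiv.ext fun x => by
    rcases x with x | x
    · rfl
    · exact x.elim
  rot_rightUnitor f := Equiv.ext fun x => by
    rcases x with x | x
    · exact x.elim
    · rfl

/-- The underlying permutation of a formal morphism: the bijection it induces from the occurrences
of edges in its source to those in its target. Rotators act by the evident rotation, all other
generators act by the identity of the list of edges; so, when the occurrences in source and target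
are numbered from left to right, these bijections are the cyclic permutations. -/
noncomputable def permutation : FreeNormalLaxShadow V ⥤ Bij :=
  FreeNormalLaxShadow.lift (FreeShadow.lift (occShadow V)) (FreeShadow.lift (freeOccShadow V))
    (fun w => Equiv.refl (FreeNormalLax.freeOcc w))
    (fun η => by
      obtain ⟨η⟩ := η
      rfl)
    (fun f g => rfl)

end Permutation

/-! ## Formal diagrams -/

section Formal

variable {C : Type u₁} [Bicategory.{w₁, v₁} C] {TC : Type t} [Category.{t₁} TC]
  {D : Type u₂} [Bicategory.{w₂, v₂} D] {TD : Type t₂} [Category.{t₃} TD]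
  {SC : Shadow C TC} {SD : Shadow D TD}

namespace NormalLaxShadowFunctor

variable (Φ : NormalLaxShadowFunctor SC SD)

/-- The shadow of `D`, on the values of formal 1-cells. -/
noncomputable def innerEval : Shadow (FreeNormalLax C) TD where
  sh a :=
    { obj f := (SD.sh (Φ.F.obj a)).obj (FreeNormalLax.Hom.eval Φ.F.toPrelaxFunctor f)
      map η := (SD.sh (Φ.F.obj a)).map
        (Quot.lift (FreeNormalLax.Hom₂.eval Φ.F Φ.isIso_mapId)
          (fun _ _ h => FreeNormalLax.Hom₂.eval_congr Φ.F Φ.isIso_mapId h) η)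
      map_id _ := (SD.sh _).map_id _
      map_comp := by
        rintro f g h ⟨η⟩ ⟨θ⟩
        exact (SD.sh _).map_comp _ _ }
  rot f g := SD.rot (FreeNormalLax.Hom.eval Φ.F.toPrelaxFunctor f)
    (FreeNormalLax.Hom.eval Φ.F.toPrelaxFunctor g)
  rot_naturality_left := by
    rintro a b f f' ⟨η⟩ g
    exact SD.rot_naturality_left _ _
  rot_naturality_right := by
    rintro a b f g g' ⟨η⟩
    exact SD.rot_naturality_right _ _
  rot_associator f g h := SD.rot_associator _ _ _
  rot_leftUnitor f := SD.rot_leftUnitor _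
  rot_rightUnitor f := SD.rot_rightUnitor _

end NormalLaxShadowFunctor

/-- The shadow of `C`, on the values of formal 1-cells. -/
def Shadow.outerEval (SC : Shadow C TC) : Shadow (FreeBicategory C) TC where
  sh a := (FreeNormalLax.counit C).mapFunctor a a ⋙ SC.sh ((FreeNormalLax.counit C).obj a)
  rot f g := SC.rot ((FreeNormalLax.counit C).map f) ((FreeNormalLax.counit C).map g)
  rot_naturality_left := by
    rintro a b f f' ⟨η⟩ g
    exact SC.rot_naturality_left _ _
  rot_naturality_right := by
    rintro a b f g g' ⟨η⟩
    exact SC.rot_naturality_right _ _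
  rot_associator f g h := SC.rot_associator _ _ _
  rot_leftUnitor f := SC.rot_leftUnitor _
  rot_rightUnitor f := SC.rot_rightUnitor _

/-- Evaluation of formal morphisms of a normal lax shadow functor. -/
noncomputable def NormalLaxShadowFunctor.eval (Φ : NormalLaxShadowFunctor SC SD) :
    FreeNormalLaxShadow C ⥤ TD :=
  FreeNormalLaxShadow.lift (FreeShadow.lift Φ.innerEval) (FreeShadow.lift SC.outerEval ⋙ Φ.H)
    (fun w => Φ.s ((FreeNormalLax.counit C).map w))
    (fun η => Φ.s_naturality ((FreeNormalLax.counit C).map₂ η))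
    (fun f g => Φ.s_rot ((FreeNormalLax.counit C).map f) ((FreeNormalLax.counit C).map g))

namespace NormalOplaxShadowFunctor

variable (Φ : NormalOplaxShadowFunctor SC SD)

/-- The shadow of `D`, on the values of formal 1-cells, with the direction of the 2-cells
reversed. -/
noncomputable def innerEval : Shadow (FreeNormalLax C) TDᵒᵖ where
  sh a :=
    { obj f := Opposite.op
        ((SD.sh (Φ.F.obj a)).obj (FreeNormalLax.Hom.eval Φ.F.toPrelaxFunctor f))
      map η := ((SD.sh (Φ.F.obj a)).map
        (Quot.lift (FreeNormalLax.Hom₂.evalOp Φ.F Φ.isIso_mapId)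
          (fun _ _ h => FreeNormalLax.Hom₂.evalOp_congr Φ.F Φ.isIso_mapId h) η)).op
      map_id _ := congrArg Quiver.Hom.op ((SD.sh _).map_id _)
      map_comp := by
        rintro f g h ⟨η⟩ ⟨θ⟩
        exact congrArg Quiver.Hom.op ((SD.sh _).map_comp _ _) }
  rot f g := (SD.rot (FreeNormalLax.Hom.eval Φ.F.toPrelaxFunctor f)
    (FreeNormalLax.Hom.eval Φ.F.toPrelaxFunctor g)).symm.op
  rot_naturality_left := by
    rintro a b f f' ⟨η⟩ g
    exact congrArg Quiver.Hom.op (SD.inv_naturality_left _ _)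
  rot_naturality_right := by
    rintro a b f g g' ⟨η⟩
    exact congrArg Quiver.Hom.op (SD.inv_naturality_right _ _)
  rot_associator f g h := congrArg Quiver.Hom.op (SD.inv_associator _ _ _)
  rot_leftUnitor f := congrArg Quiver.Hom.op (SD.inv_leftUnitor _)
  rot_rightUnitor f := congrArg Quiver.Hom.op (SD.inv_rightUnitor _)

end NormalOplaxShadowFunctor

namespace FreeNormalLax

/-- The value in `C` of the inverse of a 2-cell of the free bicategory. -/
noncomputable def invEval {a b : FreeBicategory C} {f g : a ⟶ b} (η : f ⟶ g) :
    (counit C).map g ⟶ (counit C).map f :=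
  (counit C).map₂ (invFree η)

theorem invEval_whiskerRight {a b c : FreeBicategory C} {f f' : a ⟶ b} (η : f ⟶ f')
    (g : b ⟶ c) : invEval (η ▷ g) = invEval η ▷ (counit C).map g := by
  unfold invEval
  rw [invFree_whiskerRight, counit_whiskerRight]

theorem invEval_whiskerLeft {a b c : FreeBicategory C} (f : a ⟶ b) {g g' : b ⟶ c}
    (η : g ⟶ g') : invEval (f ◁ η) = (counit C).map f ◁ invEval η := by
  unfold invEval
  rw [invFree_whiskerLeft, counit_whiskerLeft]

theorem invEval_hom {a b : FreeBicategory C} {f g : a ⟶ b} (i : f ≅ g) :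
    invEval i.hom = (counit C).map₂ i.inv :=
  congrArg (counit C).map₂ (invFree_hom i)

theorem invEval_inv {a b : FreeBicategory C} {f g : a ⟶ b} (i : f ≅ g) :
    invEval i.inv = (counit C).map₂ i.hom :=
  congrArg (counit C).map₂ (invFree_inv i)

end FreeNormalLax

/-- The shadow of `C`, on the values of formal 1-cells, with the direction of the 2-cells
reversed. -/
noncomputable def Shadow.outerEvalOp (SC : Shadow C TC) : Shadow (FreeBicategory C) TCᵒᵖ where
  sh a :=
    { obj f := Opposite.op
        ((SC.sh ((FreeNormalLax.counit C).obj a)).obj ((FreeNormalLax.counit C).map f))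
      map η := ((SC.sh ((FreeNormalLax.counit C).obj a)).map
        (FreeNormalLax.invEval η)).op
      map_id f := by
        rw [FreeNormalLax.invEval, FreeNormalLax.invFree_id, PrelaxFunctor.map₂_id, CategoryTheory.Functor.map_id]
        rfl
      map_comp η θ := by
        rw [FreeNormalLax.invEval, FreeNormalLax.invFree_comp, PrelaxFunctor.map₂_comp, Functor.map_comp]
        rfl }
  rot f g := (SC.rot ((FreeNormalLax.counit C).map f) ((FreeNormalLax.counit C).map g)).symm.op
  rot_naturality_left {a b f f'} η g := congrArg Quiver.Hom.op <|
    (congrArg (fun z => (SC.rot ((FreeNormalLax.counit C).map f') ((FreeNormalLax.counit C).map g)).inv ≫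
      (SC.sh ((FreeNormalLax.counit C).obj a)).map z)
      (FreeNormalLax.invEval_whiskerRight η g)).trans <|
    (SC.inv_naturality_left (FreeNormalLax.invEval η) ((FreeNormalLax.counit C).map g)).trans <|
    (congrArg (fun z => (SC.sh ((FreeNormalLax.counit C).obj b)).map z ≫
      (SC.rot ((FreeNormalLax.counit C).map f) ((FreeNormalLax.counit C).map g)).inv)
      (FreeNormalLax.invEval_whiskerLeft g η)).symm
  rot_naturality_right {a b} f {g g'} η := congrArg Quiver.Hom.op <|
    (congrArg (fun z => (SC.rot ((FreeNormalLax.counit C).map f) ((FreeNormalLax.counit C).map g')).inv ≫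
      (SC.sh ((FreeNormalLax.counit C).obj a)).map z)
      (FreeNormalLax.invEval_whiskerLeft f η)).trans <|
    (SC.inv_naturality_right ((FreeNormalLax.counit C).map f) (FreeNormalLax.invEval η)).trans <|
    (congrArg (fun z => (SC.sh ((FreeNormalLax.counit C).obj b)).map z ≫
      (SC.rot ((FreeNormalLax.counit C).map f) ((FreeNormalLax.counit C).map g)).inv)
      (FreeNormalLax.invEval_whiskerRight η f)).symm
  rot_associator {a b c} f g h := congrArg Quiver.Hom.op <|
    (congrArg (fun z => ((SC.rot (((FreeNormalLax.counit C).map h) ≫ ((FreeNormalLax.counit C).map f)) ((FreeNormalLax.counit C).map g)).inv ≫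
      (SC.sh ((FreeNormalLax.counit C).obj c)).map z) ≫
        (SC.rot (((FreeNormalLax.counit C).map f) ≫ ((FreeNormalLax.counit C).map g)) ((FreeNormalLax.counit C).map h)).inv)
      (FreeNormalLax.invEval_inv (α_ h f g))).trans <|
    (SC.inv_associator ((FreeNormalLax.counit C).map f) ((FreeNormalLax.counit C).map g) ((FreeNormalLax.counit C).map h)).trans <|
    (congrArg₂ (fun z z' => ((SC.sh ((FreeNormalLax.counit C).obj b)).map z ≫
      (SC.rot ((FreeNormalLax.counit C).map f) (((FreeNormalLax.counit C).map g) ≫ ((FreeNormalLax.counit C).map h))).inv) ≫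
        (SC.sh ((FreeNormalLax.counit C).obj a)).map z')
      (FreeNormalLax.invEval_hom (α_ g h f)) (FreeNormalLax.invEval_hom (α_ f g h))).symm
  rot_leftUnitor {a} f := congrArg Quiver.Hom.op <|
    (congrArg (fun z => (SC.sh ((FreeNormalLax.counit C).obj a)).map z ≫
      (SC.rot ((FreeNormalLax.counit C).map f) (𝟙 ((FreeNormalLax.counit C).obj a))).inv)
      (FreeNormalLax.invEval_hom (λ_ f))).trans <|
    (SC.inv_leftUnitor ((FreeNormalLax.counit C).map f)).trans <|
    (congrArg (SC.sh ((FreeNormalLax.counit C).obj a)).map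
      (FreeNormalLax.invEval_hom (ρ_ f))).symm
  rot_rightUnitor {a} f := congrArg Quiver.Hom.op <|
    (congrArg (fun z => (SC.sh ((FreeNormalLax.counit C).obj a)).map z ≫
      (SC.rot (𝟙 ((FreeNormalLax.counit C).obj a)) ((FreeNormalLax.counit C).map f)).inv)
      (FreeNormalLax.invEval_hom (ρ_ f))).trans <|
    (SC.inv_rightUnitor ((FreeNormalLax.counit C).map f)).trans <|
    (congrArg (SC.sh ((FreeNormalLax.counit C).obj a)).map
      (FreeNormalLax.invEval_hom (λ_ f))).symm

/-- Evaluation of formal morphisms of a normal oplax shadow functor. The target shadow category of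
the free normal oplax shadow functor is the opposite of that of the free normal lax one. -/
noncomputable def NormalOplaxShadowFunctor.eval (Φ : NormalOplaxShadowFunctor SC SD) :
    (FreeNormalLaxShadow C)ᵒᵖ ⥤ TD :=
  (FreeNormalLaxShadow.lift (T := TDᵒᵖ) (FreeShadow.lift Φ.innerEval)
    (FreeShadow.lift SC.outerEvalOp ⋙ Φ.H.op)
    (fun w => (Φ.s ((FreeNormalLax.counit C).map w)).op)
    (fun η => congrArg Quiver.Hom.op
      (Φ.s_naturality ((FreeNormalLax.counit C).map₂ (FreeNormalLax.invFree η))).symm)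
    (fun f g => congrArg Quiver.Hom.op
      (Φ.inv_s_rot ((FreeNormalLax.counit C).map f) ((FreeNormalLax.counit C).map g)))).leftOp

/-- A diagram commutes if any two parallel composites in it are equal. -/
def Commutes {J : Type u} [Category.{v} J] {T : Type t} [Category.{t₁} T] (K : J ⥤ T) : Prop :=
  ∀ ⦃x y : J⦄ (f g : x ⟶ y), K.map f = K.map g

/-- A diagram in the target shadow category which lifts to a formal diagram in which any two
parallel composites induce the same permutation. -/
def NormalLaxShadowFunctor.IsFormalWithEqualPermutations (Φ : NormalLaxShadowFunctor SC SD)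
    {J : Type u} [Category.{v} J] (K : J ⥤ TD) : Prop :=
  ∃ L : J ⥤ FreeNormalLaxShadow C, L ⋙ Φ.eval = K ∧
    ∀ ⦃x y : J⦄ (f g : x ⟶ y),
      (permutation C).map (L.map f) = (permutation C).map (L.map g)

/-- The same for a normal oplax shadow functor. -/
def NormalOplaxShadowFunctor.IsFormalWithEqualPermutations (Φ : NormalOplaxShadowFunctor SC SD)
    {J : Type u} [Category.{v} J] (K : J ⥤ TD) : Prop :=
  ∃ L : J ⥤ (FreeNormalLaxShadow C)ᵒᵖ, L ⋙ Φ.eval = K ∧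
    ∀ ⦃x y : J⦄ (f g : x ⟶ y),
      (permutation C).map (L.map f).unop = (permutation C).map (L.map g).unop

end Formal

/-! ## The bi-augmented cyclic category -/

namespace Cyclic

/-- The objects `0, 1, 2, …` and the terminal object. -/
inductive Vertex : Type
  | num (n : ℕ)
  | star

/-- Generators: cofaces `d i : n → n + 1`, codegeneracies `s i : n + 2 → n + 1`, the cycle
`τ : n + 1 → n + 1` and the terminal map `t : 1 → *`. Indices start from `0`. -/
inductive Gen : Vertex → Vertex → Type
  | d {n : ℕ} (i : Fin (n + 1)) : Gen (.num n) (.num (n + 1))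
  | s {n : ℕ} (i : Fin (n + 1)) : Gen (.num (n + 2)) (.num (n + 1))
  | τ (n : ℕ) : Gen (.num (n + 1)) (.num (n + 1))
  | t : Gen (.num 1) .star

instance : Quiver Vertex := ⟨Gen⟩

/-- The free category on the generators. -/
abbrev Words := Paths Vertex

abbrev num (n : ℕ) : Words := Vertex.num n

abbrev star : Words := Vertex.star

def d {n : ℕ} (i : Fin (n + 1)) : num n ⟶ num (n + 1) := Quiver.Hom.toPath (Gen.d i)

def s {n : ℕ} (i : Fin (n + 1)) : num (n + 2) ⟶ num (n + 1) := Quiver.Hom.toPath (Gen.s i)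

def τ (n : ℕ) : num (n + 1) ⟶ num (n + 1) := Quiver.Hom.toPath (Gen.τ n)

def t : num 1 ⟶ star := Quiver.Hom.toPath Gen.t

/-- The defining relations; `f ≫ g` is `f` followed by `g`. -/
inductive Rel : HomRel Words
  | d_d {n : ℕ} (i j : Fin (n + 1)) (h : i ≤ j) : Rel (d j ≫ d i.castSucc) (d i ≫ d j.succ)
  | s_s {n : ℕ} (i j : Fin (n + 1)) (h : i ≤ j) : Rel (s i.castSucc ≫ s j) (s j.succ ≫ s i)
  | d_s_lt {n : ℕ} (i : Fin (n + 2)) (j : Fin (n + 1)) (h : i ≤ j.castSucc) :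
      Rel (d i.castSucc ≫ s j.succ) (s j ≫ d i)
  | d_s_self {n : ℕ} (i : Fin (n + 1)) : Rel (d i.castSucc ≫ s i) (𝟙 (num (n + 1)))
  | d_s_succ {n : ℕ} (i : Fin (n + 1)) : Rel (d i.succ ≫ s i) (𝟙 (num (n + 1)))
  | d_s_gt {n : ℕ} (i : Fin (n + 2)) (j : Fin (n + 1)) (h : j.castSucc < i) :
      Rel (d i.succ ≫ s j.castSucc) (s j ≫ d i)
  | d_τ {n : ℕ} (i : Fin (n + 1)) : Rel (d i.succ ≫ τ (n + 1)) (τ n ≫ d i.castSucc)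
  | d_zero_τ (n : ℕ) : Rel (d 0 ≫ τ n) (d (Fin.last n))
  | s_τ {n : ℕ} (i : Fin (n + 1)) : Rel (s i.succ ≫ τ (n + 1)) (τ (n + 2) ≫ s i.castSucc)
  | s_zero_τ (n : ℕ) : Rel (s 0 ≫ τ n) (τ (n + 1) ≫ τ (n + 1) ≫ s (Fin.last n))
  | τ_pow (n : ℕ) : Rel ((show End (num (n + 1)) from τ n) ^ (n + 1)) (𝟙 (num (n + 1)))
  | s_t : Rel (s 0 ≫ t) (τ 1 ≫ s 0 ≫ t)

end Cyclic

/-- The bi-augmented cyclic category `Λ'`. -/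
abbrev BiaugmentedCyclic := CategoryTheory.Quotient Cyclic.Rel

namespace BiaugmentedCyclic

/-- The object `n` of `Λ'`. -/
abbrev num (n : ℕ) : BiaugmentedCyclic := (CategoryTheory.Quotient.functor Cyclic.Rel).obj (Cyclic.num n)

/-- The coface maps of `Λ'`. -/
abbrev d {n : ℕ} (i : Fin (n + 1)) : num n ⟶ num (n + 1) :=
  (CategoryTheory.Quotient.functor Cyclic.Rel).map (Cyclic.d i)

/-- The injective totally ordered maps in `Λ'`: the composites of cofaces. -/
inductive injective : MorphismProperty BiaugmentedCyclic
  | id (n : ℕ) : injective (𝟙 (num n))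
  | comp {n m : ℕ} (f : num n ⟶ num m) (i : Fin (m + 1)) (hf : injective f) : injective (f ≫ d i)

/-- The category `(n ↓ Λ')[I⁻¹]`: the maps of the comma category that lie over injective totally
ordered maps are inverted. -/
abbrev LocalizedComma (n : ℕ) :=
  (injective.inverseImage (Under.forget (num n))).Localization

end BiaugmentedCyclic

end ShadowCoherence

open ShadowCoherence

/-! Parts 1 and 2 reduce to one fact about the free object: the functor `permutation` on its target
shadow category is faithful (`eq_of_permutation_map_eq`). A formal diagram is the image of a diagram
there, or in its opposite, so parallel composites already agree before evaluation.

Faithfulness has three layers. The first is that the target bicategory of the free normal lax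
functor is locally thin. Since the unit maps are invertible, a formal 1-cell is isomorphic to a list
of nonempty blocks `F(w)`. In terms of these normal forms every 2-cell merges consecutive blocks
(`Blocks.isMerge`), and the lengths of the blocks leave only one way to do so
(`Blocks.Merge.unique`). Uniqueness of 2-cells into a single symbol `F(w)` comes beforehand, from
the natural collapse of a formal 1-cell onto a single symbol.

The second layer is coherence for shadows over a locally thin bicategory in which cuts of the target
of a 2-cell lift to its source (`HasCuts`). By the hexagon, rotations compose to rotations
(`Shadow.IsRotation.comp`), so each morphism of the free shadow category rotates once, across one
cut, and then applies a 2-cell. The position reached by the first edge determines the cut, except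
that no rotation and a full rotation look alike; by the unit axioms both of these are induced by
2-cells, which are unique.

The third layer brings in the shadow commutators. The collapse gives a canonical morphism `canSh`
from a cyclic word into the image of `H`, natural in the word (`map_canSh`). Hence a morphism into
the image of `H` from outside is `canSh` followed by a morphism inside `H`; no generator leads back.
The bijection of `canSh` can be cancelled, and the second layer applies inside `H`.

Part 3 rests on a factorization in `Λ'`: a map is a split epimorphism or a map to the last object,
followed by a composite of cofaces or by the identity of the last object (`factors`), with diagonal
fillers (`exists_diagonal`). So every object under `n` has a functorial image. The structure map of
an image is epi, so an image has at most one map to any object. The image functor inverts `I`, and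
the inclusion of an image becomes invertible in the localization; by `isThin_localization` the
localization is thin. -/

namespace ShadowCoherence

open Category Bicategory

/-! ### Bicategories in which 2-cells respect cuts -/

/-- Componentwise maps between two factored 1-cells, with the same intermediate 0-cell. -/
inductive Componentwise {B : Type u} [Bicategory.{w, v} B] {a c : B} :
    ∀ {b b' : B}, (a ⟶ b) → (b ⟶ c) → (a ⟶ b') → (b' ⟶ c) → Prop
  | mk {b : B} {p p' : a ⟶ b} {q q' : b ⟶ c} (η : p ⟶ p') (θ : q ⟶ q') :
      Componentwise p q p' q'

/-- A locally thin bicategory whose 1-cells have lengths, in which decompositions of the target of a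
2-cell lift to the source and decompositions are determined by the length of the first factor. -/
structure HasCuts (B : Type u) [Bicategory.{w, v} B] (len : ∀ {a b : B}, (a ⟶ b) → ℕ) : Prop where
  thin {a b : B} (f g : a ⟶ b) : Subsingleton (f ⟶ g)
  len_id (a : B) : len (𝟙 a) = 0
  len_comp {a b c : B} (f : a ⟶ b) (g : b ⟶ c) : len (f ≫ g) = len f + len g
  len_eq {a b : B} {f g : a ⟶ b} (η : f ⟶ g) : len f = len g
  factor {a b b' c : B} {p : a ⟶ b} {q : b ⟶ c} {k : a ⟶ b'} {l : b' ⟶ c} (η : p ≫ q ⟶ k ≫ l) :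
    (∃ (k' : a ⟶ b') (m : b' ⟶ b),
      Nonempty (p ≅ k' ≫ m) ∧ Nonempty (k' ⟶ k) ∧ Nonempty (m ≫ q ⟶ l)) ∨
    ∃ (m : b ⟶ b') (l' : b' ⟶ c),
      Nonempty (q ≅ m ≫ l') ∧ Nonempty (p ≫ m ⟶ k) ∧ Nonempty (l' ⟶ l)
  cut {a b b' c : B} {p : a ⟶ b} {q : b ⟶ c} {p' : a ⟶ b'} {q' : b' ⟶ c}
    (η : p ≫ q ⟶ p' ≫ q') (h : len p = len p') : Componentwise p q p' q'

/-- 1-cells which are isomorphic to units. -/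
inductive IsUnitCell {B : Type u} [Bicategory.{w, v} B] : ∀ {a b : B}, (a ⟶ b) → Prop
  | mk {a : B} {f : a ⟶ a} (i : f ≅ 𝟙 a) : IsUnitCell f

theorem IsUnitCell.nonempty_iso {B : Type u} [Bicategory.{w, v} B] {a : B} {f : a ⟶ a}
    (h : IsUnitCell f) : Nonempty (f ≅ 𝟙 a) := by
  obtain ⟨i⟩ := h
  exact ⟨i⟩

/-- Both `f ≫ 𝟙 b` and `𝟙 a ≫ f` are isomorphic to `f`, and their first factors both have length
zero. Cutting there identifies the 0-cells and yields 2-cells between `f` and the unit in both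
directions, mutually inverse by thinness. -/
theorem HasCuts.isUnitCell {B : Type u} [Bicategory.{w, v} B] {len : ∀ {a b : B}, (a ⟶ b) → ℕ}
    (hB : HasCuts B len) {a b : B} (f : a ⟶ b) (h : len f = 0) : IsUnitCell f := by
  have key := hB.cut ((ρ_ f).hom ≫ (λ_ f).inv) (h.trans (hB.len_id a).symm)
  cases key with
  | mk η θ => exact ⟨⟨η, θ, (hB.thin _ _).elim _ _, (hB.thin _ _).elim _ _⟩⟩

/-! ### Cuts of paths and of 1-cells of the free bicategory -/

theorem path_comp_eq_comp {V : Type u} [Quiver.{v} V] {a c : V} {b b' : V} {p : Quiver.Path a b}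
    {q : Quiver.Path b c} {p' : Quiver.Path a b'} {q' : Quiver.Path b' c}
    (h : p.comp q = p'.comp q') :
    (∃ m, p = p'.comp m ∧ q' = m.comp q) ∨ ∃ m, p' = p.comp m ∧ q = m.comp q' := by
  induction q with
  | nil => exact Or.inl ⟨q', h, rfl⟩
  | cons q e ih =>
    cases q' with
    | nil => exact Or.inr ⟨q.cons e, h.symm, rfl⟩
    | cons q' e' =>
      simp only [Quiver.Path.comp_cons] at h
      injection h with h₁ _ h₂ h₃
      subst h₁
      cases h₃
      rcases ih (eq_of_heq h₂) with ⟨m, rfl, rfl⟩ | ⟨m, rfl, rfl⟩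
      · exact Or.inl ⟨m, rfl, rfl⟩
      · exact Or.inr ⟨m, rfl, rfl⟩

/-- Last edges are stripped from both sides; the lengths prevent one second factor from running out
before the other. -/
theorem path_comp_inj {V : Type u} [Quiver.{v} V] {a c : V} {b b' : V} {p : Quiver.Path a b}
    {q : Quiver.Path b c} {p' : Quiver.Path a b'} {q' : Quiver.Path b' c}
    (h : p.comp q = p'.comp q') (hl : p.length = p'.length) :
    ∃ hb : b = b', hb ▸ p = p' ∧ q = hb ▸ q' := by
  induction q with
  | nil =>
    have hq : q'.length = 0 := by
      have := congrArg Quiver.Path.length h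
      simp only [Quiver.Path.length_comp, Quiver.Path.length_nil] at this
      omega
    cases q' with
    | nil => exact ⟨rfl, h, rfl⟩
    | cons q' e => simp at hq
  | cons q e ih =>
    cases q' with
    | nil =>
      have := congrArg Quiver.Path.length h
      simp only [Quiver.Path.length_comp, Quiver.Path.length_nil, Quiver.Path.length_cons] at this
      omega
    | cons q' e' =>
      simp only [Quiver.Path.comp_cons] at h
      injection h with h₁ _ h₂ h₃
      subst h₁
      cases h₃
      obtain ⟨rfl, rfl, rfl⟩ := ih (eq_of_heq h₂)
      exact ⟨rfl, rfl, rfl⟩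

namespace FreeBicategory

variable {V : Type u} [Quiver.{v} V]

/-- The path underlying a 1-cell of the free bicategory. -/
def path {a b : FreeBicategory V} (f : a ⟶ b) : @Quiver.Path V _ a b :=
  CategoryTheory.FreeBicategory.normalizeAux (B := V) Quiver.Path.nil f

/-- The number of edges in a 1-cell of the free bicategory. -/
def len {a b : FreeBicategory V} (f : a ⟶ b) : ℕ := (path f).length

theorem path_comp {a b c : FreeBicategory V} (f : a ⟶ b) (g : b ⟶ c) :
    path (f ≫ g) = (path f).comp (path g) :=
  CategoryTheory.FreeBicategory.normalizeAux_nil_comp (B := V) f g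

theorem path_eq {a b : FreeBicategory V} {f g : a ⟶ b} (η : f ⟶ g) : path f = path g :=
  CategoryTheory.FreeBicategory.normalizeAux_congr (B := V) Quiver.Path.nil η

/-- Both 1-cells are isomorphic to the standard bracketing of their common path. -/
theorem nonempty_hom_of_path_eq {a b : FreeBicategory V} {f g : a ⟶ b} (h : path f = path g) :
    Nonempty (f ⟶ g) := by
  have i : ∀ f : a ⟶ b, f ≅
      (show a ⟶ b from CategoryTheory.FreeBicategory.inclusionPathAux (B := V) (path f)) :=
    fun f => (λ_ f).symm ≪≫
      CategoryTheory.FreeBicategory.normalizeIso (B := V) (a := a) (b := a) (c := b) .nil f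
  refine ⟨(i f).hom ≫ ?_ ≫ (i g).inv⟩
  rw [h]
  exact 𝟙 _

theorem exists_path_eq {a b : FreeBicategory V} (p : @Quiver.Path V _ a b) :
    ∃ f : a ⟶ b, path f = p := by
  induction p with
  | nil => exact ⟨𝟙 a, rfl⟩
  | @cons b c p e ih =>
    obtain ⟨f, rfl⟩ := ih
    exact ⟨FreeBicategory.Hom.comp (B := V) f (.of e), rfl⟩

/-- Thinness is the coherence theorem for bicategories. A 2-cell exists exactly when the underlying
paths agree, so the statements about cuts are those for paths. -/
theorem hasCuts : HasCuts (FreeBicategory V) (@len V _) where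
  thin f g := inferInstance
  len_id a := rfl
  len_comp f g := by exact (congrArg Quiver.Path.length (path_comp f g)).trans (Quiver.Path.length_comp _ _)
  len_eq η := congrArg Quiver.Path.length (path_eq η)
  factor {a b b' c p q k l} η := by
    have e := path_eq η
    rw [path_comp, path_comp] at e
    rcases path_comp_eq_comp e with ⟨m, h₁, h₂⟩ | ⟨m, h₁, h₂⟩
    · obtain ⟨m, rfl⟩ := exists_path_eq (a := b') (b := b) m
      rw [← path_comp] at h₁ h₂
      obtain ⟨η₁⟩ := nonempty_hom_of_path_eq h₁
      exact Or.inl ⟨k, m, ⟨@asIso _ _ _ _ η₁ (FreeNormalLax.isIso_free η₁)⟩, ⟨𝟙 k⟩,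
        nonempty_hom_of_path_eq h₂.symm⟩
    · obtain ⟨m, rfl⟩ := exists_path_eq (a := b) (b := b') m
      rw [← path_comp] at h₁ h₂
      obtain ⟨η₁⟩ := nonempty_hom_of_path_eq h₂
      exact Or.inr ⟨m, l, ⟨@asIso _ _ _ _ η₁ (FreeNormalLax.isIso_free η₁)⟩,
        nonempty_hom_of_path_eq h₁.symm, ⟨𝟙 l⟩⟩
  cut {a b b' c p q p' q'} η h := by
    have e := path_eq η
    rw [path_comp, path_comp] at e
    obtain ⟨hb, h₁, h₂⟩ := path_comp_inj e h
    change @Eq (FreeBicategory V) b b' at hb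
    subst hb
    obtain ⟨η₁⟩ := nonempty_hom_of_path_eq h₁
    obtain ⟨η₂⟩ := nonempty_hom_of_path_eq h₂
    exact ⟨η₁, η₂⟩

end FreeBicategory

/-! ### Structure 2-cells of the free normal lax functor -/

namespace FreeNormalLax

variable {V : Type u} [Quiver.{v} V]

/-- A 0-cell of the target of the universal lax functor, as a 0-cell of its source. -/
def toFr (a : FreeNormalLax V) : FreeBicategory V := a

/-- A 1-cell of the free bicategory, between 0-cells of the target of the universal lax functor. -/
abbrev Wd (a b : FreeNormalLax V) := toFr a ⟶ toFr b

section API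

variable {a b c d : FreeNormalLax V}

/-- The formal 1-cell `F(w)`. -/
def symb (w : Wd a b) : a ⟶ b := Hom.app (V := V) w

/-- The 2-cell `F(η)`. -/
def mapF {f g : Wd a b} (η : f ⟶ g) : symb f ⟶ symb g := (laxFunctor V).map₂ η

/-- The identity 1-cell of the free bicategory. -/
abbrev idW (a : FreeNormalLax V) : Wd a a := 𝟙 (toFr a)

/-- The unit constraint of the universal normal lax functor. -/
def unitF (a : FreeNormalLax V) : 𝟙 a ≅ symb (idW a) where
  hom := (laxFunctor V).mapId a
  inv := Quot.mk _ (Hom₂.mapIdInv a)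
  hom_inv_id := Quot.sound (Rel.mapId_hom_inv (V := V) a)
  inv_hom_id := Quot.sound (Rel.mapId_inv_hom (V := V) a)

/-- The composition constraint of the universal normal lax functor. -/
def mulF (f : Wd a b) (g : Wd b c) : symb f ≫ symb g ⟶ symb (f ≫ g) :=
  (laxFunctor V).mapComp f g

@[simp]
theorem mapF_id (f : Wd a b) : mapF (𝟙 f) = 𝟙 (symb f) := (laxFunctor V).map₂_id f

@[simp]
theorem mapF_comp {f g h : Wd a b} (η : f ⟶ g) (θ : g ⟶ h) :
    mapF (η ≫ θ) = mapF η ≫ mapF θ :=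
  (laxFunctor V).map₂_comp η θ

theorem mapF_congr {f g : Wd a b} (η θ : f ⟶ g) : mapF η = mapF θ :=
  congrArg mapF (Subsingleton.elim η θ)

theorem mulF_naturality_left {f f' : Wd a b} (η : f ⟶ f') (g : Wd b c) :
    mulF f g ≫ mapF (η ▷ g) = mapF η ▷ symb g ≫ mulF f' g :=
  (laxFunctor V).mapComp_naturality_left η g

theorem mulF_naturality_right (f : Wd a b) {g g' : Wd b c} (η : g ⟶ g') :
    mulF f g ≫ mapF (f ◁ η) = symb f ◁ mapF η ≫ mulF f g' :=
  (laxFunctor V).mapComp_naturality_right f η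

theorem mulF_associator (f : Wd a b) (g : Wd b c) (h : Wd c d) :
    mulF f g ▷ symb h ≫ mulF (f ≫ g) h ≫ mapF (α_ f g h).hom =
      (α_ (symb f) (symb g) (symb h)).hom ≫ symb f ◁ mulF g h ≫ mulF f (g ≫ h) :=
  (laxFunctor V).map₂_associator f g h

theorem mapF_leftUnitor_inv (f : Wd a b) :
    mapF (λ_ f).inv = (λ_ (symb f)).inv ≫ (unitF a).hom ▷ symb f ≫ mulF (idW a) f :=
  (laxFunctor V).map₂_leftUnitor f

theorem mapF_rightUnitor_inv (f : Wd a b) :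
    mapF (ρ_ f).inv = (ρ_ (symb f)).inv ≫ symb f ◁ (unitF b).hom ≫ mulF f (idW b) :=
  (laxFunctor V).map₂_rightUnitor f

end API

section Induction

/-- Recursion over the 1-cells. -/
noncomputable def homRec {motive : ∀ a b : FreeNormalLax V, (a ⟶ b) → Type w}
    (onSymb : ∀ (a b : FreeNormalLax V) (w : Wd a b), motive a b (symb w))
    (onId : ∀ a : FreeNormalLax V, motive a a (𝟙 a))
    (onComp : ∀ {a b c : FreeNormalLax V} (f : a ⟶ b) (g : b ⟶ c),
      motive a b f → motive b c g → motive a c (f ≫ g)) {a b : FreeNormalLax V} (f : a ⟶ b) :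
    motive a b f :=
  @Hom.rec V _ (fun a b f => motive a b f) (fun {a b} w => onSymb a b w)
    (fun a => onId a) (fun {a b c} f g hf hg => onComp (a := a) (b := b) (c := c) f g hf hg) a b f

/-- Induction over the 1-cells. -/
theorem hom_induction {motive : ∀ a b : FreeNormalLax V, (a ⟶ b) → Prop}
    (onSymb : ∀ (a b : FreeNormalLax V) (w : Wd a b), motive a b (symb w))
    (onId : ∀ a : FreeNormalLax V, motive a a (𝟙 a))
    (onComp : ∀ {a b c : FreeNormalLax V} (f : a ⟶ b) (g : b ⟶ c),
      motive a b f → motive b c g → motive a c (f ≫ g)) {a b : FreeNormalLax V} (f : a ⟶ b) :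
    motive a b f :=
  @Hom.rec V _ (fun a b f => motive a b f) (fun {a b} w => onSymb a b w)
    (fun a => onId a) (fun {a b c} f g hf hg => onComp (a := a) (b := b) (c := c) f g hf hg) a b f

/-- Induction over the 2-cells. -/
theorem hom₂_induction {motive : ∀ {a b : FreeNormalLax V} {f g : a ⟶ b}, (f ⟶ g) → Prop}
    (id : ∀ {a b : FreeNormalLax V} (f : a ⟶ b), motive (𝟙 f))
    (comp : ∀ {a b : FreeNormalLax V} {f g h : a ⟶ b} (η : f ⟶ g) (θ : g ⟶ h),
      motive η → motive θ → motive (η ≫ θ))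
    (whiskerLeft : ∀ {a b c : FreeNormalLax V} (f : a ⟶ b) {g h : b ⟶ c} (η : g ⟶ h),
      motive η → motive (f ◁ η))
    (whiskerRight : ∀ {a b c : FreeNormalLax V} {f g : a ⟶ b} (η : f ⟶ g) (h : b ⟶ c),
      motive η → motive (η ▷ h))
    (associator : ∀ {a b c d : FreeNormalLax V} (f : a ⟶ b) (g : b ⟶ c) (h : c ⟶ d),
      motive (α_ f g h).hom)
    (leftUnitor : ∀ {a b : FreeNormalLax V} (f : a ⟶ b), motive (λ_ f).hom)
    (rightUnitor : ∀ {a b : FreeNormalLax V} (f : a ⟶ b), motive (ρ_ f).hom)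
    (associatorInv : ∀ {a b c d : FreeNormalLax V} (f : a ⟶ b) (g : b ⟶ c) (h : c ⟶ d),
      motive (α_ f g h).inv)
    (leftUnitorInv : ∀ {a b : FreeNormalLax V} (f : a ⟶ b), motive (λ_ f).inv)
    (rightUnitorInv : ∀ {a b : FreeNormalLax V} (f : a ⟶ b), motive (ρ_ f).inv)
    (unitFInv : ∀ a : FreeNormalLax V, motive (unitF a).inv)
    (mapF : ∀ {a b : FreeNormalLax V} {f g : Wd a b} (η : f ⟶ g), motive (mapF η))
    (unitF : ∀ a : FreeNormalLax V, motive (unitF a).hom)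
    (mulF : ∀ {a b c : FreeNormalLax V} (f : Wd a b) (g : Wd b c), motive (mulF f g))
    {a b : FreeNormalLax V} {f g : a ⟶ b} (η : f ⟶ g) : motive η := by
  refine Quot.ind (fun p => ?_) η
  clear η
  induction p with
  | id f => exact id f
  | vcomp p q hp hq => exact comp (Quot.mk _ p) (Quot.mk _ q) hp hq
  | whiskerLeft f p hp => exact whiskerLeft f (Quot.mk _ p) hp
  | whiskerRight h p hp => exact whiskerRight (Quot.mk _ p) h hp
  | associator f g h => exact associator f g h
  | associatorInv f g h => exact associatorInv f g h
  | rightUnitor f => exact rightUnitor f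
  | rightUnitorInv f => exact rightUnitorInv f
  | leftUnitor f => exact leftUnitor f
  | leftUnitorInv f => exact leftUnitorInv f
  | @map₂ a b f g η => exact @mapF a b f g η
  | mapId a => exact unitF a
  | mapIdInv a => exact unitFInv a
  | mapComp f g => exact mulF f g

end Induction

/-! ### The collapse, and uniqueness of 2-cells into a symbol or a unit -/

/-- A 1-cell of the free bicategory, together with a map to its symbol. -/
structure Collapse {a b : FreeNormalLax V} (f : a ⟶ b) where
  cell : Wd a b
  map : f ⟶ symb cell

/-- The collapse of a formal 1-cell: all symbols `F` are dropped. -/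
noncomputable def coll {a b : FreeNormalLax V} (f : a ⟶ b) : Collapse f :=
  homRec (motive := fun _ _ f => Collapse f) (fun _ _ w => ⟨w, 𝟙 _⟩) (fun a => ⟨idW a, (unitF a).hom⟩)
    (fun _ g F G => ⟨F.cell ≫ G.cell, (F.map ▷ g ≫ symb F.cell ◁ G.map) ≫ mulF F.cell G.cell⟩) f

section Coll

variable {a b c d : FreeNormalLax V}

theorem coll_comp (f : a ⟶ b) (g : b ⟶ c) :
    coll (f ≫ g) = ⟨(coll f).cell ≫ (coll g).cell, ((coll f).map ▷ g ≫
      symb (coll f).cell ◁ (coll g).map) ≫ mulF (coll f).cell (coll g).cell⟩ := rfl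

theorem coll_id : coll (𝟙 a) = ⟨idW a, (unitF a).hom⟩ := rfl

theorem coll_symb (w : Wd a b) : coll (symb w) = ⟨w, 𝟙 (symb w)⟩ := rfl

theorem coll_map_associator (f : a ⟶ b) (g : b ⟶ c) (h : c ⟶ d) :
    ∃ φ : (coll ((f ≫ g) ≫ h)).cell ≅ (coll (f ≫ g ≫ h)).cell,
      (α_ f g h).hom ≫ (coll (f ≫ g ≫ h)).map = (coll ((f ≫ g) ≫ h)).map ≫ mapF φ.hom := by
  rw [coll_comp f, coll_comp (f ≫ g), coll_comp f, coll_comp g]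
  refine ⟨α_ _ _ _, ?_⟩
  have h₁ := mulF_associator (coll f).cell (coll g).cell (coll h).cell
  simp only [comp_whiskerRight, Category.assoc, Bicategory.whiskerLeft_comp]
  -- Interchange brings the two composition maps next to each other, so that the associativity axiom
  -- of the lax functor applies.
  rw [← whisker_exchange_assoc (mulF _ _) (coll h).map, h₁]
  simp

theorem coll_map_leftUnitor (f : a ⟶ b) :
    ∃ φ : (coll (𝟙 a ≫ f)).cell ≅ (coll f).cell,
      (λ_ f).hom ≫ (coll f).map = (coll (𝟙 a ≫ f)).map ≫ mapF φ.hom := by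
  rw [coll_comp, coll_id]
  refine ⟨λ_ _, ?_⟩
  have h₁ : mapF (λ_ (coll f).cell).inv ≫ mapF (λ_ (coll f).cell).hom = 𝟙 _ := by
    rw [← mapF_comp, Iso.inv_hom_id, mapF_id]
  rw [mapF_leftUnitor_inv] at h₁
  rw [← Iso.eq_inv_comp]
  -- The inserted identity is `F` of the unitor and its inverse; the unit axiom expands the inverse
  -- into the unit map and a composition map, as in the collapse of a composite.
  conv_lhs => rw [← Category.comp_id (coll f).map, ← h₁]
  rw [← whisker_exchange]
  simp

theorem coll_map_rightUnitor (f : a ⟶ b) :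
    ∃ φ : (coll (f ≫ 𝟙 b)).cell ≅ (coll f).cell,
      (ρ_ f).hom ≫ (coll f).map = (coll (f ≫ 𝟙 b)).map ≫ mapF φ.hom := by
  rw [coll_comp, coll_id]
  refine ⟨ρ_ _, ?_⟩
  have h₁ : mapF (ρ_ (coll f).cell).inv ≫ mapF (ρ_ (coll f).cell).hom = 𝟙 _ := by
    rw [← mapF_comp, Iso.inv_hom_id, mapF_id]
  rw [mapF_rightUnitor_inv] at h₁
  rw [← Iso.eq_inv_comp]
  conv_lhs => rw [← Category.comp_id (coll f).map, ← h₁]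
  simp

theorem coll_map_inv {f g : a ⟶ b} (i : f ≅ g)
    (h : ∃ φ : (coll f).cell ≅ (coll g).cell, i.hom ≫ (coll g).map = (coll f).map ≫ mapF φ.hom) :
    ∃ φ : (coll g).cell ≅ (coll f).cell, i.inv ≫ (coll f).map = (coll g).map ≫ mapF φ.hom := by
  obtain ⟨φ, hφ⟩ := h
  refine ⟨φ.symm, ?_⟩
  rw [Iso.inv_comp_eq, ← Category.assoc, hφ, Category.assoc, ← mapF_comp]
  simp

theorem coll_map_unitF (a : FreeNormalLax V) :
    ∃ φ : (coll (𝟙 a)).cell ≅ (coll (symb (idW a))).cell,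
      (unitF a).hom ≫ (coll (symb (idW a))).map = (coll (𝟙 a)).map ≫ mapF φ.hom := by
  rw [coll_symb, coll_id]
  exact ⟨Iso.refl _, by simp⟩

/-- The collapse is natural: associators and unitors collapse to themselves by the axioms of a lax
functor, while composition and unit maps, being built into the collapse, collapse to identities.
Mere existence of `φ` suffices, because 2-cells of the free bicategory are unique. -/
theorem exists_coll_map {f g : a ⟶ b} (η : f ⟶ g) :
    ∃ φ : (coll f).cell ≅ (coll g).cell, η ≫ (coll g).map = (coll f).map ≫ mapF φ.hom := by
  induction η using hom₂_induction with
  | id f => exact ⟨Iso.refl _, by simp⟩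
  | comp η θ hη hθ =>
    obtain ⟨φ, hφ⟩ := hη
    obtain ⟨ψ, hψ⟩ := hθ
    refine ⟨φ ≪≫ ψ, ?_⟩
    rw [Category.assoc, hψ, ← Category.assoc, hφ, Iso.trans_hom, mapF_comp, Category.assoc]
  | whiskerLeft f η hη =>
    obtain ⟨φ, hφ⟩ := hη
    rw [coll_comp, coll_comp]
    refine ⟨whiskerLeftIso _ φ, ?_⟩
    rw [whiskerLeftIso_hom, Category.assoc _ (mulF _ _), mulF_naturality_right,
      Category.assoc, Category.assoc, whisker_exchange_assoc, ← Bicategory.whiskerLeft_comp_assoc, hφ]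
    simp
  | whiskerRight η h hη =>
    obtain ⟨φ, hφ⟩ := hη
    rw [coll_comp, coll_comp]
    refine ⟨whiskerRightIso φ _, ?_⟩
    rw [whiskerRightIso_hom, Category.assoc _ (mulF _ _), mulF_naturality_left,
      ← Category.assoc, ← comp_whiskerRight_assoc, hφ, comp_whiskerRight]
    simp [whisker_exchange_assoc]
  | associator f g h => exact coll_map_associator f g h
  | leftUnitor f => exact coll_map_leftUnitor f
  | rightUnitor f => exact coll_map_rightUnitor f
  | associatorInv f g h => exact coll_map_inv _ (coll_map_associator f g h)
  | leftUnitorInv f => exact coll_map_inv _ (coll_map_leftUnitor f)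
  | rightUnitorInv f => exact coll_map_inv _ (coll_map_rightUnitor f)
  | unitFInv a => exact coll_map_inv _ (coll_map_unitF a)
  | mapF η =>
    rw [coll_symb, coll_symb]
    exact ⟨@asIso _ _ _ _ η (isIso_free η), by simp⟩
  | unitF a => exact coll_map_unitF a
  | mulF f g =>
    rw [coll_comp, coll_symb, coll_symb, coll_symb]
    exact ⟨Iso.refl _, by simp⟩

/-- A map to a symbol `F(w)` factors through the collapse. -/
theorem exists_eq_coll_map_comp {f : a ⟶ b} {w : Wd a b} (η : f ⟶ symb w) :
    ∃ φ : (coll f).cell ⟶ w, η = (coll f).map ≫ mapF φ := by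
  have h := exists_coll_map η
  rw [coll_symb] at h
  obtain ⟨φ, h⟩ := h
  exact ⟨φ.hom, by rw [← h, Category.comp_id]⟩

instance subsingleton_hom_symb (f : a ⟶ b) (w : Wd a b) : Subsingleton (f ⟶ symb w) :=
  ⟨fun η θ => by
    obtain ⟨φ, rfl⟩ := exists_eq_coll_map_comp η
    obtain ⟨ψ, rfl⟩ := exists_eq_coll_map_comp θ
    rw [mapF_congr φ ψ]⟩

/-- Normality enters here: the unit map is invertible, hence mono, and it leads into a symbol. -/
instance subsingleton_hom_id (f : a ⟶ a) : Subsingleton (f ⟶ 𝟙 a) :=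
  ⟨fun η θ => by
    rw [← cancel_mono (unitF a).hom]
    exact Subsingleton.elim _ _⟩

end Coll

end FreeNormalLax
-- A word without edges has equal ends only propositionally; in this form the end can be replaced by
-- the source without explicit transports.
theorem FreeBicategory.induction_of_len_eq_zero {V : Type u} [Quiver.{v} V] {a : FreeBicategory V}
    {motive : ∀ b : FreeBicategory V, (a ⟶ b) → Prop}
    (H : ∀ f : a ⟶ a, Nonempty (f ≅ 𝟙 a) → motive a f) {b : FreeBicategory V} (f : a ⟶ b)
    (h : FreeBicategory.len f = 0) : motive b f := by
  cases FreeBicategory.hasCuts.isUnitCell f h with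
  | mk i => exact H _ ⟨i⟩

/-! ### Lengths of formal 1-cells -/

namespace FreeNormalLax

variable {V : Type u} [Quiver.{v} V]

/-- The number of edges in a formal 1-cell. -/
noncomputable def len {a b : FreeNormalLax V} (f : a ⟶ b) : ℕ := FreeBicategory.len (coll f).cell

section Len

variable {a b c : FreeNormalLax V}

theorem len_comp (f : a ⟶ b) (g : b ⟶ c) : len (f ≫ g) = len f + len g :=
  FreeBicategory.hasCuts.len_comp (coll f).cell (coll g).cell

theorem len_id (a : FreeNormalLax V) : len (𝟙 a) = 0 := rfl

theorem len_symb (w : Wd a b) : len (symb w) = FreeBicategory.len w := rfl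

theorem len_eq {f g : a ⟶ b} (η : f ⟶ g) : len f = len g := by
  obtain ⟨φ, -⟩ := exists_coll_map η
  exact FreeBicategory.hasCuts.len_eq φ.hom

theorem isUnit_symb (w : Wd a b) (h : FreeBicategory.len w = 0) : IsUnitCell (symb w) := by
  refine FreeBicategory.induction_of_len_eq_zero
    (motive := fun b w => IsUnitCell (@symb V _ a b w)) (fun f ⟨i⟩ => ?_) w h
  let j : symb (a := a) (b := a) f ≅ symb (idW a) :=
    { hom := mapF i.hom
      inv := mapF i.inv
      hom_inv_id := by rw [← mapF_comp, i.hom_inv_id, mapF_id]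
      inv_hom_id := by rw [← mapF_comp, i.inv_hom_id, mapF_id] }
  exact ⟨j ≪≫ (unitF a).symm⟩

theorem nonempty_symb_iso_id (w : Wd b b) (h : FreeBicategory.len w = 0) :
    Nonempty (symb w ≅ 𝟙 b) := (isUnit_symb w h).nonempty_iso

end Len

/-! ### Normal forms by lists of blocks, and local thinness -/

/-- Lists of nonempty blocks: normal forms of the 1-cells. -/
inductive Blocks (a : FreeNormalLax V) : FreeNormalLax V → Type (max u v)
  | nil : Blocks a a
  | snoc {b c : FreeNormalLax V} (P : Blocks a b) (w : Wd b c) (hw : FreeBicategory.len w ≠ 0) :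
      Blocks a c

namespace Blocks

variable {a b c d : FreeNormalLax V}

/-- The 1-cell of a list of blocks. -/
@[reducible]
def cell : ∀ {b : FreeNormalLax V}, Blocks a b → (a ⟶ b)
  | _, nil => 𝟙 a
  | _, snoc P w _ => cell P ≫ symb w

/-- The maps between lists of blocks which merge consecutive blocks. -/
inductive Merge : ∀ {b : FreeNormalLax V} (P Q : Blocks a b), (P.cell ⟶ Q.cell) → Prop
  | nil : Merge nil nil (𝟙 (𝟙 a))
  | snoc {b c : FreeNormalLax V} {P Q : Blocks a b} {φ : P.cell ⟶ Q.cell} {w w' : Wd b c}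
      (hw : FreeBicategory.len w ≠ 0) (hw' : FreeBicategory.len w' ≠ 0) (h : Merge P Q φ)
      (μ : symb w ⟶ symb w') :
      Merge (P.snoc w hw) (Q.snoc w' hw') (φ ▷ symb w ≫ Q.cell ◁ μ)
  | merge {b c d : FreeNormalLax V} {P : Blocks a c} {Q : Blocks a b} {q : Wd b c} {w : Wd c d}
      {w' : Wd b d} {hq : FreeBicategory.len q ≠ 0} {φ : P.cell ⟶ (Q.snoc q hq).cell}
      (hw : FreeBicategory.len w ≠ 0) (hw' : FreeBicategory.len w' ≠ 0)
      (h : Merge P (Q.snoc q hq) φ) (μ : symb q ≫ symb w ⟶ symb w') :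
      Merge (P.snoc w hw) (Q.snoc w' hw')
        (φ ▷ symb w ≫ (α_ Q.cell (symb q) (symb w)).hom ≫ Q.cell ◁ μ)

namespace Merge

theorem of_eq {P Q : Blocks a b} {φ ψ : P.cell ⟶ Q.cell} (h : Merge P Q φ) (e : φ = ψ) :
    Merge P Q ψ := e ▸ h

theorem id (P : Blocks a b) : Merge P P (𝟙 P.cell) := by
  induction P with
  | nil => exact nil
  | snoc P w hw ih => exact (snoc hw hw ih (𝟙 _)).of_eq (by simp)

theorem comp {P Q R : Blocks a b} {φ : P.cell ⟶ Q.cell} {ψ : Q.cell ⟶ R.cell}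
    (h : Merge P Q φ) (k : Merge Q R ψ) : Merge P R (φ ≫ ψ) := by
  induction h with
  | nil =>
    cases k
    exact nil.of_eq (by simp)
  | snoc hw hw' h μ ih =>
    cases k with
    | snoc _ hw'' k ν =>
      refine (snoc hw hw'' (ih k) (μ ≫ ν)).of_eq ?_
      simp [whisker_exchange_assoc]
    | merge _ hw'' k ν =>
      refine (merge hw hw'' (ih k) (_ ◁ μ ≫ ν)).of_eq ?_
      simp [whisker_exchange_assoc]
  | @merge b c d P Q q w w' hq φ hw hw' h μ ih =>
    cases k with
    | snoc _ hw'' k ν =>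
      refine (merge hw hw'' (ih (snoc hq hq k (𝟙 _))) (μ ≫ ν)).of_eq ?_
      simp [whisker_exchange_assoc]
    -- Both maps merge at the end, so the blocks `z`, `q` and `w` become one. The composite merges
    -- `z` with `q` first and then with `w`; the comparison `χ` exists because any map into a symbol
    -- factors through the collapse.
    | @merge b₀ _ _ _ R z _ w'' hz ψ _ hw'' k ν =>
      have hzq : FreeBicategory.len (z ≫ q) ≠ 0 := by
        rw [FreeBicategory.hasCuts.len_comp]
        omega
      obtain ⟨χ, hχ⟩ := exists_eq_coll_map_comp ((α_ _ _ _).hom ≫ symb z ◁ μ ≫ ν)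
      refine (merge hw hw'' (ih (merge hq hzq k (mulF z q))) (mulF (z ≫ q) w ≫ mapF χ)).of_eq ?_
      have e : (α_ _ _ _).hom ≫ symb z ◁ μ ≫ ν =
        mulF z q ▷ symb w ≫ (mulF (z ≫ q) w ≫ mapF χ) := Subsingleton.elim _ _
      have e' := congrArg (fun x => (α_ R.cell (symb z ≫ symb q) (symb w)).hom ≫ R.cell ◁ x) e
      simp only [Bicategory.whiskerLeft_comp] at e'
      simp only [comp_whiskerRight, Category.assoc, Bicategory.whiskerLeft_comp]
      simp only [associator_naturality_middle_assoc, ← e']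
      simp [whisker_exchange_assoc]

/-- Blocks are nonempty, so the last target block has the length of the last source block in the
`snoc` case and is strictly longer in the `merge` case: the two maps end with the same constructor.
The remaining 2-cells end in symbols and are unique. -/
theorem unique {P Q : Blocks a b} {φ ψ : P.cell ⟶ Q.cell}
    (h : Merge P Q φ) (k : Merge P Q ψ) : φ = ψ := by
  induction h with
  | nil => 
    cases k
    rfl
  | @snoc _ _ P Q φ w w' hw hw' h μ ih =>
    cases k with
    | snoc _ _ k ν => rw [ih k, Subsingleton.elim μ ν]
    | merge _ _ k ν =>
      have h₁ := len_eq μ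
      have h₂ := len_eq ν
      rw [len_comp] at h₂
      simp only [len_symb] at h₁ h₂
      omega
  | @merge b c d P Q q w w' hq φ hw hw' h μ ih =>
    cases k with
    | snoc _ _ k ν =>
      have h₁ := len_eq μ
      have h₂ := len_eq ν
      rw [len_comp] at h₁
      simp only [len_symb] at h₁ h₂
      omega
    | @merge b' _ _ _ _ q' _ _ hq' ψ _ _ k ν =>
      obtain ⟨x, -⟩ := exists_eq_coll_map_comp μ
      obtain ⟨y, -⟩ := exists_eq_coll_map_comp ν
      have h₁ := len_eq μ
      have h₂ := len_eq ν
      rw [len_comp] at h₁ h₂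
      simp only [len_symb] at h₁ h₂
      -- The two merges may use different words `q'` and `q` for what precedes `w`. They have equal
      -- lengths, so cutting `q' ≫ w ⟶ q ≫ w` gives a 2-cell `θ` along which one merge is
      -- transported to the other.
      have hc := FreeBicategory.hasCuts.cut (p := q') (q := w) (p' := q) (q' := w)
        (y ≫ invFree x) (by omega)
      obtain ⟨θ⟩ : Nonempty (q' ⟶ q) := by
        cases hc with
        | mk θ _ => exact ⟨θ⟩
      rw [ih (k.comp (snoc hq' hq (id Q) (mapF θ)))]
      have e : mapF θ ▷ symb w ≫ μ = ν := Subsingleton.elim _ _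
      rw [← e]
      simp

end Merge

/-- A normal form of the composite of a list of blocks with a 1-cell. -/
structure Norm (P : Blocks a b) (f : b ⟶ c) where
  blocks : Blocks a c
  iso : P.cell ≫ f ≅ blocks.cell

/-- The normal form of the composite with a 1-cell isomorphic to a unit. -/
inductive Norm.IsTrivial (P : Blocks a b) :
    ∀ {c : FreeNormalLax V} {f : b ⟶ c}, Norm P f → Prop
  | mk {f : b ⟶ b} (i : f ≅ 𝟙 b) : IsTrivial P ⟨P, whiskerLeftIso P.cell i ≪≫ ρ_ P.cell⟩

/-- 2-cells into a unit are unique, so the chosen isomorphism to the unit is immaterial. -/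
theorem Norm.IsTrivial.eq {P : Blocks a b} {f : b ⟶ b} {n : Norm P f} (h : n.IsTrivial)
    (i : f ≅ 𝟙 b) : n = ⟨P, whiskerLeftIso P.cell i ≪≫ ρ_ P.cell⟩ := by
  obtain ⟨j⟩ := h
  have : j = i := Iso.ext (Subsingleton.elim _ _)
  rw [this]

theorem exists_isTrivial (P : Blocks a b) (w : Wd b c) (h : FreeBicategory.len w = 0) :
    ∃ n : Norm P (symb w), n.IsTrivial := by
  have key := isUnit_symb w h
  -- Once the symbol is an arbitrary 1-cell, case analysis can identify its two ends.
  generalize symb w = f at key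
  obtain ⟨i⟩ := key
  exact ⟨_, ⟨i⟩⟩

open Classical in
/-- The normal form of the composite with a symbol. -/
noncomputable def actSymb (P : Blocks a b) (w : Wd b c) : Norm P (symb w) :=
  if h : FreeBicategory.len w = 0 then (exists_isTrivial P w h).choose
  else ⟨P.snoc w h, Iso.refl _⟩

/-- The normal form of a composite. -/
noncomputable def act (f : b ⟶ c) : ∀ {a : FreeNormalLax V} (P : Blocks a b), Norm P f :=
  fun {a} => homRec (motive := fun b _ f => ∀ (a : FreeNormalLax V) (P : Blocks a b), Norm P f)
    (fun _ _ w _ P => actSymb P w) (fun _ _ P => ⟨P, ρ_ _⟩)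
    (fun _ g F G a P => ⟨(G a (F a P).blocks).blocks,
      (α_ _ _ _).symm ≪≫ whiskerRightIso (F a P).iso g ≪≫ (G a (F a P).blocks).iso⟩) f a

theorem act_id (P : Blocks a b) : act (𝟙 b) P = ⟨P, ρ_ P.cell⟩ := rfl

theorem act_comp (f : b ⟶ c) (g : c ⟶ d) (P : Blocks a b) :
    act (f ≫ g) P = ⟨(act g (act f P).blocks).blocks, (α_ _ _ _).symm ≪≫
      whiskerRightIso (act f P).iso g ≪≫ (act g (act f P).blocks).iso⟩ := rfl

theorem act_symb_of_ne (P : Blocks a b) (w : Wd b c) (h : FreeBicategory.len w ≠ 0) :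
    act (symb w) P = ⟨P.snoc w h, Iso.refl _⟩ := dif_neg h

theorem act_symb_of_eq (P : Blocks a b) (w : Wd b b) (i : symb w ≅ 𝟙 b) :
    act (symb w) P = ⟨P, whiskerLeftIso P.cell i ≪≫ ρ_ P.cell⟩ := by
  have h : FreeBicategory.len w = 0 := len_eq i.hom
  have h₁ : act (symb w) P = (exists_isTrivial P w h).choose := dif_pos h
  have h₂ := (exists_isTrivial P w h).choose_spec
  rw [← h₁] at h₂
  exact h₂.eq i

/-- Case distinction for words of the free bicategory. -/
theorem symb_cases {b : FreeNormalLax V}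
    {motive : ∀ {c : FreeNormalLax V}, Wd b c → Prop}
    (ne : ∀ {c : FreeNormalLax V} (w : Wd b c), FreeBicategory.len w ≠ 0 → motive w)
    (eq : ∀ (w : Wd b b) (_ : symb w ≅ 𝟙 b), motive w) {c : FreeNormalLax V} (w : Wd b c) :
    motive w := by
  by_cases h : FreeBicategory.len w = 0
  · refine FreeBicategory.induction_of_len_eq_zero
      (motive := fun c w => FreeBicategory.len w = 0 → @motive c w) (fun f _ hf => ?_) w h h
    have key := isUnit_symb (a := b) (b := b) f hf
    generalize hg : symb (a := b) (b := b) f = g at key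
    obtain ⟨i⟩ := key
    exact eq f (eqToIso hg ≪≫ i)
  · exact ne w h

namespace Merge

/-- Naturality of normalization in the list: appending a symbol leaves the merging map as it is or
adds one block to it. This is what right whiskering requires. -/
theorem exists_act {P Q : Blocks a b} {φ : P.cell ⟶ Q.cell} (h : Merge P Q φ) (f : b ⟶ c) :
    ∃ ψ, Merge (act f P).blocks (act f Q).blocks ψ ∧
      φ ▷ f ≫ (act f Q).iso.hom = (act f P).iso.hom ≫ ψ := by
  induction f using hom_induction with
  | onSymb b c w =>
    induction w using symb_cases with
    | ne w hw =>
      rw [act_symb_of_ne _ _ hw, act_symb_of_ne _ _ hw]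
      exact ⟨_, snoc hw hw h (𝟙 _), by simp⟩
    | eq w i =>
      rw [act_symb_of_eq _ _ i, act_symb_of_eq _ _ i]
      exact ⟨φ, h, by simp [← whisker_exchange_assoc]⟩
  | onId b =>
    rw [act_id, act_id]
    exact ⟨φ, h, by simp⟩
  | onComp f g hf hg =>
    rw [act_comp, act_comp]
    obtain ⟨ψ, h₁, e₁⟩ := hf h
    obtain ⟨χ, h₂, e₂⟩ := hg h₁
    refine ⟨χ, h₂, ?_⟩
    simp only [Iso.trans_hom, Iso.symm_hom, whiskerRightIso_hom, Category.assoc]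
    rw [associator_inv_naturality_left_assoc, ← comp_whiskerRight_assoc, e₁,
      comp_whiskerRight_assoc, e₂]

end Merge

/-- A 2-cell is a merging map, up to passing to normal forms. -/
def IsMerge {f g : b ⟶ c} (η : f ⟶ g) (P : Blocks a b) : Prop :=
  ∃ κ, Merge (act f P).blocks (act g P).blocks κ ∧
      P.cell ◁ η ≫ (act g P).iso.hom = (act f P).iso.hom ≫ κ

theorem isMerge_associator {e : FreeNormalLax V} (P : Blocks a b) (f : b ⟶ c) (g : c ⟶ d)
    (h : d ⟶ e) : IsMerge (α_ f g h).hom P ∧ IsMerge (α_ f g h).inv P := by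
  unfold IsMerge
  rw [act_comp f, act_comp (f ≫ g), act_comp f, act_comp g]
  exact ⟨⟨_, Merge.id _, by simp⟩, ⟨_, Merge.id _, by simp⟩⟩

theorem isMerge_leftUnitor (P : Blocks a b) (f : b ⟶ c) :
    IsMerge (λ_ f).hom P ∧ IsMerge (λ_ f).inv P := by
  unfold IsMerge
  rw [act_comp, act_id]
  exact ⟨⟨_, Merge.id _, by simp⟩, ⟨_, Merge.id _, by simp⟩⟩

theorem isMerge_rightUnitor (P : Blocks a b) (f : b ⟶ c) :
    IsMerge (ρ_ f).hom P ∧ IsMerge (ρ_ f).inv P := by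
  unfold IsMerge
  rw [act_comp, act_id]
  exact ⟨⟨_, Merge.id _, by simp⟩, ⟨_, Merge.id _, by simp⟩⟩

theorem isMerge_unitF (P : Blocks a b) :
    IsMerge (unitF b).hom P ∧ IsMerge (unitF b).inv P := by
  unfold IsMerge
  rw [act_symb_of_eq _ _ (unitF b).symm, act_id]
  exact ⟨⟨_, Merge.id _, by simp⟩, ⟨_, Merge.id _, by simp⟩⟩

theorem isMerge_mapF (P : Blocks a b) {f g : Wd b c} (η : f ⟶ g) : IsMerge (mapF η) P := by
  unfold IsMerge
  have hl := FreeBicategory.hasCuts.len_eq η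
  induction f using symb_cases with
  | ne f hf =>
    rw [act_symb_of_ne _ _ hf, act_symb_of_ne _ _ (hl ▸ hf)]
    exact ⟨_, Merge.snoc _ _ (Merge.id P) (mapF η), by simp⟩
  | eq f i =>
    -- If the source is a unit up to isomorphism then so is the target; both leave the list
    -- unchanged, and the merging map is the identity.
    have j : symb g ≅ symb f :=
      { hom := mapF (invFree η)
        inv := mapF η
        hom_inv_id := Subsingleton.elim _ _
        inv_hom_id := Subsingleton.elim _ _ }
    rw [act_symb_of_eq _ _ i, act_symb_of_eq _ _ (j ≪≫ i)]
    refine ⟨_, Merge.id _, ?_⟩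
    have e : mapF η ≫ (j ≪≫ i).hom = i.hom := Subsingleton.elim _ _
    have e' := congrArg (P.cell ◁ ·) e
    simp only [Iso.trans_hom, Bicategory.whiskerLeft_comp] at e'
    simp [reassoc_of% e']

theorem isMerge_mulF (P : Blocks a b) (f : Wd b c) (g : Wd c d) : IsMerge (mulF f g) P := by
  unfold IsMerge
  have hl := FreeBicategory.hasCuts.len_comp f g
  rw [act_comp]
  induction f using symb_cases with
  | ne f hf =>
    have hfg : FreeBicategory.len (f ≫ g) ≠ 0 := by omega
    rw [act_symb_of_ne _ _ hf, act_symb_of_ne _ _ hfg]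
    induction g using symb_cases with
    | ne g hg =>
      rw [act_symb_of_ne _ _ hg]
      exact ⟨_, Merge.merge hg hfg (Merge.id _) (mulF f g), by simp⟩
    | eq g i =>
      rw [act_symb_of_eq _ _ i]
      -- When one of the two words is empty nothing merges: the composition map then only changes
      -- the word in the surviving block.
      exact ⟨_, Merge.snoc hf hfg (Merge.id _)
        ((ρ_ _).inv ≫ symb f ◁ i.inv ≫ mulF f g), by simp⟩
  | eq f i =>
    rw [act_symb_of_eq _ _ i]
    induction g using symb_cases with
    | ne g hg =>
      have hfg : FreeBicategory.len (f ≫ g) ≠ 0 := by omega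
      rw [act_symb_of_ne _ _ hg, act_symb_of_ne _ _ hfg]
      exact ⟨_, Merge.snoc hg hfg (Merge.id _)
        ((λ_ _).inv ≫ i.inv ▷ symb g ≫ mulF f g), by simp⟩
    | eq g j =>
      have hf := len_eq i.hom
      have hg := len_eq j.hom
      simp only [len_symb, len_id] at hf hg
      obtain ⟨k⟩ := nonempty_symb_iso_id (f ≫ g) (by omega)
      rw [act_symb_of_eq _ _ j, act_symb_of_eq _ _ k]
      refine ⟨_, Merge.id _, ?_⟩
      have e : mulF f g ≫ k.hom = i.hom ▷ symb g ≫ (λ_ _).hom ≫ j.hom := Subsingleton.elim _ _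
      have e' := congrArg (P.cell ◁ ·) e
      simp only [Bicategory.whiskerLeft_comp] at e'
      simp [reassoc_of% e']

/-- Merging maps contain the normal forms of all generators and are closed under composition. The
list `P` has to be arbitrary, since whiskering on the left by `f` replaces `P` by its product with
`f`. -/
theorem isMerge {f g : b ⟶ c} (η : f ⟶ g) (P : Blocks a b) : IsMerge η P := by
  induction η using hom₂_induction with
  | id f => exact ⟨_, Merge.id _, by simp⟩
  | comp η θ hη hθ =>
    obtain ⟨κ, h, e⟩ := hη P
    obtain ⟨κ', h', e'⟩ := hθ P
    exact ⟨_, h.comp h', by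
      rw [Bicategory.whiskerLeft_comp, Category.assoc, e', reassoc_of% e]⟩
  | whiskerLeft f η hη =>
    obtain ⟨κ, h, e⟩ := hη (act f P).blocks
    unfold IsMerge
    rw [act_comp, act_comp]
    refine ⟨κ, h, ?_⟩
    simp [← e, ← whisker_exchange_assoc]
  | whiskerRight η f hη =>
    obtain ⟨κ, h, e⟩ := hη P
    obtain ⟨κ', h', e'⟩ := h.exists_act f
    unfold IsMerge
    rw [act_comp, act_comp]
    refine ⟨κ', h', ?_⟩
    simp [← e', ← comp_whiskerRight_assoc, ← e]
  | associator f g h => exact (isMerge_associator P f g h).1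
  | associatorInv f g h => exact (isMerge_associator P f g h).2
  | leftUnitor f => exact (isMerge_leftUnitor P f).1
  | leftUnitorInv f => exact (isMerge_leftUnitor P f).2
  | rightUnitor f => exact (isMerge_rightUnitor P f).1
  | rightUnitorInv f => exact (isMerge_rightUnitor P f).2
  | unitF a => exact (isMerge_unitF P).1
  | unitFInv a => exact (isMerge_unitF P).2
  | mapF η => exact isMerge_mapF P η
  | mulF f g => exact isMerge_mulF P f g

end Blocks

/-- There is at most one 2-cell between two formal 1-cells. -/
instance locally_thin {a b : FreeNormalLax V} (f g : a ⟶ b) : Subsingleton (f ⟶ g) :=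
  ⟨fun η θ => by
    obtain ⟨κ, h, e⟩ := Blocks.isMerge η (Blocks.nil (a := a))
    obtain ⟨κ', h', e'⟩ := Blocks.isMerge θ (Blocks.nil (a := a))
    -- Both normal forms are merging maps between the same lists, hence equal; cancelling the
    -- normalization isomorphism leaves the two 2-cells whiskered by a unit.
    rw [← h.unique h', ← e, cancel_mono] at e'
    simpa using e'.symm⟩

end FreeNormalLax
-- Cuts in the target bicategory
namespace FreeNormalLax

variable {V : Type u} [Quiver.{v} V]

namespace Blocks

variable {a b c d : FreeNormalLax V}

/-- Concatenation of lists of blocks. -/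
def append (P : Blocks a b) : ∀ {c : FreeNormalLax V}, Blocks b c → Blocks a c
  | _, nil => P
  | _, snoc R w hw => (append P R).snoc w hw

/-- Normalization only appends blocks at the end of the list, so it does not see the prefix. Hence
the normal form of a composite is a concatenation. -/
theorem act_append (f : c ⟶ d) (P : Blocks a b) (R : Blocks b c) :
    (act f (P.append R)).blocks = P.append (act f R).blocks := by
  induction f using hom_induction with
  | onSymb c d w =>
    induction w using symb_cases with
    | ne w hw =>
      rw [act_symb_of_ne _ _ hw, act_symb_of_ne _ _ hw]
      rfl
    | eq w i => rw [act_symb_of_eq _ _ i, act_symb_of_eq _ _ i]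
  | onId c => rw [act_id, act_id]
  | onComp f g hf hg =>
    rw [act_comp, act_comp]
    dsimp only
    rw [hf, hg]

/-- The normal form of a 1-cell. -/
noncomputable abbrev norm (f : a ⟶ b) : Blocks a b := (act f nil).blocks

theorem norm_comp (f : a ⟶ b) (g : b ⟶ c) : norm (f ≫ g) = (norm f).append (norm g) :=
  act_append g (norm f) nil

/-- A 1-cell is isomorphic to its normal form. -/
noncomputable def normIso (f : a ⟶ b) : f ≅ (norm f).cell := (λ_ f).symm ≪≫ (act f nil).iso

theorem exists_merge {f g : a ⟶ b} (η : f ⟶ g) : ∃ κ, Merge (norm f) (norm g) κ := by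
  obtain ⟨κ, h, -⟩ := isMerge η (nil (a := a))
  exact ⟨κ, h⟩

theorem nonempty_cell_append (P : Blocks a b) (R : Blocks b c) :
    Nonempty ((P.append R).cell ≅ P.cell ≫ R.cell) := by
  induction R with
  | nil => exact ⟨(ρ_ P.cell).symm⟩
  | snoc R w hw ih =>
    obtain ⟨i⟩ := ih
    exact ⟨whiskerRightIso i (symb w) ≪≫ α_ _ _ _⟩

/-- Each target block is made from consecutive source blocks, so a cut between target blocks comes
from a cut between source blocks. -/
theorem Merge.split {P : Blocks a c} {Q : Blocks a b} {R : Blocks b c}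
    {φ : P.cell ⟶ (Q.append R).cell} (h : Merge P (Q.append R) φ) :
    ∃ (P₁ : Blocks a b) (P₂ : Blocks b c), P = P₁.append P₂ ∧
      (∃ φ₁, Merge P₁ Q φ₁) ∧ ∃ φ₂, Merge P₂ R φ₂ := by
  induction P generalizing b with
  | nil =>
    cases R with
    | nil => exact ⟨Blocks.nil, Blocks.nil, rfl, ⟨_, h⟩, ⟨_, Merge.nil⟩⟩
    | snoc R w hw =>
      change Merge _ ((Q.append R).snoc w hw) φ at h
      cases h
  | snoc P w hw ih =>
    cases R with
    | nil => exact ⟨P.snoc w hw, Blocks.nil, rfl, ⟨_, h⟩, ⟨_, Merge.nil⟩⟩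
    | snoc R w' hw' =>
      change Merge _ ((Q.append R).snoc w' hw') φ at h
      cases h with
      | snoc _ _ h μ =>
        obtain ⟨P₁, P₂, rfl, h₁, φ₂, h₂⟩ := ih h
        exact ⟨P₁, P₂.snoc w hw, rfl, h₁, ⟨_, Merge.snoc hw hw' h₂ μ⟩⟩
      | @merge _ _ _ _ _ q _ _ hq _ _ _ h μ =>
        -- The partial block `q` belongs to the same side of the cut as the block it is being merged
        -- into.
        obtain ⟨P₁, P₂, rfl, h₁, φ₂, h₂⟩ := ih (R := R.snoc q hq) h
        exact ⟨P₁, P₂.snoc w hw, rfl, h₁, ⟨_, Merge.merge hw hw' h₂ μ⟩⟩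

theorem len_append (P : Blocks a b) (R : Blocks b c) :
    len (P.append R).cell = len P.cell + len R.cell := by
  obtain ⟨i⟩ := nonempty_cell_append P R
  rw [len_eq i.hom, len_comp]

theorem len_snoc (P : Blocks a b) (w : Wd b c) (hw : FreeBicategory.len w ≠ 0) :
    len (P.snoc w hw).cell = len P.cell + FreeBicategory.len w := len_comp _ _

theorem append_eq_append {b' : FreeNormalLax V} {P : Blocks a b} {R : Blocks b c}
    {P' : Blocks a b'} {R' : Blocks b' c} (h : P.append R = P'.append R') :
    (∃ M, P = P'.append M ∧ R' = M.append R) ∨ ∃ M, P' = P.append M ∧ R = M.append R' := by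
  induction R with
  | nil => exact Or.inl ⟨R', h, rfl⟩
  | snoc R w hw ih =>
    cases R' with
    | nil => exact Or.inr ⟨R.snoc w hw, h.symm, rfl⟩
    | snoc R' w' hw' =>
      change (P.append R).snoc w hw = (P'.append R').snoc w' hw' at h
      injection h with h₁ _ h₂ h₃
      subst h₁
      cases h₃
      rcases ih (eq_of_heq h₂) with ⟨M, rfl, rfl⟩ | ⟨M, rfl, rfl⟩
      · exact Or.inl ⟨M, rfl, rfl⟩
      · exact Or.inr ⟨M, rfl, rfl⟩

/-- Blocks have positive length, so a list of length zero is empty and the two second parts run out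
together. -/
theorem append_inj {b' : FreeNormalLax V} {P : Blocks a b} {R : Blocks b c} {P' : Blocks a b'}
    {R' : Blocks b' c} (h : P.append R = P'.append R') (hl : len P.cell = len P'.cell) :
    ∃ hb : b = b', hb ▸ P = P' ∧ R = hb ▸ R' := by
  have hlen := congrArg (fun x => len (cell x)) h
  simp only [len_append] at hlen
  induction R with
  | nil =>
    cases R' with
    | nil => exact ⟨rfl, h, rfl⟩
    | snoc R' w hw =>
      rw [len_snoc, len_id] at hlen
      omega
  | snoc R w hw ih =>
    cases R' with
    | nil =>
      rw [len_snoc, len_id] at hlen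
      omega
    | snoc R' w' hw' =>
      change (P.append R).snoc w hw = (P'.append R').snoc w' hw' at h
      injection h with h₁ _ h₂ h₃
      subst h₁
      cases h₃
      have h₂ := eq_of_heq h₂
      obtain ⟨rfl, rfl, rfl⟩ := ih h₂ (by rw [← len_append, ← len_append, h₂])
      exact ⟨rfl, rfl, rfl⟩

end Blocks

open Blocks in
-- In normal form a 2-cell is a merging map, and `Merge.split` pulls the cut of its target back to
-- the normal form of its source. Comparing this cut with the given one gives `factor`; if the
-- lengths agree, the two cuts coincide, which gives `cut`.
theorem hasCuts : HasCuts (FreeNormalLax V) (@len V _) where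
  thin f g := inferInstance
  len_id := len_id
  len_comp := len_comp
  len_eq := len_eq
  factor {a b b' c p q k l} η := by
    have h := exists_merge η
    rw [norm_comp k] at h
    obtain ⟨κ, h⟩ := h
    obtain ⟨P₁, P₂, e, ⟨φ₁, -⟩, ⟨φ₂, -⟩⟩ := h.split
    rw [norm_comp] at e
    rcases append_eq_append e with ⟨M, h₁, rfl⟩ | ⟨M, rfl, h₂⟩
    · obtain ⟨i⟩ := nonempty_cell_append P₁ M
      obtain ⟨j⟩ := nonempty_cell_append M (norm q)
      exact Or.inl ⟨P₁.cell, M.cell, ⟨normIso p ≪≫ eqToIso (by rw [h₁]) ≪≫ i⟩,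
        ⟨φ₁ ≫ (normIso k).inv⟩, ⟨M.cell ◁ (normIso q).hom ≫ j.inv ≫ φ₂ ≫ (normIso l).inv⟩⟩
    · obtain ⟨i⟩ := nonempty_cell_append (norm p) M
      obtain ⟨j⟩ := nonempty_cell_append M P₂
      exact Or.inr ⟨M.cell, P₂.cell, ⟨normIso q ≪≫ eqToIso (by rw [h₂]) ≪≫ j⟩,
        ⟨(normIso p).hom ▷ M.cell ≫ i.inv ≫ φ₁ ≫ (normIso k).inv⟩, ⟨φ₂ ≫ (normIso l).inv⟩⟩
  cut {a b b' c p q p' q'} η hl := by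
    have h := exists_merge η
    rw [norm_comp p'] at h
    obtain ⟨κ, h⟩ := h
    obtain ⟨P₁, P₂, e, ⟨φ₁, -⟩, ⟨φ₂, -⟩⟩ := h.split
    rw [norm_comp] at e
    obtain ⟨rfl, rfl, rfl⟩ := append_inj e (by
      rw [len_eq φ₁, ← len_eq (normIso p).hom, ← len_eq (normIso p').hom, hl])
    exact ⟨(normIso p).hom ≫ φ₁ ≫ (normIso p').inv, (normIso q).hom ≫ φ₂ ≫ (normIso q').inv⟩

end FreeNormalLax
-- Rotations in a shadow
namespace Shadow

variable {B : Type u} [Bicategory.{w, v} B] {T : Type t} [Category.{t₁} T] (S : Shadow B T)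

theorem rot_id_left {a : B} (f : a ⟶ a) :
    (S.rot (𝟙 a) f).hom = (S.sh a).map ((λ_ f).hom ≫ (ρ_ f).inv) := by
  rw [← cancel_mono ((S.sh a).map (ρ_ f).hom), S.rot_rightUnitor, ← Functor.map_comp]
  simp

theorem rot_id_right {a : B} (f : a ⟶ a) :
    (S.rot f (𝟙 a)).hom = (S.sh a).map ((ρ_ f).hom ≫ (λ_ f).inv) := by
  rw [← cancel_mono ((S.sh a).map (λ_ f).hom), S.rot_leftUnitor, ← Functor.map_comp]
  simp

theorem rot_map_left {a b : B} {f f' : a ⟶ b} (i : f ≅ f') (g : b ⟶ a) :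
    (S.rot f' g).hom = (S.sh a).map (i.inv ▷ g) ≫ (S.rot f g).hom ≫ (S.sh b).map (g ◁ i.hom) := by
  rw [← S.rot_naturality_left, ← Functor.map_comp_assoc]
  simp

theorem rot_map_right {a b : B} (f : a ⟶ b) {g g' : b ⟶ a} (i : g ≅ g') :
    (S.rot f g').hom = (S.sh a).map (f ◁ i.inv) ≫ (S.rot f g).hom ≫ (S.sh b).map (i.hom ▷ f) := by
  rw [← S.rot_naturality_right, ← Functor.map_comp_assoc]
  simp

/-- A full rotation is the identity. -/
theorem rot_rot {a b : B} (f : a ⟶ b) (g : b ⟶ a) :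
    (S.rot f g).hom ≫ (S.rot g f).hom = 𝟙 _ := by
  -- In the hexagon whose first 1-cell is a unit, one side is the full rotation up to unitors, and
  -- the other contains only a rotator with a unit, which the unit axioms turn into a 2-cell.
  have h := S.rot_associator (𝟙 a) f g
  rw [rot_id_left, S.rot_map_left (λ_ f).symm, S.rot_map_left (ρ_ g).symm] at h
  have e₁ : g ◁ (λ_ f).inv ≫ (α_ g (𝟙 a) f).inv ≫ (ρ_ g).hom ▷ f = 𝟙 (g ≫ f) := by simp
  have e₂ : (α_ (𝟙 a) f g).hom ≫ ((λ_ (f ≫ g)).hom ≫ (ρ_ (f ≫ g)).inv) ≫ (α_ f g (𝟙 a)).hom =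
    (λ_ f).hom ▷ g ≫ f ◁ (ρ_ g).inv := by simp
  rw [← Functor.map_comp, ← Functor.map_comp, e₂] at h
  simp only [Iso.symm_hom, Iso.symm_inv, Category.assoc] at h
  rw [← Functor.map_comp_assoc, ← Functor.map_comp_assoc, Category.assoc, e₁,
    CategoryTheory.Functor.map_id, Category.id_comp, Functor.map_comp, cancel_epi,
    ← Category.assoc] at h
  rw [← cancel_mono ((S.sh a).map (f ◁ (ρ_ g).inv))]
  simpa using h

theorem rot_comp_map {a b : B} {f f' : a ⟶ b} {g g' : b ⟶ a} (η : f ⟶ f') (θ : g ⟶ g') :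
    (S.sh a).map (η ▷ g ≫ f' ◁ θ) ≫ (S.rot f' g').hom =
      (S.rot f g).hom ≫ (S.sh b).map (g ◁ η ≫ θ ▷ f') := by
  rw [Functor.map_comp, Category.assoc, S.rot_naturality_right, ← Category.assoc,
    S.rot_naturality_left, Category.assoc, ← Functor.map_comp]

/-- The hexagon solved for its other rotator: composing it with a further rotator cancels one factor
because a full rotation is trivial. -/
theorem rot_comp_right {a b c : B} (f : a ⟶ b) (g : b ⟶ c) (h : c ⟶ a) :
    (S.rot f (g ≫ h)).hom ≫ (S.sh b).map (α_ g h f).hom ≫ (S.rot g (h ≫ f)).hom =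
      (S.sh a).map (α_ f g h).inv ≫ (S.rot (f ≫ g) h).hom ≫ (S.sh c).map (α_ h f g).inv := by
  have e := congrArg (· ≫ (S.rot g (h ≫ f)).hom) (S.rot_associator f g h)
  simp only [Category.assoc, rot_rot, Category.comp_id] at e
  rw [e, ← Functor.map_comp_assoc]
  simp

/-- A morphism between shadows which rotates a factored 1-cell and then applies a 2-cell. -/
def IsRotation {x y : B} {f : x ⟶ x} {g : y ⟶ y} (p : (S.sh x).obj f ⟶ (S.sh y).obj g) : Prop :=
  ∃ (a : x ⟶ y) (b : y ⟶ x) (e : f ≅ a ≫ b) (θ : b ≫ a ⟶ g),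
    p = (S.sh x).map e.hom ≫ (S.rot a b).hom ≫ (S.sh y).map θ

/-- This is the rotation across a unit placed in front of `f`. -/
theorem isRotation_map {x : B} {f g : x ⟶ x} (η : f ⟶ g) : S.IsRotation ((S.sh x).map η) :=
  ⟨𝟙 x, f, (λ_ f).symm, (ρ_ f).hom ≫ η, by
    rw [rot_id_left, ← Functor.map_comp, ← Functor.map_comp]
    simp⟩

theorem isRotation_rot {x y : B} (f : x ⟶ y) (g : y ⟶ x) : S.IsRotation (S.rot f g).hom :=
  ⟨f, g, Iso.refl _, 𝟙 _, by simp⟩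

theorem isRotation_rot_inv {x y : B} (f : x ⟶ y) (g : y ⟶ x) : S.IsRotation (S.rot f g).inv := by
  have e : (S.rot f g).inv = (S.rot g f).hom := Iso.inv_ext (S.rot_rot f g)
  rw [e]
  exact S.isRotation_rot g f

/-- The second rotation cuts a 1-cell that receives a 2-cell from `b ≫ a`, and `factor` lifts this
cut into `b` or into `a`. In `b`, the amounts of rotation add up; in `a`, a whole turn is completed
and only the excess `m` remains. The hexagon combines the rotators in each case. -/
theorem IsRotation.comp {len : ∀ {a b : B}, (a ⟶ b) → ℕ} (hB : HasCuts B len) {x y z : B}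
    {f : x ⟶ x} {g : y ⟶ y} {h : z ⟶ z} {p : (S.sh x).obj f ⟶ (S.sh y).obj g}
    {q : (S.sh y).obj g ⟶ (S.sh z).obj h} (hp : S.IsRotation p) (hq : S.IsRotation q) :
    S.IsRotation (p ≫ q) := by
  obtain ⟨a, b, e, θ, rfl⟩ := hp
  obtain ⟨a', b', e', θ', rfl⟩ := hq
  have thin : ∀ {r s : y ⟶ y} (η η' : r ⟶ s), η = η' := fun η η' => (hB.thin _ _).elim η η'
  rcases hB.factor (θ ≫ e'.hom) with ⟨k, m, ⟨i⟩, ⟨φ⟩, ⟨ψ⟩⟩ | ⟨m, l, ⟨i⟩, ⟨φ⟩, ⟨ψ⟩⟩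
  · refine ⟨a ≫ k, m, e ≪≫ whiskerLeftIso a i ≪≫ (α_ a k m).symm,
      (α_ m a k).inv ≫ ((m ≫ a) ◁ φ ≫ ψ ▷ a') ≫ θ', ?_⟩
    have e₁ : θ ≫ e'.hom = i.hom ▷ a ≫ (α_ k m a).hom ≫ φ ▷ (m ≫ a) ≫ a' ◁ ψ := thin _ _
    have e₂ := S.rot_naturality_right a i.hom
    have e₃ := S.rot_comp_map φ ψ
    simp only [Category.assoc, ← Functor.map_comp_assoc (S.sh y), e₁]
    simp only [Functor.map_comp, Category.assoc] at e₃ ⊢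
    rw [← reassoc_of% e₂, reassoc_of% e₃, reassoc_of% (S.rot_comp_right a k m)]
    simp
  · refine ⟨m, l ≫ b, e ≪≫ whiskerRightIso i b ≪≫ α_ m l b,
      (α_ l b m).hom ≫ (l ◁ φ ≫ ψ ▷ a') ≫ θ', ?_⟩
    have e₁ : θ ≫ e'.hom = b ◁ i.hom ≫ (α_ b m l).inv ≫ φ ▷ l ≫ a' ◁ ψ := thin _ _
    have e₂ := S.rot_naturality_left i.hom b
    have e₃ := S.rot_comp_map φ ψ
    simp only [Category.assoc, ← Functor.map_comp_assoc (S.sh y), e₁]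
    simp only [Functor.map_comp, Category.assoc] at e₃ ⊢
    rw [← reassoc_of% e₂, reassoc_of% e₃, reassoc_of% (S.rot_associator m l b)]
    simp

/-- First factors of equal length are compared by 2-cells between corresponding factors, across
which the rotator is natural; thinness matches the rest. -/
theorem eq_of_hom {x y : B} {f : x ⟶ x} {g : y ⟶ y} {len : ∀ {a b : B}, (a ⟶ b) → ℕ}
    (hB : HasCuts B len) {a a' : x ⟶ y} {b b' : y ⟶ x} (e : f ≅ a ≫ b) (e' : f ≅ a' ≫ b')
    (θ : b ≫ a ⟶ g) (θ' : b' ≫ a' ⟶ g) (h : len a = len a') :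
    (S.sh x).map e.hom ≫ (S.rot a b).hom ≫ (S.sh y).map θ =
      (S.sh x).map e'.hom ≫ (S.rot a' b').hom ≫ (S.sh y).map θ' := by
  cases hB.cut (e.inv ≫ e'.hom) h with
  | mk α β =>
    have e₁ : e'.hom = e.hom ≫ α ▷ b ≫ a' ◁ β := (hB.thin _ _).elim _ _
    have e₂ : θ = (b ◁ α ≫ β ▷ a') ≫ θ' := (hB.thin _ _).elim _ _
    have e₃ := S.rot_comp_map α β
    rw [e₁, e₂, Functor.map_comp _ e.hom, Functor.map_comp _ _ θ', Category.assoc, reassoc_of% e₃]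

/-- Morphisms between shadows induced by 2-cells. -/
def IsMap {x y : B} {f : x ⟶ x} {g : y ⟶ y} (p : (S.sh x).obj f ⟶ (S.sh y).obj g) : Prop :=
  ∃ (h : x = y) (η : (h ▸ f : y ⟶ y) ⟶ g), p ≍ (S.sh y).map η

/-- A factor without edges is isomorphic to a unit, and the rotator with a unit is a composite of
unitors. -/
theorem isMap_of_len_left {len : ∀ {a b : B}, (a ⟶ b) → ℕ} (hB : HasCuts B len) {x y : B}
    {f : x ⟶ x} {g : y ⟶ y} {a : x ⟶ y} {b : y ⟶ x} (e : f ≅ a ≫ b) (θ : b ≫ a ⟶ g)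
    (h : len a = 0) : S.IsMap ((S.sh x).map e.hom ≫ (S.rot a b).hom ≫ (S.sh y).map θ) := by
  cases hB.isUnitCell a h with
  | mk i =>
    rw [S.rot_map_left i.symm, rot_id_left]
    simp only [← Functor.map_comp]
    exact ⟨rfl, _, HEq.rfl⟩

theorem isMap_of_len_right {len : ∀ {a b : B}, (a ⟶ b) → ℕ} (hB : HasCuts B len) {x y : B}
    {f : x ⟶ x} {g : y ⟶ y} {a : x ⟶ y} {b : y ⟶ x} (e : f ≅ a ≫ b) (θ : b ≫ a ⟶ g)
    (h : len b = 0) : S.IsMap ((S.sh x).map e.hom ≫ (S.rot a b).hom ≫ (S.sh y).map θ) := by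
  cases hB.isUnitCell b h with
  | mk i =>
    rw [S.rot_map_right _ i.symm, rot_id_right]
    simp only [← Functor.map_comp]
    exact ⟨rfl, _, HEq.rfl⟩

theorem IsMap.eq {len : ∀ {a b : B}, (a ⟶ b) → ℕ} (hB : HasCuts B len) {x y : B}
    {f : x ⟶ x} {g : y ⟶ y} {p q : (S.sh x).obj f ⟶ (S.sh y).obj g} (hp : S.IsMap p)
    (hq : S.IsMap q) : p = q := by
  obtain ⟨rfl, η, hη⟩ := hp
  obtain ⟨_, η', hη'⟩ := hq
  have e : η = η' := (hB.thin _ _).elim _ _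
  subst e
  exact eq_of_heq (hη.trans hη'.symm)

end Shadow
-- Coherence for free shadows
/-- The underlying map of a bijection. -/
def Bij.app {X Y : Bij} (e : X ⟶ Y) : X.carrier → Y.carrier := (show X.carrier ≃ Y.carrier from e)

/-- A shadow with values in finite lists, in which rotators are rotations. -/
structure Shadow.Numbering {B : Type u} [Bicategory.{w, v} B] (S : Shadow B Bij)
    (len : ∀ {a b : B}, (a ⟶ b) → ℕ) where
  pos {a : B} (f : a ⟶ a) : ((S.sh a).obj f).carrier → ℕ
  pos_map {a : B} {f g : a ⟶ a} (η : f ⟶ g) (x : ((S.sh a).obj f).carrier) :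
    pos g (Bij.app ((S.sh a).map η) x) = pos f x
  pos_rot {a b : B} (f : a ⟶ b) (g : b ⟶ a) (x : ((S.sh a).obj (f ≫ g)).carrier) :
    pos (g ≫ f) (Bij.app (S.rot f g).hom x) =
      if pos (f ≫ g) x < len f then pos (f ≫ g) x + len g else pos (f ≫ g) x - len f
  exists_pos_eq_zero {a : B} (f : a ⟶ a) (h : 0 < len f) : ∃ x, pos f x = 0

namespace FreeShadow

variable {B : Type u} [Bicategory.{w, v} B] {len : ∀ {a b : B}, (a ⟶ b) → ℕ}

/-- All generators are rotations: a 2-cell across a unit, and an inverse rotator because it is the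
opposite rotator. -/
theorem isRotation (hB : HasCuts B len) {X Y : FreeShadow B} (p : X ⟶ Y) :
    (shadow B).IsRotation (f := X.cell) (g := Y.cell) p := by
  refine Quot.ind (fun r => ?_) p
  clear p
  induction r with
  | id X => 
    have := (shadow B).isRotation_map (𝟙 X.cell)
    rw [CategoryTheory.Functor.map_id] at this
    exact this
  | comp p q hp hq => exact Shadow.IsRotation.comp _ hB hp hq
  | sh η => exact (shadow B).isRotation_map η
  | rot f g => exact (shadow B).isRotation_rot f g
  | rotInv f g => exact (shadow B).isRotation_rot_inv f g

/-- Coherence for shadows: a morphism of the free shadow category is determined by the rotation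
that it induces. -/
theorem eq_of_lift_map_eq (hB : HasCuts B len) (S : Shadow B Bij) (N : S.Numbering len)
    {X Y : FreeShadow B} (p q : X ⟶ Y) (h : (lift S).map p = (lift S).map q) : p = q := by
  obtain ⟨a, b, e, θ, hp⟩ := isRotation hB p
  obtain ⟨a', b', e', θ', hq⟩ := isRotation hB q
  -- The first edge is moved to position `len b`, unless `a` has no edges, in which case it stays at
  -- position zero.
  have key : ∀ {a : X.base ⟶ Y.base} {b : Y.base ⟶ X.base} (e : X.cell ≅ a ≫ b)
      (θ : b ≫ a ⟶ Y.cell) (p : X ⟶ Y) (_ : p = ((shadow B).sh X.base).map e.hom ≫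
        ((shadow B).rot a b).hom ≫ ((shadow B).sh Y.base).map θ)
      (x : ((S.sh X.base).obj X.cell).carrier) (_ : N.pos _ x = 0),
      N.pos Y.cell (Bij.app ((lift S).map p) x) = if 0 < len a then len b else 0 := by
    rintro a b e θ p rfl x hx
    change N.pos Y.cell (Bij.app ((S.sh Y.base).map θ) (Bij.app (S.rot a b).hom
      (Bij.app ((S.sh X.base).map e.hom) x))) = _
    rw [N.pos_map, N.pos_rot, N.pos_map, hx]
    simp
  have hl := hB.len_eq e.hom
  have hl' := hB.len_eq e'.hom
  rw [hB.len_comp] at hl hl'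
  by_cases hn : 0 < len X.cell
  · obtain ⟨x, hx⟩ := N.exists_pos_eq_zero _ hn
    have k := key e θ p hp x hx
    have k' := key e' θ' q hq x hx
    rw [h, k'] at k
    -- If exactly one of `a`, `a'` is empty, then equal positions force the second factor of the
    -- other rotation to be empty as well: a full rotation is compared with none, and both are
    -- induced by 2-cells.
    by_cases ha : 0 < len a <;> by_cases ha' : 0 < len a' <;> simp only [ha, ha', if_true, if_false] at k
    · rw [hp, hq]
      exact (shadow B).eq_of_hom hB e e' θ θ' (by omega)
    · rw [hp, hq]
      exact Shadow.IsMap.eq _ hB ((shadow B).isMap_of_len_right hB e θ (by omega))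
        ((shadow B).isMap_of_len_left hB e' θ' (by omega))
    · rw [hp, hq]
      exact Shadow.IsMap.eq _ hB ((shadow B).isMap_of_len_left hB e θ (by omega))
        ((shadow B).isMap_of_len_right hB e' θ' (by omega))
    · rw [hp, hq]
      exact (shadow B).eq_of_hom hB e e' θ θ' (by omega)
  -- Without edges the permutation carries no information, but then both first factors have length
  -- zero.
  · rw [hp, hq]
    exact (shadow B).eq_of_hom hB e e' θ θ' (by omega)

end FreeShadow

/-! ### Positions of edges, counted from left to right -/

namespace FreeBicategory

variable {V : Type u} [Quiver.{v} V]

/-- The position of an occurrence of an edge in a 1-cell of the free bicategory. -/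
def pos : ∀ {a b : V} (f : CategoryTheory.FreeBicategory.Hom a b), FreeNormalLax.freeOcc f → ℕ
  | _, _, .of _ => fun _ => 0
  | _, _, .id _ => fun x => x.elim
  | _, _, .comp f g => Sum.elim (pos f) (fun y => @len V _ _ _ f + pos g y)

theorem pos_lt {a b : V} (f : CategoryTheory.FreeBicategory.Hom a b)
    (x : FreeNormalLax.freeOcc f) : pos f x < @len V _ _ _ f := by
  induction f with
  | of e => exact Nat.one_pos
  | id a => exact x.elim
  | comp f g hf hg =>
    have h : @len V _ _ _ (f.comp g) = @len V _ _ _ f + @len V _ _ _ g :=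
      hasCuts.len_comp (B := FreeBicategory V) f g
    rw [h]
    rcases x with x | y
    · exact Nat.lt_add_right _ (hf x)
    · exact Nat.add_lt_add_left (hg y) _

theorem exists_pos_eq_zero {a b : V} (f : CategoryTheory.FreeBicategory.Hom a b)
    (h : 0 < @len V _ _ _ f) : ∃ x, pos f x = 0 := by
  induction f with
  | of e => exact ⟨(), rfl⟩
  | id a => exact absurd h (lt_irrefl 0)
  | comp f g hf hg =>
    have e : @len V _ _ _ (f.comp g) = @len V _ _ _ f + @len V _ _ _ g :=
      hasCuts.len_comp (B := FreeBicategory V) f g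
    rcases Nat.eq_zero_or_pos (@len V _ _ _ f) with h₀ | h₀
    · obtain ⟨y, hy⟩ := hg (by omega)
      exact ⟨Sum.inr y, by change _ + _ = _; omega⟩
    · obtain ⟨x, hx⟩ := hf h₀
      exact ⟨Sum.inl x, hx⟩

theorem pos_freeOccMap₂ {a b : FreeBicategory V} {f g : a ⟶ b}
    (η : CategoryTheory.FreeBicategory.Hom₂ f g) (x : FreeNormalLax.freeOcc f) :
    pos g (FreeNormalLax.freeOccMap₂ η x) = pos f x := by
  induction η with
  | id f => rfl
  | vcomp η θ hη hθ => exact (hθ _).trans (hη x)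
  | whisker_left f η hη =>
    rcases x with x | x
    · rfl
    · exact congrArg (len f + ·) (hη x)
  | whisker_right h η hη =>
    rcases x with x | x
    · exact hη x
    · exact congrArg (· + pos h x) (hasCuts.len_eq (B := FreeBicategory V) (Quot.mk _ η)).symm
  | associator f g h =>
    rcases x with (x | x) | x
    · rfl
    · rfl
    · exact (Nat.add_assoc _ _ _).symm.trans
        (congrArg (· + pos h x) (hasCuts.len_comp (B := FreeBicategory V) f g).symm)
  | associator_inv f g h =>
    rcases x with x | x | x
    · rfl
    · rfl
    · exact (congrArg (· + pos h x) (hasCuts.len_comp (B := FreeBicategory V) f g)).trans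
        (Nat.add_assoc _ _ _)
  | right_unitor f =>
    rcases x with x | x
    · rfl
    · exact x.elim
  | right_unitor_inv f => rfl
  | left_unitor f =>
    rcases x with x | x
    · exact x.elim
    · exact (Nat.zero_add _).symm
  | left_unitor_inv f => exact Nat.zero_add _

end FreeBicategory

/-- Positions count occurrences of edges from left to right. -/
def freeOccNumbering (V : Type u) [Quiver.{v} V] :
    (freeOccShadow V).Numbering (@FreeBicategory.len V _) where
  pos f := FreeBicategory.pos f
  pos_map {a f g} η x := by
    obtain ⟨η⟩ := η
    exact FreeBicategory.pos_freeOccMap₂ η x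
  pos_rot f g x := by
    rcases x with x | x
    · have h := FreeBicategory.pos_lt f x
      exact (Nat.add_comm _ _).trans (if_pos h).symm
    · exact (Nat.add_sub_cancel_left _ _).symm.trans (if_neg (Nat.not_lt.2 (Nat.le_add_right _ _))).symm
  exists_pos_eq_zero f h := FreeBicategory.exists_pos_eq_zero f h

namespace FreeNormalLax

variable {V : Type u} [Quiver.{v} V]

/-- The position of an occurrence of an edge in a formal 1-cell. -/
noncomputable def pos : ∀ {a b : V} (f : Hom a b), occ f → ℕ
  | _, _, .app w => FreeBicategory.pos w
  | _, _, .id _ => fun x => x.elim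
  | _, _, .comp f g => Sum.elim (pos f) (fun y => @len V _ _ _ f + pos g y)

theorem pos_lt {a b : V} (f : Hom a b) (x : occ f) : pos f x < @len V _ _ _ f := by
  induction f with
  | app w => exact FreeBicategory.pos_lt w x
  | id a => exact x.elim
  | comp f g hf hg =>
    have h : @len V _ _ _ (f.comp g) = @len V _ _ _ f + @len V _ _ _ g := len_comp (V := V) f g
    rw [h]
    rcases x with x | y
    · exact Nat.lt_add_right _ (hf x)
    · exact Nat.add_lt_add_left (hg y) _

theorem exists_pos_eq_zero {a b : V} (f : Hom a b) (h : 0 < @len V _ _ _ f) :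
    ∃ x, pos f x = 0 := by
  induction f with
  | app w => exact FreeBicategory.exists_pos_eq_zero w h
  | id a => exact absurd h (lt_irrefl 0)
  | comp f g hf hg =>
    have e : @len V _ _ _ (f.comp g) = @len V _ _ _ f + @len V _ _ _ g := len_comp (V := V) f g
    rcases Nat.eq_zero_or_pos (@len V _ _ _ f) with h₀ | h₀
    · obtain ⟨y, hy⟩ := hg (by omega)
      exact ⟨Sum.inr y, by change _ + _ = _; omega⟩
    · obtain ⟨x, hx⟩ := hf h₀
      exact ⟨Sum.inl x, hx⟩

theorem pos_occMap₂ {a b : FreeNormalLax V} {f g : a ⟶ b} (η : Hom₂ f g) (x : occ f) :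
    pos g (occMap₂ η x) = pos f x := by
  induction η with
  | id f => rfl
  | vcomp η θ hη hθ => exact (hθ _).trans (hη x)
  | whiskerLeft f η hη =>
    rcases x with x | x
    · rfl
    · exact congrArg (len f + ·) (hη x)
  | whiskerRight h η hη =>
    rcases x with x | x
    · exact hη x
    · exact congrArg (· + pos h x) (len_eq (V := V) (Quot.mk _ η)).symm
  | associator f g h =>
    rcases x with (x | x) | x
    · rfl
    · rfl
    · exact (Nat.add_assoc _ _ _).symm.trans (congrArg (· + pos h x) (len_comp f g).symm)
  | associatorInv f g h =>
    rcases x with x | x | x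
    · rfl
    · rfl
    · exact (congrArg (· + pos h x) (len_comp f g)).trans (Nat.add_assoc _ _ _)
  | rightUnitor f =>
    rcases x with x | x
    · rfl
    · exact x.elim
  | rightUnitorInv f => rfl
  | leftUnitor f =>
    rcases x with x | x
    · exact x.elim
    · exact (Nat.zero_add _).symm
  | leftUnitorInv f => exact Nat.zero_add _
  | map₂ η =>
    obtain ⟨η⟩ := η
    exact FreeBicategory.pos_freeOccMap₂ η x
  | mapId a => exact x.elim
  | mapIdInv a => exact x.elim
  | mapComp f g =>
    rcases x with x | x
    · rfl
    · rfl

end FreeNormalLax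

/-- Positions count occurrences of edges from left to right. -/
noncomputable def occNumbering (V : Type u) [Quiver.{v} V] :
    (occShadow V).Numbering (@FreeNormalLax.len V _) where
  pos f := FreeNormalLax.pos f
  pos_map {a f g} η x := by
    obtain ⟨η⟩ := η
    exact FreeNormalLax.pos_occMap₂ η x
  pos_rot f g x := by
    rcases x with x | x
    · have h := FreeNormalLax.pos_lt f x
      exact (Nat.add_comm _ _).trans (if_pos h).symm
    · exact (Nat.add_sub_cancel_left _ _).symm.trans (if_neg (Nat.not_lt.2 (Nat.le_add_right _ _))).symm
  exists_pos_eq_zero f h := FreeNormalLax.exists_pos_eq_zero f h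

/-! ### Normal forms in the target shadow category -/

namespace FreeNormalLaxShadow

open FreeNormalLax

variable {V : Type u} [Quiver.{v} V]

/-- The inclusion of the shadow category of the target bicategory. -/
def innerF (V : Type u) [Quiver.{v} V] :
    FreeShadow (FreeNormalLax V) ⥤ FreeNormalLaxShadow V where
  obj X := .inner X
  map p := Quot.mk _ (Pre.inner p)
  map_id X := Quot.sound (Rel.inner_id X)
  map_comp p q := Quot.sound (Rel.inner_comp p q)

/-- The functor `H` of the universal normal lax shadow functor. -/
def outerF (V : Type u) [Quiver.{v} V] :
    FreeShadow (FreeBicategory V) ⥤ FreeNormalLaxShadow V where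
  obj X := .outer X
  map p := Quot.mk _ (Pre.outer p)
  map_id X := Quot.sound (Rel.outer_id X)
  map_comp p q := Quot.sound (Rel.outer_comp p q)

/-- `⟨⟨f⟩⟩` as an object of the target shadow category. -/
abbrev inSh (a : FreeNormalLax V) : (a ⟶ a) ⥤ FreeNormalLaxShadow V :=
  (innerShadow V).sh a ⋙ innerF V

/-- `H⟨⟨w⟩⟩` as an object of the target shadow category. -/
abbrev outSh (a : FreeNormalLax V) : Wd a a ⥤ FreeNormalLaxShadow V :=
  (outerShadow V).sh (toFr a) ⋙ outerF V

abbrev inRot {a b : FreeNormalLax V} (f : a ⟶ b) (g : b ⟶ a) :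
    (inSh a).obj (f ≫ g) ⟶ (inSh b).obj (g ≫ f) :=
  (innerF V).map ((innerShadow V).rot f g).hom

abbrev outRot {a b : FreeNormalLax V} (f : Wd a b) (g : Wd b a) :
    (outSh a).obj (f ≫ g) ⟶ (outSh b).obj (g ≫ f) :=
  (outerF V).map ((outerShadow V).rot f g).hom

/-- The shadow commutator. -/
def comm {a : FreeNormalLax V} (w : Wd a a) : (inSh a).obj (symb w) ⟶ (outSh a).obj w :=
  Quot.mk _ (Pre.s w)

theorem comm_naturality {a : FreeNormalLax V} {f g : Wd a a} (η : f ⟶ g) :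
    (inSh a).map (mapF η) ≫ comm g = comm f ≫ (outSh a).map η :=
  Quot.sound (Rel.s_naturality η)

theorem comm_rot {a b : FreeNormalLax V} (f : Wd a b) (g : Wd b a) :
    (inSh a).map (mulF f g) ≫ comm (f ≫ g) ≫ outRot f g =
      inRot (symb f) (symb g) ≫ (inSh b).map (mulF g f) ≫ comm (g ≫ f) :=
  Quot.sound (Rel.s_rot f g)

/-- The morphism `⟨⟨f⟩⟩ ⟶ H⟨⟨w⟩⟩` given by a map from `f` to `F(w)`. -/
def _root_.ShadowCoherence.FreeNormalLax.Collapse.toOuter {a : FreeNormalLax V} {f : a ⟶ a}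
    (F : Collapse f) : (inSh a).obj f ⟶ (outSh a).obj F.cell :=
  (inSh a).map F.map ≫ comm F.cell

/-- The canonical morphism `⟨⟨f⟩⟩ ⟶ H⟨⟨w⟩⟩`, where `w` is the collapse of `f`. -/
noncomputable def can {a : FreeNormalLax V} (f : a ⟶ a) :
    (inSh a).obj f ⟶ (outSh a).obj (coll f).cell :=
  (coll f).toOuter

/-- The rotator of the collapse of a composite. -/
noncomputable def canRot {a b : FreeNormalLax V} (f : a ⟶ b) (g : b ⟶ a) :
    ((outerShadow V).sh (toFr a)).obj (coll (f ≫ g)).cell ⟶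
      ((outerShadow V).sh (toFr b)).obj (coll (g ≫ f)).cell :=
  ((outerShadow V).rot (coll f).cell (coll g).cell).hom

theorem map_can {a : FreeNormalLax V} {f g : a ⟶ a} (η : f ⟶ g) :
    ∃ φ, (inSh a).map η ≫ can g = can f ≫ (outSh a).map φ := by
  obtain ⟨φ, hφ⟩ := exists_coll_map η
  refine ⟨φ.hom, ?_⟩
  rw [can, can, Collapse.toOuter, Collapse.toOuter, Category.assoc, ← comm_naturality,
    ← Functor.map_comp_assoc, hφ, Functor.map_comp_assoc]

theorem inRot_naturality {a b : FreeNormalLax V} {f f' : a ⟶ b} {g g' : b ⟶ a} (η : f ⟶ f')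
    (θ : g ⟶ g') :
    (inSh a).map (η ▷ g ≫ f' ◁ θ) ≫ inRot f' g' = inRot f g ≫ (inSh b).map (θ ▷ f ≫ g' ◁ η) := by
  have h := congrArg (innerF V).map ((innerShadow V).rot_comp_map η θ)
  rw [whisker_exchange] at h
  exact ((innerF V).map_comp _ _).symm.trans (h.trans ((innerF V).map_comp _ _))

/-- The rotator slides past the maps of the two factors by naturality, and then past the composition
map and the commutator by their compatibility with rotators. -/
theorem inRot_toOuter {a b : FreeNormalLax V} {f : a ⟶ b} {g : b ⟶ a} (F : Collapse f)
    (G : Collapse g) :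
    inRot f g ≫ (inSh b).map ((G.map ▷ f ≫ symb G.cell ◁ F.map) ≫ mulF G.cell F.cell) ≫
        comm (G.cell ≫ F.cell) =
      ((inSh a).map ((F.map ▷ g ≫ symb F.cell ◁ G.map) ≫ mulF F.cell G.cell) ≫
        comm (F.cell ≫ G.cell)) ≫ outRot F.cell G.cell := by
  rw [Functor.map_comp _ _ (mulF _ _), Functor.map_comp _ _ (mulF _ _), Category.assoc,
    Category.assoc, Category.assoc, comm_rot, ← Category.assoc (inRot f g), ← inRot_naturality,
    Category.assoc]

theorem inRot_can {a b : FreeNormalLax V} (f : a ⟶ b) (g : b ⟶ a) :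
    inRot f g ≫ can (g ≫ f) = can (f ≫ g) ≫ (outerF V).map (canRot f g) :=
  inRot_toOuter (coll f) (coll g)

theorem map_can_of_isRotation {x y : FreeNormalLax V} {f : x ⟶ x} {g : y ⟶ y}
    {p : ((innerShadow V).sh x).obj f ⟶ ((innerShadow V).sh y).obj g}
    (hp : (innerShadow V).IsRotation p) :
    ∃ q : ((outerShadow V).sh (toFr x)).obj (coll f).cell ⟶
      ((outerShadow V).sh (toFr y)).obj (coll g).cell,
      (innerF V).map p ≫ can g = can f ≫ (outerF V).map q := by
  obtain ⟨a, b, e, θ, rfl⟩ := hp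
  obtain ⟨φ, hφ⟩ := map_can e.hom
  obtain ⟨ψ, hψ⟩ := map_can θ
  refine ⟨((outerShadow V).sh _).map φ ≫ canRot a b ≫ ((outerShadow V).sh _).map ψ, ?_⟩
  have h : (inSh x).map e.hom ≫ inRot a b ≫ (inSh y).map θ ≫ can g =
      can f ≫ (outSh x).map φ ≫ (outerF V).map (canRot a b) ≫ (outSh y).map ψ := by
    rw [hψ, ← Category.assoc (inRot a b), inRot_can, Category.assoc, ← Category.assoc, hφ,
      Category.assoc]
  rw [Functor.map_comp, Functor.map_comp, Functor.map_comp, Functor.map_comp, Category.assoc,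
    Category.assoc]
  exact h

/-- The collapse of a cyclic word. -/
noncomputable def collSh (X : FreeShadow (FreeNormalLax V)) : FreeShadow (FreeBicategory V) :=
  ⟨(coll X.cell).cell⟩

/-- The canonical morphism from a cyclic word to its collapse. -/
noncomputable def canSh (X : FreeShadow (FreeNormalLax V)) :
    (innerF V).obj X ⟶ (outerF V).obj (collSh X) :=
  can X.cell

/-- Every morphism of cyclic words is a rotation between 2-cells, and the canonical morphism is
natural for each of these pieces. This moves all commutators to the front of what happens inside
`H`. -/
theorem map_canSh {X Y : FreeShadow (FreeNormalLax V)} (p : X ⟶ Y) :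
    ∃ q : collSh X ⟶ collSh Y, (innerF V).map p ≫ canSh Y = canSh X ≫ (outerF V).map q :=
  map_can_of_isRotation (FreeShadow.isRotation FreeNormalLax.hasCuts p)

theorem canSh_symb {a : FreeNormalLax V} (w : Wd a a) : canSh ⟨symb w⟩ = comm w := by
  change (inSh a).map (𝟙 (symb w)) ≫ comm w = comm w
  rw [CategoryTheory.Functor.map_id, Category.id_comp]

/-- Normal forms of the morphisms of the target shadow category. -/
inductive IsNormal : ∀ {X Y : FreeNormalLaxShadow V}, (X ⟶ Y) → Prop
  | inner {X Y : FreeShadow (FreeNormalLax V)} (p : X ⟶ Y) : IsNormal ((innerF V).map p)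
  | outer {X Y : FreeShadow (FreeBicategory V)} (p : X ⟶ Y) : IsNormal ((outerF V).map p)
  | mixed (X : FreeShadow (FreeNormalLax V)) {Y : FreeShadow (FreeBicategory V)}
      (q : collSh X ⟶ Y) : IsNormal (canSh X ≫ (outerF V).map q)

/-- The only composite that needs an argument is a morphism of cyclic words followed by a mixed one;
naturality of `canSh` carries the former inside `H`. -/
theorem IsNormal.comp {X Y Z : FreeNormalLaxShadow V} {p : X ⟶ Y} {q : Y ⟶ Z} (hp : IsNormal p)
    (hq : IsNormal q) : IsNormal (p ≫ q) := by
  cases hp with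
  | inner p =>
    cases hq with
    | inner q =>
      rw [← Functor.map_comp]
      exact .inner _
    | mixed Y q =>
      obtain ⟨r, hr⟩ := map_canSh p
      rw [← Category.assoc, hr, Category.assoc, ← Functor.map_comp]
      exact .mixed _ _
  | outer p =>
    cases hq with
    | outer q =>
      rw [← Functor.map_comp]
      exact .outer _
  | mixed X p =>
    cases hq with
    | outer q =>
      rw [Category.assoc, ← Functor.map_comp]
      exact .mixed _ _

theorem isNormal_comm {a : FreeNormalLax V} (w : Wd a a) : IsNormal (comm w) := by
  have h := IsNormal.mixed ⟨symb w⟩ (𝟙 _)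
  rw [CategoryTheory.Functor.map_id, Category.comp_id, canSh_symb] at h
  exact h

theorem isNormal {X Y : FreeNormalLaxShadow V} (p : X ⟶ Y) : IsNormal p := by
  refine Quot.ind (fun r => ?_) p
  clear p
  induction r with
  | id X =>
    cases X with
    | inner X =>
      have h := IsNormal.inner (𝟙 X)
      rw [CategoryTheory.Functor.map_id] at h
      exact h
    | outer X =>
      have h := IsNormal.outer (𝟙 X)
      rw [CategoryTheory.Functor.map_id] at h
      exact h
  | comp p q hp hq => exact IsNormal.comp hp hq
  | inner p => exact .inner p
  | outer p => exact .outer p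
  | @s a w =>
    exact isNormal_comm (V := V) (a := a) w

/-- Coherence: a formal morphism is determined by its underlying permutation. -/
theorem eq_of_permutation_map_eq {X Y : FreeNormalLaxShadow V} (p q : X ⟶ Y)
    (h : (permutation V).map p = (permutation V).map q) : p = q := by
  have hp := isNormal p
  have hq := isNormal q
  cases hp with
  | inner p =>
    cases hq with
    | inner q =>
      rw [FreeShadow.eq_of_lift_map_eq FreeNormalLax.hasCuts _ (occNumbering V) p q h]
  | outer p =>
    cases hq with
    | outer q =>
      rw [FreeShadow.eq_of_lift_map_eq FreeBicategory.hasCuts _ (freeOccNumbering V) p q h]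
  | mixed X p =>
    cases hq with
    | mixed _ q =>
      rw [Functor.map_comp, Functor.map_comp] at h
      -- Both sides share the permutation of `canSh X`, a bijection, so evaluating at preimages
      -- under it cancels it.
      have h' : (FreeShadow.lift (freeOccShadow V)).map p = (FreeShadow.lift (freeOccShadow V)).map q := by
        refine Equiv.ext fun x => ?_
        have e := congrArg (fun r => Bij.app r
          ((show _ ≃ _ from (permutation V).map (canSh X)).symm x)) h
        refine Eq.trans (Eq.symm ?_) (Eq.trans e ?_)
        · exact congrArg (Bij.app ((FreeShadow.lift (freeOccShadow V)).map p))
            ((show _ ≃ _ from (permutation V).map (canSh X)).apply_symm_apply x)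
        · exact congrArg (Bij.app ((FreeShadow.lift (freeOccShadow V)).map q))
            ((show _ ≃ _ from (permutation V).map (canSh X)).apply_symm_apply x)
      rw [FreeShadow.eq_of_lift_map_eq FreeBicategory.hasCuts _ (freeOccNumbering V) p q h']

end FreeNormalLaxShadow

/-! ### Commutativity of formal diagrams -/

section Formal

variable {C : Type u₁} [Bicategory.{w₁, v₁} C] {TC : Type t} [Category.{t₁} TC]
  {D : Type u₂} [Bicategory.{w₂, v₂} D] {TD : Type t₂} [Category.{t₃} TD]
  {SC : Shadow C TC} {SD : Shadow D TD} {J : Type u} [Category.{v} J] {K : J ⥤ TD}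

theorem NormalLaxShadowFunctor.IsFormalWithEqualPermutations.commutes
    {Φ : NormalLaxShadowFunctor SC SD} (h : Φ.IsFormalWithEqualPermutations K) : Commutes K := by
  obtain ⟨L, rfl, h⟩ := h
  intro x y f g
  exact congrArg Φ.eval.map (FreeNormalLaxShadow.eq_of_permutation_map_eq _ _ (h f g))

theorem NormalOplaxShadowFunctor.IsFormalWithEqualPermutations.commutes
    {Φ : NormalOplaxShadowFunctor SC SD} (h : Φ.IsFormalWithEqualPermutations K) : Commutes K := by
  obtain ⟨L, rfl, h⟩ := h
  intro x y f g
  exact congrArg Φ.eval.map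
    (Quiver.Hom.unop_inj (FreeNormalLaxShadow.eq_of_permutation_map_eq _ _ (h f g)))

end Formal

/-! ### A criterion for a thin localization -/

/-- If every object `X` receives a natural map, inverted by the localization, from an object `R X`
with at most one map to any other object, and if `R` inverts `W`, then the localization is thin. -/
theorem isThin_localization {T : Type t} [Category.{t₁} T] (W : MorphismProperty T) (R : T ⥤ T)
    (ι : R ⟶ 𝟭 T) (hR : W.IsInvertedBy R) (hι : ∀ X, IsIso (W.Q.map (ι.app X)))
    (h : ∀ X Z, Subsingleton (R.obj X ⟶ Z)) : Quiver.IsThin W.Localization := by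
  let L : W.Localization ⥤ T := Localization.lift R hR W.Q
  let τ : R ⋙ W.Q ≅ W.Q := NatIso.ofComponents (fun X => @asIso _ _ _ _ (W.Q.map (ι.app X)) (hι X))
    (fun f => by
      change W.Q.map (R.map f) ≫ W.Q.map (ι.app _) = W.Q.map (ι.app _) ≫ W.Q.map f
      rw [← W.Q.map_comp, ι.naturality, W.Q.map_comp]
      rfl)
  -- The functor `L` induced by `R` has a left inverse up to isomorphism, so it is faithful; maps
  -- can be compared after applying `L`.
  let ν : L ⋙ W.Q ≅ 𝟭 _ :=
    Localization.liftNatIso W.Q W (R ⋙ W.Q) W.Q (L ⋙ W.Q) (𝟭 W.Localization) τ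
  intro A B
  refine ⟨fun f g => ?_⟩
  have e : L.map f = L.map g := by
    -- Every object of the localization comes from `T` up to isomorphism, so `L.obj A` is isomorphic
    -- to a value of `R`, out of which maps are unique.
    let i : L.obj A ≅ R.obj (W.Q.objPreimage A) :=
      L.mapIso (W.Q.objObjPreimageIso A).symm ≪≫ (Localization.fac R hR W.Q).app _
    rw [← cancel_epi i.inv]
    exact (h _ _).elim _ _
  have hf := ν.hom.naturality f
  have hg := ν.hom.naturality g
  rw [← cancel_epi (ν.hom.app A)]
  exact hf.symm.trans ((congrArg (fun r => W.Q.map r ≫ ν.hom.app B) e).trans hg)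

/-! ### A factorization system on the bi-augmented cyclic category -/

namespace BiaugmentedCyclic

/-- The projection from words to `Λ'`. -/
abbrev proj : Cyclic.Words ⥤ BiaugmentedCyclic := CategoryTheory.Quotient.functor Cyclic.Rel

/-- The terminal object of `Λ'`. -/
abbrev star : BiaugmentedCyclic := proj.obj Cyclic.star

/-- A generator, as a morphism of `Λ'`. -/
abbrev gen {a b : Cyclic.Words} (g : Cyclic.Gen a b) :
    proj.obj a ⟶ proj.obj b :=
  proj.map (Quiver.Hom.toPath g)

/-- The codegeneracy maps of `Λ'`. -/
abbrev s {n : ℕ} (i : Fin (n + 1)) : num (n + 2) ⟶ num (n + 1) :=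
  proj.map (Cyclic.s i)

/-- The cycle maps of `Λ'`. -/
abbrev τ (n : ℕ) : num (n + 1) ⟶ num (n + 1) :=
  proj.map (Cyclic.τ n)

theorem map_eq {a b : Cyclic.Words} {f g : a ⟶ b} (h : Cyclic.Rel f g) :
    proj.map f = proj.map g :=
  CategoryTheory.Quotient.sound _ h

/-- A morphism is an identity or ends with a generator. -/
theorem hom_cases {a : Cyclic.Words} {motive : ∀ b : Cyclic.Words, (proj.obj a ⟶
      proj.obj b) → Prop}
    (id : motive a (𝟙 _))
    (comp : ∀ {b c : Cyclic.Words} (f : proj.obj a ⟶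
      proj.obj b) (g : Cyclic.Gen b c), motive b f →
        motive c (f ≫ gen g)) {b : Cyclic.Words}
    (f : proj.obj a ⟶
      proj.obj b) : motive b f := by
  obtain ⟨p, rfl⟩ := proj.map_surjective f
  exact @Quiver.Path.rec Cyclic.Vertex _ a (fun b p => motive b (proj.map p)) id
    (fun p g ih => comp (proj.map p) g ih) b p

/-- No generator ends at `0`, so the only map into `0` is its identity. -/
theorem hom_zero_eq {a : Cyclic.Words} (f g : proj.obj a ⟶ num 0) :
    f = g := by
  have key : ∀ {b : Cyclic.Words} (f : proj.obj a ⟶ proj.obj b), b = Cyclic.num 0 →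
      ∃ h : a = b, f = eqToHom (congrArg proj.obj h) := by
    intro b f
    induction f using hom_cases with
    | id => exact fun _ => ⟨rfl, rfl⟩
    | comp f g hf => cases g <;> nofun
  obtain ⟨_, rfl⟩ := key f rfl
  obtain ⟨_, rfl⟩ := key g rfl
  rfl

/-- No generator starts at the last object. -/
theorem star_hom_eq {b : Cyclic.Words} (f g : star ⟶ proj.obj b) :
    f = g := by
  have key : ∀ {b : Cyclic.Words} (f : star ⟶ proj.obj b),
      ∃ h : Cyclic.star = b, f = eqToHom (congrArg proj.obj h) := by
    intro b f
    induction f using hom_cases with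
    | id => exact ⟨rfl, rfl⟩
    | comp f g hf =>
      obtain ⟨rfl, -⟩ := hf
      cases g
  obtain ⟨_, rfl⟩ := key f
  obtain ⟨_, rfl⟩ := key g
  rfl

instance isSplitEpi_s {n : ℕ} (i : Fin (n + 1)) : IsSplitEpi (s i) :=
  ⟨⟨⟨d i.castSucc, map_eq (.d_s_self i)⟩⟩⟩

instance isSplitEpi_τ (n : ℕ) : IsSplitEpi (τ n) :=
  ⟨⟨⟨proj.map
    ((show End (Cyclic.num (n + 1)) from Cyclic.τ n) ^ n), by
      rw [← Functor.map_comp]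
      have h := map_eq (.τ_pow n)
      rw [pow_succ'] at h
      exact h⟩⟩⟩

/-- A codegeneracy is a retraction, except for the coface out of `0`, which has none; that one is
mono because maps into `0` are unique. -/
instance mono_d {n : ℕ} (i : Fin (n + 1)) : Mono (d i) := by
  cases n with
  | zero => exact ⟨fun f g _ => hom_zero_eq f g⟩
  | succ n =>
    have : ∃ j : Fin (n + 1), d i ≫ s j = 𝟙 _ := by
      induction i using Fin.lastCases with
      | last => exact ⟨Fin.last n, map_eq (.d_s_succ (Fin.last n))⟩
      | cast i => exact ⟨i, map_eq (.d_s_self i)⟩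
    obtain ⟨j, hj⟩ := this
    exact SplitMono.mono ⟨_, hj⟩

theorem injective.mono {X Y : BiaugmentedCyclic} {f : X ⟶ Y} (hf : injective f) : Mono f := by
  induction hf with
  | id n => infer_instance
  | comp f i hf ih => exact mono_comp f (d i)

/-- The left class of a factorization system on `Λ'`. -/
inductive LeftClass : ∀ {X Y : BiaugmentedCyclic}, (X ⟶ Y) → Prop
  | split {n m : ℕ} (f : num n ⟶ num m) (h : IsSplitEpi f) : LeftClass f
  | toStar {X : BiaugmentedCyclic} (f : X ⟶ star) : LeftClass f

/-- The right class of a factorization system on `Λ'`. -/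
inductive RightClass : ∀ {X Y : BiaugmentedCyclic}, (X ⟶ Y) → Prop
  | inj {n m : ℕ} (f : num n ⟶ num m) (h : injective f) : RightClass f
  | id_star : RightClass (𝟙 star)

theorem LeftClass.id (a : Cyclic.Words) :
    LeftClass (𝟙 (proj.obj a)) := by
  cases a with
  | num n => exact .split _ inferInstance
  | star => exact .toStar _

theorem RightClass.id (a : Cyclic.Words) :
    RightClass (𝟙 (proj.obj a)) := by
  cases a with
  | num n => exact .inj _ (.id n)
  | star => exact .id_star

theorem LeftClass.comp {X Y Z : BiaugmentedCyclic} {f : X ⟶ Y} {g : Y ⟶ Z} (hf : LeftClass f)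
    (hg : LeftClass g) : LeftClass (f ≫ g) := by
  cases hg with
  | split g h' =>
    cases hf with
    | split f h => exact .split _ inferInstance
  | toStar g => exact .toStar _

/-- A map to the last object is epi for lack of distinct maps out of it. -/
theorem LeftClass.epi {X Y : BiaugmentedCyclic} {f : X ⟶ Y} (hf : LeftClass f) : Epi f := by
  cases hf with
  | split f h => infer_instance
  | toStar f => exact ⟨fun {Z} g h _ => star_hom_eq (b := Z.as) g h⟩

theorem RightClass.injective_or_isIso {X Y : BiaugmentedCyclic} {f : X ⟶ Y} (hf : RightClass f) :
    injective f ∨ IsIso f := by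
  cases hf with
  | inj f hf => exact .inl hf
  | id_star => exact .inr inferInstance

theorem injective.comp_injective {X Y Z : BiaugmentedCyclic} {f : X ⟶ Y} {g : Y ⟶ Z}
    (hg : injective g) (hf : injective f) : injective (f ≫ g) := by
  induction hg with
  | id n => rwa [Category.comp_id]
  | comp g i hg ih =>
    have h := ih hf
    rw [← Category.assoc]
    cases hf with
    | id n => exact .comp _ i h
    | comp f j hf => exact .comp _ i h

theorem RightClass.comp_injective {X Y Z : BiaugmentedCyclic} {f : X ⟶ Y} {g : Y ⟶ Z}
    (hf : RightClass f) (hg : injective g) : RightClass (f ≫ g) := by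
  cases hf with
  | inj f hf =>
    have h := hg.comp_injective hf
    cases hg with
    | id n => exact .inj _ h
    | comp g i hg => exact .inj _ h
  | id_star => cases hg

/-- Morphisms which factor as a map of the left class followed by one of the right class. -/
def Factors {X Y : BiaugmentedCyclic} (f : X ⟶ Y) : Prop :=
  ∃ (Z : BiaugmentedCyclic) (e : X ⟶ Z) (m : Z ⟶ Y), LeftClass e ∧ RightClass m ∧ e ≫ m = f

theorem LeftClass.factors {a : BiaugmentedCyclic} {b : Cyclic.Words}
    {f : a ⟶ proj.obj b} (hf : LeftClass f) : Factors f :=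
  ⟨_, f, 𝟙 _, hf, .id b, Category.comp_id f⟩

theorem Factors.comp_d {X : BiaugmentedCyclic} {n : ℕ} {f : X ⟶ num n} (hf : Factors f)
    (i : Fin (n + 1)) : Factors (f ≫ d i) := by
  obtain ⟨Z, e, m, he, hm, rfl⟩ := hf
  cases hm with
  | inj m hm => exact ⟨_, e, m ≫ d i, he, .inj _ (.comp m i hm), (Category.assoc _ _ _).symm⟩

/-- The cosimplicial identities cancel the pair or interchange it. An interchange passes through an
object with one element less and needs `n ≥ 1`; `eqToHom` records this reindexing. -/
theorem d_comp_s {n : ℕ} (j : Fin (n + 2)) (i : Fin (n + 1)) :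
    d j ≫ s i = 𝟙 (num (n + 1)) ∨ ∃ (k : ℕ) (h : n = k + 1) (i' : Fin (k + 1)) (j' : Fin (k + 2)),
      d j ≫ s i = eqToHom (by rw [h]) ≫ s i' ≫ d j' ≫ eqToHom (by rw [h]) := by
  rcases lt_trichotomy j i.castSucc with hi | rfl | hi
  · right
    cases n with
    | zero => exact absurd hi (by simp [Fin.eq_zero i])
    | succ n =>
      obtain ⟨i, rfl⟩ := Fin.exists_succ_eq.2 (show i ≠ 0 by rintro rfl; exact absurd hi (by simp))
      obtain ⟨j, rfl⟩ := Fin.exists_castSucc_eq.2 (Fin.ne_last_of_lt hi)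
      refine ⟨n, rfl, i, j, ?_⟩
      rw [eqToHom_refl, Category.id_comp, Category.comp_id]
      refine map_eq (.d_s_lt j i ?_)
      simp only [Fin.lt_def, Fin.le_def, Fin.val_castSucc, Fin.val_succ] at hi ⊢
      omega
  · exact .inl (map_eq (.d_s_self i))
  · obtain ⟨j, rfl⟩ := Fin.exists_succ_eq.2 (Fin.ne_zero_of_lt hi)
    by_cases hij : j = i
    · subst hij
      exact .inl (map_eq (.d_s_succ j))
    · right
      have hlt : i < j := by
        refine lt_of_le_of_ne ?_ (Ne.symm hij)
        simp only [Fin.lt_def, Fin.le_def, Fin.val_castSucc, Fin.val_succ] at hi ⊢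
        omega
      cases n with
      | zero => exact absurd (Fin.ext (by omega)) hij
      | succ n =>
        obtain ⟨i, rfl⟩ := Fin.exists_castSucc_eq.2 (Fin.ne_last_of_lt hlt)
        refine ⟨n, rfl, i, j, ?_⟩
        rw [eqToHom_refl, Category.id_comp, Category.comp_id]
        exact map_eq (.d_s_gt j i hlt)

/-- Pushing a generator through a coface. -/
theorem Factors.comp_gen {X : BiaugmentedCyclic} {n : ℕ} {f : X ⟶ num n} (hf : injective f)
    {c : Cyclic.Words} (g : Cyclic.Gen (.num n) c) : Factors (f ≫ gen g) := by
  -- Induction on a composite of cofaces needs a variable target, while the generator needs a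
  -- numbered one; `eqToHom` mediates.
  suffices key : ∀ {Y : BiaugmentedCyclic} {f : X ⟶ Y}, injective f → ∀ (n : ℕ) (h : Y = num n)
      (g : Cyclic.Gen (.num n) c), Factors ((f ≫ eqToHom h) ≫ gen g) by
    simpa using key hf n rfl g
  clear hf g f n
  intro Y f hf
  induction hf generalizing c with
  | id n =>
    intro n' h g
    cases h
    rw [eqToHom_refl, Category.comp_id, Category.id_comp]
    cases g with
    | d i =>
      exact ⟨_, 𝟙 _, 𝟙 _ ≫ d i, .id _, .inj _ (.comp _ i (.id n)),
        (Category.id_comp _).trans (Category.id_comp _)⟩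
    | s i => exact LeftClass.factors (.split _ (isSplitEpi_s i))
    | τ n => exact LeftClass.factors (.split _ (isSplitEpi_τ n))
    | t => exact LeftClass.factors (.toStar _)
  | @comp n m f j hf ih =>
    intro n' h g
    cases h
    rw [eqToHom_refl, Category.comp_id, Category.assoc]
    have hf' : Factors f := ⟨_, 𝟙 _, f, .id _, .inj _ hf, Category.id_comp _⟩
    have ih' : ∀ {c : Cyclic.Words} (g : Cyclic.Gen (.num m) c), Factors (f ≫ gen g) := fun g => by
      simpa using ih m rfl g
    cases g with
    | d i =>
      rw [← Category.assoc]
      exact (hf'.comp_d j).comp_d i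
    | s i =>
      rcases d_comp_s j i with h | ⟨k, rfl, i', j', h⟩
      · change Factors (f ≫ d j ≫ s i)
        rw [h, Category.comp_id]
        exact hf'
      · change Factors (f ≫ d j ≫ s i)
        rw [h, eqToHom_refl, Category.id_comp, Category.comp_id, ← Category.assoc]
        exact (ih' (.s i')).comp_d j'
    | τ n =>
      -- The cycle map turns the first coface into the last one and disappears; past any other
      -- coface it moves to the left.
      induction j using Fin.cases with
      | zero =>
        have : d 0 ≫ τ m = d (Fin.last m) := map_eq (.d_zero_τ m)
        change Factors (f ≫ d 0 ≫ τ m)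
        rw [this]
        exact hf'.comp_d _
      | succ j =>
        cases m with
        | zero => exact j.elim0
        | succ m =>
          have : d j.succ ≫ τ (m + 1) = τ m ≫ d j.castSucc := map_eq (.d_τ j)
          change Factors (f ≫ d j.succ ≫ τ (m + 1))
          rw [this, ← Category.assoc]
          exact (ih' (.τ m)).comp_d _
    | t => exact LeftClass.factors (.toStar _)

theorem RightClass.comp_gen {X : BiaugmentedCyclic} {b c : Cyclic.Words} {m : X ⟶ proj.obj b}
    (hm : RightClass m) (g : Cyclic.Gen b c) : Factors (m ≫ gen g) := by
  suffices key : ∀ {Y : BiaugmentedCyclic} {m : X ⟶ Y}, RightClass m → ∀ (b : Cyclic.Words)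
      (h : Y = proj.obj b) (g : Cyclic.Gen b c), Factors ((m ≫ eqToHom h) ≫ gen g) by
    simpa using key hm b rfl g
  clear hm g m b
  intro Y m hm
  cases hm with
  | inj m hm =>
    intro b h g
    cases h
    rw [eqToHom_refl, Category.comp_id]
    exact Factors.comp_gen hm g
  | id_star =>
    intro b h g
    cases h
    cases g

/-- Generators are adjoined one at a time: a new one is pushed to the left through the right factor,
and the left factors compose. -/
theorem factors_map {a b : Cyclic.Words} (f : proj.obj a ⟶ proj.obj b) : Factors f := by
  induction f using hom_cases with
  | id => exact (LeftClass.id a).factors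
  | comp f g hf =>
    obtain ⟨Z, e, m, he, hm, rfl⟩ := hf
    rw [Category.assoc]
    have : Factors (m ≫ gen g) := hm.comp_gen g
    obtain ⟨Z', e', m', he', hm', h⟩ := this
    exact ⟨_, e ≫ e', m', he.comp he', hm', by rw [Category.assoc, h]⟩

theorem factors {X Y : BiaugmentedCyclic} (f : X ⟶ Y) : Factors f :=
  factors_map (a := X.as) (b := Y.as) f

/-- Between numbered objects, a section of `e` followed by `e'` is the filler, since `m'` is mono.
At the last object the right factors are identities. -/
theorem exists_diagonal {X Y A A' : BiaugmentedCyclic} {e : X ⟶ A} {m : A ⟶ Y} {e' : X ⟶ A'}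
    {m' : A' ⟶ Y} (he : LeftClass e) (hm : RightClass m) (hm' : RightClass m')
    (h : e ≫ m = e' ≫ m') : ∃ φ : A ⟶ A', e ≫ φ = e' ∧ φ ≫ m' = m := by
  cases hm with
  | inj m hm =>
    cases hm' with
    | inj m' hm' =>
      cases he with
      | split e he =>
        have := hm'.mono
        refine ⟨section_ e ≫ e', ?_, ?_⟩
        · rw [← cancel_mono m', Category.assoc, Category.assoc, ← h, IsSplitEpi.id_assoc]
        · rw [Category.assoc, ← h, IsSplitEpi.id_assoc]
  | id_star =>
    cases hm' with
    | id_star => exact ⟨𝟙 _, by simpa using h, Category.comp_id _⟩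

/-! ### Images in the comma category -/

section Comma

variable {n : ℕ}

/-- The image of an object of the comma category, with its inclusion. -/
structure Image (X : Under (num n)) where
  obj : Under (num n)
  map : obj ⟶ X
  left : LeftClass obj.hom
  right : RightClass map.right

theorem nonempty_image (X : Under (num n)) : Nonempty (Image X) := by
  obtain ⟨Z, e, m, he, hm, h⟩ := factors X.hom
  exact ⟨⟨Under.mk e, Under.homMk m h, he, hm⟩⟩

/-- The image of an object of the comma category. -/
noncomputable def image (X : Under (num n)) : Image X := (nonempty_image X).some

/-- A map under `n` is determined by its composite with the structure map of its source, which here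
is epi. Functoriality and naturality of images become automatic. -/
theorem subsingleton_image_hom {X : Under (num n)} (A : Image X) (Z : Under (num n)) :
    Subsingleton (A.obj ⟶ Z) := by
  have := A.left.epi
  refine ⟨fun f g => Under.UnderMorphism.ext ?_⟩
  rw [← cancel_epi A.obj.hom, Under.w, Under.w]

/-- Two images of the same object are related by a map over it. -/
theorem exists_image_hom {X : Under (num n)} (A B : Image X) :
    ∃ f : A.obj ⟶ B.obj, f ≫ B.map = A.map := by
  obtain ⟨φ, h₁, h₂⟩ := exists_diagonal A.left A.right B.right
    ((Under.w A.map).trans (Under.w B.map).symm)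
  exact ⟨Under.homMk φ h₁, Under.UnderMorphism.ext h₂⟩

theorem exists_image_map {X Y : Under (num n)} (A : Image X) (B : Image Y) (f : X ⟶ Y) :
    ∃ g : A.obj ⟶ B.obj, g ≫ B.map = A.map ≫ f := by
  obtain ⟨Z, e, m, he, hm, h⟩ := factors (A.map ≫ f).right
  -- The left factor of the composite prolongs the structure map of `A` within the left class, so
  -- the intermediate object is another image of `Y`, to be compared with `B`.
  let Z' : Image Y :=
    ⟨Under.mk (A.obj.hom ≫ e), Under.homMk m (by
      have := Under.w (A.map ≫ f)
      rw [← this, ← h]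
      exact Category.assoc _ _ _), A.left.comp he, hm⟩
  obtain ⟨g, hg⟩ := exists_image_hom Z' B
  refine ⟨Under.homMk e rfl ≫ g, ?_⟩
  rw [Category.assoc, hg]
  exact Under.UnderMorphism.ext h

/-- The image functor on the comma category. -/
noncomputable def imageFunctor (n : ℕ) : Under (num n) ⥤ Under (num n) where
  obj X := (image X).obj
  map f := (exists_image_map (image _) (image _) f).choose
  map_id _ := (subsingleton_image_hom _ _).elim _ _
  map_comp _ _ := (subsingleton_image_hom _ _).elim _ _

/-- The inclusion of the image. -/
noncomputable def imageInclusion (n : ℕ) : imageFunctor n ⟶ 𝟭 _ where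
  app X := (image X).map
  naturality _ _ f := (exists_image_map (image _) (image _) f).choose_spec

/-- If `f` is in the inverted class, the image of `X` followed by `f` is also an image of `Y`. The
comparison map back is inverse to the induced one, since maps out of images are unique. -/
theorem isInvertedBy_imageFunctor (n : ℕ) :
    (injective.inverseImage (Under.forget (num n))).IsInvertedBy (imageFunctor n) := by
  intro X Y f hf
  have hA : RightClass ((image X).map ≫ f).right := (image X).right.comp_injective hf
  obtain ⟨g, hg⟩ := exists_image_hom (image Y) ⟨(image X).obj, (image X).map ≫ f, (image X).left, hA⟩
  exact ⟨g, (subsingleton_image_hom _ _).elim _ _, (subsingleton_image_hom _ _).elim _ _⟩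

theorem isIso_map_imageInclusion (X : Under (num n)) :
    IsIso ((injective.inverseImage (Under.forget (num n))).Q.map ((imageInclusion n).app X)) := by
  have key : injective (image X).map.right ∨ IsIso (image X).map.right :=
    (image X).right.injective_or_isIso
  -- The identity of the last object is not among the maps to be inverted, but it is already an
  -- isomorphism.
  rcases key with h | h
  · exact Localization.inverts _ (injective.inverseImage (Under.forget (num n))) _ h
  · have : IsIso ((Under.forget (num n)).map (image X).map) := h
    have : IsIso (image X).map := isIso_of_reflects_iso _ (Under.forget (num n))
    exact Functor.map_isIso _ (image X).map

theorem isThin_localizedComma (n : ℕ) : Quiver.IsThin (LocalizedComma n) :=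
  isThin_localization _ (imageFunctor n) (imageInclusion n) (isInvertedBy_imageFunctor n)
    isIso_map_imageInclusion (fun X => subsingleton_image_hom (image X))

end Comma

end BiaugmentedCyclic

end ShadowCoherence

theorem mainTheorem7
    {C : Type u₁} [Bicategory.{w₁, v₁} C] {TC : Type t} [Category.{t₁} TC]
    {D : Type u₂} [Bicategory.{w₂, v₂} D] {TD : Type t₂} [Category.{t₃} TD]
    (SC : Shadow C TC) (SD : Shadow D TD) {J : Type u} [Category.{v} J] (K : J ⥤ TD) :
    (∀ Φ : NormalLaxShadowFunctor SC SD, Φ.IsFormalWithEqualPermutations K → Commutes K) ∧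
    (∀ Φ : NormalOplaxShadowFunctor SC SD, Φ.IsFormalWithEqualPermutations K → Commutes K) ∧
    (∀ n : ℕ, Quiver.IsThin (BiaugmentedCyclic.LocalizedComma n)) :=
  ⟨fun _ h => h.commutes, fun _ h => h.commutes, BiaugmentedCyclic.isThin_localizedComma⟩
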